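/- \textbf{Definitions.} An instance of $(n-k)$-Regular List Coloring is a finite simple graph $G$ on $n$ vertices, an integer $k\ge 0$, and for every vertex $v$ a list $L(v)$ of exactly $n-k$ colors; the question is whether $G$ has a proper list coloring (adjacent vertices get distinct colors, and each vertex $v$ gets a color of $L(v)$). An instance of Budget-Constrained List Coloring is a finite simple graph $G$, a finite set $T$ of colors, a list $L(v)\subseteq T$ for every vertex $v$, and a pair $(T',q)$ with $T'\subseteq T$ and $q\in\mathbb N$; the question is whether $G$ has a proper list coloring that uses at most $q$ distinct colors from $T'$. A partial list coloring of a graph $G$ on a vertex set $V'\subseteq V(G)$ is a map $\lambda_0$ that assigns to each $v\in V'$ a color of $L(v)$, with $\lambda_0(u)\neq\lambda_0(v)$ for all adjacent $u,v\in V'$. \textbf{Theorem.} There is an absolute constant $A$ such that the following holds. (1) There is a polynomial-time algorithm that transforms every instance $I=(G,k,L)$ of $(n-k)$-Regular List Coloring into an equivalent instance $J$ of Budget-Constrained List Coloring (that is, $I$ is a yes-instance if and only if $J$ is one) such that $J$ has at most $11k$ vertices and at most $A\,k^2$ colors, and the binary encoding of $J$ has at most $A\,(k^2\lfloor\log_2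 k\rfloor+1)$ bits (with $\lfloor\log_2 0\rfloor$ read as $0$). Here $J$ is encoded by the adjacency matrix of its graph, the characteristic vector of $T'$, the numbers of vertices and of colors and the number $q$ in binary, and for every vertex $v$ the enumeration of the missing colors $T\setminus L(v)$, with each color written in binary. (2) There is a polynomial-time algorithm that computes, for every instance $(G,k,L)$ of $(n-k)$-Regular List Coloring with $n\ge 11k$, a set $V'\subseteq V(G)$ with $|V'|\le 7k$, a set $T'\subseteq\bigcup_{v\in V(G)}L(v)$ of colors and a number $q\in\mathbb N$ such that $G$ has a proper list coloring if and only if there is a partial list coloring of $G$ on $V'$ that uses at most $q$ distinct colors from $T'$. -/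

import Mathlib

/-! ### List colorings -/

/-- `col` is a proper list coloring of the induced subgraph `G[S]`, i.e. a partial list coloring of
`G` with scope `S`: every vertex of `S` gets a color of its list, and adjacent vertices of `S` get
distinct colors. (Values of `col` outside `S` are irrelevant.) -/
def IsPartialListColoring {V γ : Type} (G : SimpleGraph V) (L : V → Finset γ) (S : Finset V)
    (col : V → γ) : Prop :=
  (∀ v ∈ S, col v ∈ L v) ∧ ∀ u ∈ S, ∀ v ∈ S, G.Adj u v → col u ≠ col v

/-- `col` is a proper list coloring of `G`. -/
def IsListColoring {V γ : Type} (G : SimpleGraph V) (L : V → Finset γ) (col : V → γ) : Prop :=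
  (∀ v, col v ∈ L v) ∧ ∀ u v, G.Adj u v → col u ≠ col v

/-- An instance of (n-k)-Regular List Coloring: a graph on `n` vertices, a parameter `k`, and for
every vertex a list of exactly `n - k` colors. Colors are natural numbers. -/
structure RegularInstance where
  n : ℕ
  k : ℕ
  graph : SimpleGraph (Fin n)
  lists : Fin n → Finset ℕ
  regular : ∀ v, (lists v).card + k = n

/-- The question of (n-k)-Regular List Coloring. -/
def RegularInstance.IsYes (I : RegularInstance) : Prop :=
  ∃ col : Fin I.n → ℕ, IsListColoring I.graph I.lists col

/-- The set `T` of all colors that occur in some list. -/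
def RegularInstance.colors (I : RegularInstance) : Finset ℕ :=
  Finset.univ.biUnion I.lists

/-- An instance of Budget-Constrained List Coloring: a graph on `n` vertices, a set
`T = {0, …, c - 1}` of `c` colors, a list `L(v) ⊆ T` for every vertex `v`, and a pair `(T', q)` with
`T' ⊆ T` and `q ∈ ℕ`. -/
structure BudgetInstance where
  n : ℕ
  c : ℕ
  graph : SimpleGraph (Fin n)
  lists : Fin n → Finset (Fin c)
  special : Finset (Fin c)
  budget : ℕ

/-- The question of Budget-Constrained List Coloring: is there a proper list coloring that uses at
most `q` distinct colors from `T'`? -/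
def BudgetInstance.IsYes (J : BudgetInstance) : Prop :=
  ∃ col : Fin J.n → Fin J.c, IsListColoring J.graph J.lists col ∧
    (Finset.univ.image col ∩ J.special).card ≤ J.budget

/-! ### Binary encoding of instances of Budget-Constrained List Coloring -/

/-- Self-delimiting binary code of a natural number: every binary digit is preceded by `1`, and a
final `0` marks the end. -/
def natCode (m : ℕ) : List Bool :=
  (Nat.bits m).flatMap (fun b => [true, b]) ++ [false]

/-- The adjacency matrix, row by row. -/
noncomputable def adjRows {n : ℕ} (G : SimpleGraph (Fin n)) : List (List Bool) :=
  open Classical in List.ofFn fun i : Fin n => List.ofFn fun j : Fin n => decide (G.Adj i j)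

/-- Code of a finite set of colors: its size, followed by its elements in increasing order. -/
def colorSetCode {c : ℕ} (A : Finset (Fin c)) : List Bool :=
  natCode A.card ++ (A.sort (· ≤ ·)).flatMap fun a => natCode a.val

/-- The binary encoding of an instance: `n`, `c` and `q`, the adjacency matrix, the characteristic
vector of `T'`, and, for every vertex `v`, the set `T \ L(v)` of the colors missing at `v`. -/
noncomputable def BudgetInstance.encode (J : BudgetInstance) : List Bool :=
  natCode J.n ++ natCode J.c ++ natCode J.budget ++ (adjRows J.graph).flatten ++
    List.ofFn (fun a : Fin J.c => decide (a ∈ J.special)) ++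
    (List.ofFn fun v : Fin J.n => colorSetCode (J.lists v)ᶜ).flatten

theorem natCode_prefix {a b : ℕ} {s t : List Bool} (h : natCode a ++ s = natCode b ++ t) :
    a = b ∧ s = t := by
  have key : ∀ (l l' : List Bool),
      l.flatMap (fun b => [true, b]) ++ [false] ++ s =
        l'.flatMap (fun b => [true, b]) ++ [false] ++ t → l = l' ∧ s = t := by
    intro l
    induction l with
    | nil => intro l' h; cases l' <;> simp_all
    | cons x l ih =>
      intro l' h
      cases l' with
      | nil => simp at h
      | cons y l' =>
        simp only [List.flatMap_cons, List.cons_append, List.nil_append, List.cons.injEq,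
          true_and] at h
        obtain ⟨h1, h2⟩ := ih l' h.2
        exact ⟨by rw [h.1, h1], h2⟩
  obtain ⟨h1, h2⟩ := key _ _ h
  refine ⟨?_, h2⟩
  rw [← Nat.ofDigits_digits 2 a, ← Nat.ofDigits_digits 2 b, Nat.digits_two_eq_bits,
    Nat.digits_two_eq_bits, h1]

theorem colorSetCode_prefix {c : ℕ} {A B : Finset (Fin c)} {s t : List Bool}
    (h : colorSetCode A ++ s = colorSetCode B ++ t) : A = B ∧ s = t := by
  have key : ∀ (l l' : List (Fin c)), l.length = l'.length →
      l.flatMap (fun a => natCode a.val) ++ s = l'.flatMap (fun a => natCode a.val) ++ t →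
        l = l' ∧ s = t := by
    intro l
    induction l with
    | nil => intro l' hl h; cases l' <;> simp_all
    | cons x l ih =>
      intro l' hl h
      cases l' with
      | nil => simp at hl
      | cons y l' =>
        simp only [List.flatMap_cons, List.append_assoc] at h
        obtain ⟨h1, h2⟩ := natCode_prefix h
        obtain ⟨h3, h4⟩ := ih l' (by simpa using hl) h2
        exact ⟨by rw [Fin.ext h1, h3], h4⟩
  unfold colorSetCode at h
  rw [List.append_assoc, List.append_assoc] at h
  obtain ⟨h1, h2⟩ := natCode_prefix h
  obtain ⟨h3, h4⟩ := key _ _ (by simpa using h1) h2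
  refine ⟨?_, h4⟩
  have := congrArg List.toFinset h3
  simpa using this

/-- Different instances have different codes. -/
theorem BudgetInstance.encode_injective : Function.Injective BudgetInstance.encode := by
  rintro ⟨n, c, G, L, S, q⟩ ⟨n', c', G', L', S', q'⟩ h
  simp only [BudgetInstance.encode, List.append_assoc] at h
  obtain ⟨rfl, h⟩ := natCode_prefix h
  obtain ⟨rfl, h⟩ := natCode_prefix h
  obtain ⟨rfl, h⟩ := natCode_prefix h
  obtain ⟨h1, h⟩ := List.append_inj h (by simp [adjRows, List.length_flatten, Function.comp_def])
  obtain ⟨h2, h⟩ := List.append_inj h (by simp)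
  have hS : S = S' := by
    ext a
    have := congrFun (List.ofFn_injective h2) a
    simpa using this
  have hG : G = G' := by
    have key : ∀ l l' : List (List Bool), l.length = l'.length → (∀ x ∈ l, x.length = n) →
        (∀ x ∈ l', x.length = n) → l.flatten = l'.flatten → l = l' := by
      intro l
      induction l with
      | nil => intro l' hl; cases l' <;> simp_all
      | cons x l ih =>
        intro l' hl hx hy h
        cases l' with
        | nil => simp at hl
        | cons y l' =>
          simp only [List.flatten_cons] at h
          obtain ⟨e1, e2⟩ := List.append_inj h
            ((hx x (by simp)).trans (hy y (by simp)).symm)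
          rw [e1, ih l' (by simpa using hl) (fun z hz => hx z (by simp [hz]))
            (fun z hz => hy z (by simp [hz])) e2]
    have e := key _ _ (by simp [adjRows]) (by simp [adjRows]) (by simp [adjRows]) h1
    ext i j
    have := congrFun (List.ofFn_injective (congrFun (List.ofFn_injective e) i)) j
    simpa using this
  have hL : L = L' := by
    have key : ∀ l l' : List (Finset (Fin c)), l.length = l'.length →
        (l.map colorSetCode).flatten = (l'.map colorSetCode).flatten → l = l' := by
      intro l
      induction l with
      | nil => intro l' hl; cases l' <;> simp_all
      | cons x l ih =>
        intro l' hl h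
        cases l' with
        | nil => simp at hl
        | cons y l' =>
          simp only [List.map_cons, List.flatten_cons] at h
          obtain ⟨e1, e2⟩ := colorSetCode_prefix h
          rw [e1, ih l' (by simpa using hl) e2]
    have e := key (List.ofFn fun v => (L v)ᶜ) (List.ofFn fun v => (L' v)ᶜ) (by simp)
      (by simpa [List.map_ofFn, Function.comp_def] using h)
    funext v
    exact compl_injective (congrFun (List.ofFn_injective e) v)
  subst hS hG hL
  rfl

/-! ### A machine model with a step count

Programs of a first-order WHILE language over binary trees (as in LISP). Every elementary operation
costs one step and allocates at most one new cell, so that, with trees stored as shared pointer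
structures, `t` steps are simulated by a Turing machine in time polynomial in `t` and the size of
the input, and conversely. -/

/-- Binary trees, the data on which programs operate. -/
inductive Data where
  | nil : Data
  | cons : Data → Data → Data

namespace Data

/-- The number of nodes. -/
def size : Data → ℕ
  | nil => 1
  | cons a b => a.size + b.size + 1

/-- Finite sequences, as right combs. -/
def ofList : List Data → Data
  | [] => nil
  | a :: l => cons a (ofList l)

def ofBool : Bool → Data
  | false => nil
  | true => cons nil nil

/-- Bit strings. -/
def ofBits (l : List Bool) : Data := ofList (l.map ofBool)

/-- Numbers in unary. -/
def ofUnary (m : ℕ) : Data := ofList (List.replicate m nil)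

/-- Numbers in binary, least significant bit first. -/
def ofNat (m : ℕ) : Data := ofBits (Nat.bits m)

/-- Finite sets of numbers, as increasing lists of binary numbers. -/
def ofFinset (A : Finset ℕ) : Data := ofList ((A.sort (· ≤ ·)).map ofNat)

end Data

/-- Programs; each transforms one tree into another. -/
inductive Prog where
  /-- return the input -/
  | id : Prog
  /-- return the empty tree -/
  | nil : Prog
  /-- return the left subtree -/
  | hd : Prog
  /-- return the right subtree -/
  | tl : Prog
  /-- run both programs on the input and pair the results -/
  | pair (p q : Prog) : Prog
  /-- run `p`, then run `q` on its result -/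
  | seq (p q : Prog) : Prog
  /-- run the test `c`; run `p` on the input if the result is nonempty, else `q` -/
  | ite (c p q : Prog) : Prog
  /-- as long as the test `c` gives a nonempty result, replace the state by the result of `p` -/
  | loop (c p : Prog) : Prog

/-- `Run p x y t`: program `p`, started on `x`, halts after exactly `t` steps with output `y`. -/
inductive Run : Prog → Data → Data → ℕ → Prop where
  | id (x : Data) : Run .id x x 1
  | nil (x : Data) : Run .nil x .nil 1
  | hd_nil : Run .hd .nil .nil 1
  | hd_cons (a b : Data) : Run .hd (.cons a b) a 1
  | tl_nil : Run .tl .nil .nil 1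
  | tl_cons (a b : Data) : Run .tl (.cons a b) b 1
  | pair {p q : Prog} {x a b : Data} {s t : ℕ} (hp : Run p x a s) (hq : Run q x b t) :
      Run (.pair p q) x (.cons a b) (s + t + 1)
  | seq {p q : Prog} {x y z : Data} {s t : ℕ} (hp : Run p x y s) (hq : Run q y z t) :
      Run (.seq p q) x z (s + t + 1)
  | ite_true {c p q : Prog} {x a b y : Data} {s t : ℕ} (hc : Run c x (.cons a b) s)
      (hp : Run p x y t) : Run (.ite c p q) x y (s + t + 1)
  | ite_false {c p q : Prog} {x y : Data} {s t : ℕ} (hc : Run c x .nil s)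
      (hq : Run q x y t) : Run (.ite c p q) x y (s + t + 1)
  | loop_stop {c p : Prog} {x : Data} {s : ℕ} (hc : Run c x .nil s) :
      Run (.loop c p) x x (s + 1)
  | loop_step {c p : Prog} {x a b y z : Data} {s t u : ℕ} (hc : Run c x (.cons a b) s)
      (hp : Run p x y t) (hl : Run (.loop c p) y z u) : Run (.loop c p) x z (s + t + u + 1)

/-- The model is deterministic: output and step count are determined by program and input. -/
theorem Run.det {p : Prog} {x y : Data} {t : ℕ} (h : Run p x y t) :
    ∀ {y' : Data} {t' : ℕ}, Run p x y' t' → y = y' ∧ t = t' := by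
  induction h with
  | id | nil | hd_nil | hd_cons | tl_nil | tl_cons => intro y' t' h'; cases h'; exact ⟨rfl, rfl⟩
  | pair _ _ ihp ihq =>
    intro y' t' h'
    cases h' with
    | pair hp hq =>
      obtain ⟨rfl, rfl⟩ := ihp hp
      obtain ⟨rfl, rfl⟩ := ihq hq
      exact ⟨rfl, rfl⟩
  | seq _ _ ihp ihq =>
    intro y' t' h'
    cases h' with
    | seq hp hq =>
      obtain ⟨rfl, rfl⟩ := ihp hp
      obtain ⟨rfl, rfl⟩ := ihq hq
      exact ⟨rfl, rfl⟩
  | ite_true _ _ ihc ihp =>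
    intro y' t' h'
    cases h' with
    | ite_true hc hp =>
      obtain ⟨_, rfl⟩ := ihc hc
      obtain ⟨rfl, rfl⟩ := ihp hp
      exact ⟨rfl, rfl⟩
    | ite_false hc hp => exact absurd (ihc hc).1 (by simp)
  | ite_false _ _ ihc ihp =>
    intro y' t' h'
    cases h' with
    | ite_true hc hp => exact absurd (ihc hc).1 (by simp)
    | ite_false hc hp =>
      obtain ⟨_, rfl⟩ := ihc hc
      obtain ⟨rfl, rfl⟩ := ihp hp
      exact ⟨rfl, rfl⟩
  | loop_stop _ ihc =>
    intro y' t' h'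
    cases h' with
    | loop_stop hc => exact ⟨rfl, by rw [(ihc hc).2]⟩
    | loop_step hc _ _ => exact absurd (ihc hc).1 (by simp)
  | loop_step _ _ _ ihc ihp ihl =>
    intro y' t' h'
    cases h' with
    | loop_stop hc => exact absurd (ihc hc).1 (by simp)
    | loop_step hc hp hl =>
      obtain ⟨_, rfl⟩ := ihc hc
      obtain ⟨rfl, rfl⟩ := ihp hp
      obtain ⟨rfl, rfl⟩ := ihl hl
      exact ⟨rfl, rfl⟩

/-- Some program, given the input `inp a`, produces the output `out a` for every `a`, in a number
of steps that is polynomial in the size of the input. -/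
def PolyTimeComputable {α : Type} (inp out : α → Data) : Prop :=
  ∃ (p : Prog) (P : Polynomial ℕ), ∀ a, ∃ t ≤ P.eval (inp a).size, Run p (inp a) (out a) t

/-- The input of an algorithm for (n-k)-Regular List Coloring: the parameter in unary, the adjacency
matrix, and the lists of colors. -/
noncomputable def RegularInstance.toData (I : RegularInstance) : Data :=
  .cons (.ofUnary I.k)
    (.cons (.ofList ((adjRows I.graph).map .ofBits))
      (.ofList (List.ofFn fun v => .ofFinset (I.lists v))))

/-- The tree that presents a set `S` of vertices of a graph on `n` vertices (by its characteristic
vector), a set `A` of colors, and a number `q`. -/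
def tripleData {n : ℕ} (S : Finset (Fin n)) (A : Finset ℕ) (q : ℕ) : Data :=
  .cons (.ofBits (List.ofFn fun v => decide (v ∈ S))) (.cons (.ofFinset A) (.ofNat q))

/-! ### Polynomial-time functions between encoded types -/

/-! The main tool, used twice, is a decomposition of a bipartite graph (`HallDecomposition`): a left
set Z has all its neighbors in a right set Q, all of Q is matched into Z, and the left vertices
outside Z are matched outside Q. It is read off from an auction (`auction_spec`), which needs no
augmenting paths.

Take vertices on the left and colors on the right. Vertices outside Z receive private colors outside
Q, while lists of Z lie inside Q, so only Z matters. Either all vertices get distinct colors, or |Q|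
< |Z|; passing to Z lowers n and k by the same amount. From now on there are fewer colors than
vertices, so every vertex misses fewer than k colors and any two lists share more than n - 2k
colors.

Hence k disjoint pairs of nonadjacent vertices make a yes-instance: give each pair a common color
and the rest distinct colors (`colorable_of_pairs`). Otherwise a maximal matching of the complement
graph covers a set U of at most 2k - 2 vertices, and the remaining vertices form a clique C. If n <
11k the instance is kept as it is. If not, let R be the set of colors missing from at least a
quarter of the lists; double counting gives |R| ≤ 4k - 4. Decompose the graph between R ∪ U and C in
which a color is joined to the vertices that may use it and a vertex of U to its nonneighbors. Let Y
be the part of C matched with vertices of U; if |Y| ≥ k, pairs decide again. Put V' = U ∪ Q ∪ Y, T'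
= T \ (R ∩ Z) and q = |T'| - (n - |V'|); if this difference is negative, the answer is no.

The budget is necessary (`DenseInstance.exists_deciding_of_colorable`): vertices of C outside Q
avoid R ∩ Z and have distinct colors, so those outside V' use up n - |V'| colors of T'. A vertex of
U may share a color with them only if it is outside Z; it is then recolored together with its
partner in Y. The budget is sufficient (`DenseInstance.colorable_of_deciding`): unused rare colors
of T' go to their matched vertices, and Hall's condition holds for the rest, since each remaining
color is missing from less than a quarter of the lists and each vertex misses few colors.

For the compression, colors of T' that are in all lists of V' are interchangeable, and |V'| of them
suffice. Only O(k^2) colors remain, and each vertex misses at most k of them. The running time is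
handled by closure properties of the predicate `PT`, proved once for folds and iterations and then
applied to the algorithm by `fun_prop`. -/

theorem Polynomial.eval_mono_nat (P : Polynomial ℕ) {a b : ℕ} (h : a ≤ b) :
    P.eval a ≤ P.eval b := by
  simp only [Polynomial.eval_eq_sum, Polynomial.sum]
  gcongr

/-- Types whose elements are presented as trees. -/
class Enc (α : Type) where
  enc : α → Data

open Enc

/-- The size of the tree presenting `a`. -/
def sz {α : Type} [Enc α] (a : α) : ℕ := (enc a).size

instance : Enc Bool := ⟨Data.ofBool⟩
instance : Enc ℕ := ⟨Data.ofUnary⟩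
instance {α : Type} [Enc α] : Enc (List α) := ⟨fun l => Data.ofList (l.map enc)⟩
instance {α β : Type} [Enc α] [Enc β] : Enc (α × β) := ⟨fun p => .cons (enc p.1) (enc p.2)⟩

/-! ### Sizes of encoded data -/

section Size

variable {α β : Type} [Enc α] [Enc β]

theorem enc_bool (b : Bool) : enc b = Data.ofBool b := rfl
theorem enc_prod (p : α × β) : enc p = .cons (enc p.1) (enc p.2) := rfl
theorem enc_list_cons (a : α) (l : List α) : enc (a :: l) = .cons (enc a) (enc l) := rfl
theorem enc_list (l : List α) : enc l = Data.ofList (l.map enc) := rfl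

theorem sz_prod (p : α × β) : sz p = sz p.1 + sz p.2 + 1 := rfl
theorem sz_nil : sz ([] : List α) = 1 := rfl
theorem sz_cons (a : α) (l : List α) : sz (a :: l) = sz a + sz l + 1 := rfl

theorem sz_bool (b : Bool) : sz b ≤ 3 := by
  cases b <;> simp [sz, enc_bool, Data.ofBool, Data.size]

theorem sz_nat (m : ℕ) : sz m = 2 * m + 1 := by
  induction m with
  | zero => rfl
  | succ m ih =>
    have : sz (m + 1) = 1 + sz m + 1 := rfl
    omega

theorem sz_append (l m : List α) : sz (l ++ m) + 1 = sz l + sz m := by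
  induction l with
  | nil => simp [sz_nil]; omega
  | cons a l ih => simp only [List.cons_append, sz_cons]; omega

theorem sz_le_of_mem {a : α} {l : List α} (h : a ∈ l) : sz a ≤ sz l := by
  induction l with
  | nil => simp at h
  | cons b l ih =>
    rw [sz_cons]
    rcases List.mem_cons.1 h with rfl | h
    · omega
    · have := ih h; omega

theorem length_le_sz (l : List α) : l.length ≤ sz l := by
  induction l with
  | nil => simp
  | cons b l ih => rw [sz_cons, List.length_cons]; omega

end Size

/-- `f` is computed by a program in polynomial time, and its values have polynomial size. -/
@[fun_prop]
def PT {X Y : Type} [Enc X] [Enc Y] (f : X → Y) : Prop :=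
  ∃ (p : Prog) (P : Polynomial ℕ), ∀ x, (∃ t ≤ P.eval (sz x), Run p (enc x) (enc (f x)) t) ∧
    sz (f x) ≤ P.eval (sz x)

/-! ### Closure properties of polynomial-time functions -/

namespace PT

variable {X Y Z α β σ : Type} [Enc X] [Enc Y] [Enc Z] [Enc α] [Enc β] [Enc σ]

theorem size_le {f : X → Y} (hf : PT f) : ∃ P : Polynomial ℕ, ∀ x, sz (f x) ≤ P.eval (sz x) := by
  obtain ⟨_, P, h⟩ := hf
  exact ⟨P, fun x => (h x).2⟩

/-- Programs whose running time is constant and whose output is no larger than the input. -/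
theorem of_prog {f : X → Y} (p : Prog) (T : ℕ) (hp : ∀ x, ∃ t ≤ T, Run p (enc x) (enc (f x)) t)
    (hs : ∀ x, sz (f x) ≤ sz x + T) : PT f := by
  refine ⟨p, Polynomial.X + Polynomial.C T, fun x => ⟨?_, ?_⟩⟩
  · obtain ⟨t, ht, h⟩ := hp x
    exact ⟨t, by simp; omega, h⟩
  · simpa using hs x

@[fun_prop]
theorem id : PT (fun x : X => x) :=
  of_prog .id 1 (fun x => ⟨1, le_rfl, .id _⟩) (fun x => by omega)

theorem exists_prog_const (d : Data) : ∃ (p : Prog) (t : ℕ), ∀ x, Run p x d t := by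
  induction d with
  | nil => exact ⟨.nil, 1, .nil⟩
  | cons a b iha ihb =>
    obtain ⟨p, s, hp⟩ := iha
    obtain ⟨q, t, hq⟩ := ihb
    exact ⟨.pair p q, s + t + 1, fun x => .pair (hp x) (hq x)⟩

@[fun_prop]
theorem const (y : Y) : PT (fun _ : X => y) := by
  obtain ⟨p, t, hp⟩ := exists_prog_const (enc y)
  exact of_prog p (t + sz y) (fun x => ⟨t, by omega, hp _⟩) (fun x => by omega)

-- The size bound built into `PT` is needed here: the second program runs in time polynomial in the
-- intermediate value, which must itself be of polynomial size.
@[fun_prop]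
theorem comp {g : Y → Z} {f : X → Y} (hg : PT g) (hf : PT f) : PT (fun x => g (f x)) := by
  obtain ⟨p, P, hp⟩ := hf
  obtain ⟨q, Q, hq⟩ := hg
  refine ⟨.seq p q, P + Q.comp P + 1, fun x => ⟨?_, ?_⟩⟩
  · obtain ⟨s, hs, h1⟩ := (hp x).1
    obtain ⟨t, ht, h2⟩ := (hq (f x)).1
    refine ⟨s + t + 1, ?_, .seq h1 h2⟩
    have := Q.eval_mono_nat (hp x).2
    simp only [Polynomial.eval_add, Polynomial.eval_comp, Polynomial.eval_one]
    omega
  · have := Q.eval_mono_nat (hp x).2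
    have := (hq (f x)).2
    simp only [Polynomial.eval_add, Polynomial.eval_comp, Polynomial.eval_one]
    omega

@[fun_prop]
theorem pair {f : X → Y} {g : X → Z} (hf : PT f) (hg : PT g) : PT (fun x => (f x, g x)) := by
  obtain ⟨p, P, hp⟩ := hf
  obtain ⟨q, Q, hq⟩ := hg
  refine ⟨.pair p q, P + Q + 1, fun x => ⟨?_, ?_⟩⟩
  · obtain ⟨s, hs, h1⟩ := (hp x).1
    obtain ⟨t, ht, h2⟩ := (hq x).1
    refine ⟨s + t + 1, ?_, .pair h1 h2⟩
    simp only [Polynomial.eval_add, Polynomial.eval_one]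
    omega
  · have h1 := (hp x).2
    have h2 := (hq x).2
    rw [sz_prod]
    simp only [Polynomial.eval_add, Polynomial.eval_one]
    omega

@[fun_prop]
theorem fst : PT (fun p : X × Y => p.1) :=
  of_prog .hd 1 (fun x => ⟨1, le_rfl, .hd_cons _ _⟩) (fun x => by rw [sz_prod]; omega)

@[fun_prop]
theorem snd : PT (fun p : X × Y => p.2) :=
  of_prog .tl 1 (fun x => ⟨1, le_rfl, .tl_cons _ _⟩) (fun x => by rw [sz_prod]; omega)

@[fun_prop]
theorem cond {b : X → Bool} {f g : X → Y} (hb : PT b) (hf : PT f) (hg : PT g) :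
    PT (fun x => bif b x then f x else g x) := by
  obtain ⟨r, R, hr⟩ := hb
  obtain ⟨p, P, hp⟩ := hf
  obtain ⟨q, Q, hq⟩ := hg
  refine ⟨.ite r p q, R + P + Q + 1, fun x => ?_⟩
  simp only [Polynomial.eval_add, Polynomial.eval_one]
  obtain ⟨⟨s, hs, h1⟩, -⟩ := hr x
  cases h : b x with
  | true =>
    obtain ⟨⟨t, ht, h2⟩, h3⟩ := hp x
    rw [h] at h1
    exact ⟨⟨s + t + 1, by omega, .ite_true h1 h2⟩, by simp only [cond_true]; omega⟩
  | false =>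
    obtain ⟨⟨t, ht, h2⟩, h3⟩ := hq x
    rw [h] at h1
    exact ⟨⟨s + t + 1, by omega, .ite_false h1 h2⟩, by simp only [cond_false]; omega⟩

/-- The program that folds `p` over a list, on states `(x, (s, l))`. -/
def foldProg (p : Prog) : Prog :=
  .loop (.seq .tl .tl)
    (.pair .hd (.pair (.seq (.pair .hd (.pair (.seq .tl .hd) (.seq (.seq .tl .tl) .hd))) p)
      (.seq (.seq .tl .tl) .tl)))

/-- One round costs a call of `p` on a triple of size at most `sz x + B + A + 2`, plus a constant
for the loop test and for repacking the state, covered by 30. The final 4 is the failing loop test.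
-/
theorem run_foldProg {f : X → σ → α → σ} {p : Prog} {P : Polynomial ℕ}
    (hp : ∀ q : X × σ × α, ∃ t ≤ P.eval (sz q), Run p (enc q) (enc (f q.1 q.2.1 q.2.2)) t)
    (x : X) (A B : ℕ) (l : List α) (hA : ∀ a ∈ l, sz a ≤ A) (s : σ)
    (hB : ∀ l', l' <+: l → sz (l'.foldl (f x) s) ≤ B) :
    ∃ t ≤ l.length * (P.eval (sz x + B + A + 2) + 30) + 4,
      Run (foldProg p) (enc (x, s, l)) (enc (x, l.foldl (f x) s, ([] : List α))) t := by
  induction l generalizing s with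
  | nil => exact ⟨4, by omega, Run.loop_stop (.seq (.tl_cons _ _) (.tl_cons _ _))⟩
  | cons a l ih =>
    obtain ⟨t, ht, h⟩ := ih (fun b hb => hA b (by simp [hb])) (f x s a)
      (fun l' hl' => hB (a :: l') (by simpa using hl'))
    obtain ⟨u, hu, h'⟩ := hp (x, s, a)
    have h1 : sz (x, s, a) ≤ sz x + B + A + 2 := by
      have := hA a (by simp)
      have := hB [] (by simp)
      simp only [List.foldl_nil] at this
      simp only [sz_prod]
      omega
    have h2 := P.eval_mono_nat h1
    refine ⟨_, ?_, .loop_step (s := 3) (.seq (.tl_cons _ _) (.tl_cons _ _))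
      (.pair (.hd_cons _ _) (.pair (.seq (.pair (.hd_cons _ _) (.pair
        (.seq (.tl_cons _ _) (.hd_cons _ _))
        (.seq (.seq (.tl_cons _ _) (.tl_cons _ _)) (.hd_cons _ _)))) h')
        (.seq (.seq (.tl_cons _ _) (.tl_cons _ _)) (.tl_cons _ _)))) h⟩
    rw [List.length_cons, add_mul]
    omega

/-- The bound on all prefixes cannot be dropped: a step with values of polynomial size may still
blow up the state exponentially when iterated. -/
theorem foldl {f : X → σ → α → σ} {s : X → σ} {l : X → List α}
    (hf : PT (fun p : X × σ × α => f p.1 p.2.1 p.2.2)) (hs : PT s) (hl : PT l)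
    (hb : ∃ Q : Polynomial ℕ, ∀ x l', l' <+: l x → sz (l'.foldl (f x) (s x)) ≤ Q.eval (sz x)) :
    PT (fun x => (l x).foldl (f x) (s x)) := by
  obtain ⟨Q, hQ⟩ := hb
  obtain ⟨p, P, hp⟩ := hf
  obtain ⟨R, hR⟩ := hl.size_le
  have key : PT (fun x => (x, (l x).foldl (f x) (s x), ([] : List α))) := by
    obtain ⟨i, I, hi⟩ : PT (fun x => (x, s x, l x)) := id.pair (hs.pair hl)
    refine ⟨.seq i (foldProg p), I + R * (P.comp (.X + Q + R + 2) + 30) + Q + .X + 10,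
      fun x => ⟨?_, ?_⟩⟩
    · obtain ⟨⟨t, ht, h1⟩, -⟩ := hi x
      obtain ⟨u, hu, h2⟩ := run_foldProg (fun q => (hp q).1) x (R.eval (sz x)) (Q.eval (sz x)) (l x)
        (fun a ha => (sz_le_of_mem ha).trans (hR x)) (s x) (hQ x)
      refine ⟨_, ?_, .seq h1 h2⟩
      have h3 := Nat.mul_le_mul_right (P.eval (sz x + Q.eval (sz x) + R.eval (sz x) + 2) + 30)
        ((length_le_sz _).trans (hR x))
      simp only [Polynomial.eval_add, Polynomial.eval_mul, Polynomial.eval_comp, Polynomial.eval_X,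
        Polynomial.eval_ofNat]
      omega
    · have := hQ x (l x) (List.prefix_refl _)
      simp only [sz_prod, sz_nil, Polynomial.eval_add, Polynomial.eval_X, Polynomial.eval_ofNat]
      omega
  exact fst.comp (snd.comp key)

/-- Folds whose state grows by a polynomial amount in every step, under an invariant. -/
theorem foldl_of_inv {f : X → σ → α → σ} {s : X → σ} {l : X → List α} (I : X → σ → Prop)
    (hf : PT (fun p : X × σ × α => f p.1 p.2.1 p.2.2)) (hs : PT s) (hl : PT l)
    (hI : ∀ x, I x (s x))
    (hb : ∃ Q : Polynomial ℕ, ∀ x s a, a ∈ l x → I x s →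
      I x (f x s a) ∧ sz (f x s a) ≤ sz s + Q.eval (sz x)) :
    PT (fun x => (l x).foldl (f x) (s x)) := by
  obtain ⟨Q, hQ⟩ := hb
  obtain ⟨S, hS⟩ := hs.size_le
  obtain ⟨R, hR⟩ := hl.size_le
  refine foldl hf hs hl ⟨S + R * Q, fun x l' hl' => ?_⟩
  have key : ∀ (l' : List α) (s : σ), I x s → (∀ a ∈ l', a ∈ l x) →
      sz (l'.foldl (f x) s) ≤ sz s + l'.length * Q.eval (sz x) := by
    intro l'
    induction l' with
    | nil => intro s _ _; simp
    | cons a l' ih =>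
      intro s hs h
      have h2 := hQ x s a (h a (by simp)) hs
      have h1 := ih (f x s a) h2.1 (fun b hb => h b (by simp [hb]))
      rw [List.foldl_cons, List.length_cons, add_mul]
      omega
  have h1 := key l' (s x) (hI x) (fun a ha => hl'.subset ha)
  have h2 := Nat.mul_le_mul_right (Q.eval (sz x))
    (hl'.length_le.trans ((length_le_sz _).trans (hR x)))
  have h3 := hS x
  simp only [Polynomial.eval_add, Polynomial.eval_mul]
  omega

theorem foldl_of_add {f : X → σ → α → σ} {s : X → σ} {l : X → List α}
    (hf : PT (fun p : X × σ × α => f p.1 p.2.1 p.2.2)) (hs : PT s) (hl : PT l)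
    (hb : ∃ Q : Polynomial ℕ, ∀ x s a, a ∈ l x → sz (f x s a) ≤ sz s + Q.eval (sz x)) :
    PT (fun x => (l x).foldl (f x) (s x)) :=
  foldl_of_inv (fun _ _ => True) hf hs hl (fun _ => trivial)
    (hb.imp fun _ hQ x s a ha _ => ⟨trivial, hQ x s a ha⟩)

end PT

namespace PT

variable {X Y Z α β σ : Type} [Enc X] [Enc Y] [Enc Z] [Enc α] [Enc β] [Enc σ]

/-! ### Booleans and lists -/

@[fun_prop]
theorem not {f : X → Bool} (hf : PT f) : PT (fun x => !f x) := by
  convert hf.cond (const false) (const true) using 2 with x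
  cases f x <;> rfl

@[fun_prop]
theorem and {f g : X → Bool} (hf : PT f) (hg : PT g) : PT (fun x => f x && g x) := by
  convert hf.cond hg (const false) using 2 with x
  cases f x <;> rfl

@[fun_prop]
theorem or {f g : X → Bool} (hf : PT f) (hg : PT g) : PT (fun x => f x || g x) := by
  convert hf.cond (const true) hg using 2 with x
  cases f x <;> rfl

@[fun_prop]
theorem cons {f : X → α} {g : X → List α} (hf : PT f) (hg : PT g) : PT (fun x => f x :: g x) :=
  (of_prog (f := fun p : α × List α => p.1 :: p.2) .id 1 (fun _ => ⟨1, le_rfl, .id _⟩)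
    (fun x => by rw [sz_cons, sz_prod]; omega)).comp (hf.pair hg)

@[fun_prop]
theorem isEmpty {l : X → List α} (hl : PT l) : PT (fun x => (l x).isEmpty) := by
  refine comp (g := fun l : List α => l.isEmpty) ?_ hl
  refine of_prog (.ite .id .nil (.pair .nil .nil)) 10 (fun l => ?_)
    (fun l => (sz_bool _).trans (by omega))
  cases l with
  | nil => exact ⟨_, by norm_num, .ite_false (.id _) (.pair (.nil _) (.nil _))⟩
  | cons a l => exact ⟨_, by norm_num, .ite_true (.id _) (.nil _)⟩

@[fun_prop]
theorem tail {l : X → List α} (hl : PT l) : PT (fun x => (l x).tail) := by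
  refine comp (g := fun l : List α => l.tail) ?_ hl
  refine of_prog .tl 1 (fun l => ?_) (fun l => ?_)
  · cases l with
    | nil => exact ⟨_, le_rfl, .tl_nil⟩
    | cons a l => exact ⟨_, le_rfl, .tl_cons _ _⟩
  · cases l with
    | nil => simp [sz_nil]
    | cons a l => rw [sz_cons, List.tail_cons]; omega

@[fun_prop]
theorem headD {l : X → List α} (hl : PT l) (d : α) : PT (fun x => (l x).headD d) := by
  refine comp (g := fun l : List α => l.headD d) ?_ hl
  obtain ⟨p, t, hp⟩ := exists_prog_const (enc d)
  refine of_prog (.ite .id .hd p) (t + sz d + 3) (fun l => ?_) (fun l => ?_)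
  · cases l with
    | nil => exact ⟨_, by omega, .ite_false (.id _) (hp _)⟩
    | cons a l => exact ⟨_, by omega, .ite_true (.id _) (.hd_cons _ _)⟩
  · cases l with
    | nil => simp only [List.headD_nil]; omega
    | cons a l => rw [sz_cons, List.headD_cons]; omega

@[fun_prop]
theorem reverse {l : X → List α} (hl : PT l) : PT (fun x => (l x).reverse) := by
  refine comp (g := fun l : List α => l.reverse) ?_ hl
  have : PT (fun l : List α => l.foldl (fun acc a => a :: acc) []) := by
    refine foldl_of_add (f := fun _ acc a => a :: acc) (by fun_prop) (by fun_prop) (by fun_prop)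
      ⟨.X + 1, fun l s a ha => ?_⟩
    have := sz_le_of_mem ha
    simp only [sz_cons, Polynomial.eval_add, Polynomial.eval_X, Polynomial.eval_one]
    omega
  convert this using 2 with l
  simp

@[fun_prop]
theorem append {f g : X → List α} (hf : PT f) (hg : PT g) : PT (fun x => f x ++ g x) := by
  refine comp (g := fun p : List α × List α => p.1 ++ p.2) ?_ (hf.pair hg)
  have : PT (fun p : List α × List α => p.1.reverse.foldl (fun acc a => a :: acc) p.2) := by
    refine foldl_of_add (f := fun _ acc a => a :: acc) (by fun_prop) (by fun_prop) (by fun_prop)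
      ⟨.X + 1, fun p s a ha => ?_⟩
    have := sz_le_of_mem (List.mem_reverse.1 ha)
    simp only [sz_cons, sz_prod, Polynomial.eval_add, Polynomial.eval_X, Polynomial.eval_one]
    omega
  convert this using 2 with p
  simp

-- Filtering and mapping in one fold, with a reversed accumulator; `map` and `filter` are special
-- cases.
@[fun_prop]
theorem filterMap_cond {l : X → List α} {b : X → α → Bool} {f : X → α → β} (hl : PT l)
    (hb : PT (fun p : X × α => b p.1 p.2)) (hf : PT (fun p : X × α => f p.1 p.2)) :
    PT (fun x => ((l x).filter (b x)).map (f x)) := by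
  have : PT (fun x => ((l x).foldl (fun acc a => bif b x a then f x a :: acc else acc)
      []).reverse) := by
    refine reverse ?_
    obtain ⟨F, hF⟩ := hf.size_le
    obtain ⟨L, hL⟩ := hl.size_le
    have h : PT (fun p : X × List β × α => (p.1, p.2.2)) := by fun_prop
    refine foldl_of_add (f := fun x acc a => bif b x a then f x a :: acc else acc)
      (cond (b := fun p : X × List β × α => b p.1 p.2.2) (hb.comp h)
        (cons (hf.comp h) (by fun_prop)) (by fun_prop)) (const _) hl
      ⟨F.comp (.X + L + 1) + 1, fun x s a ha => ?_⟩
    have h1 : sz (x, a) ≤ sz x + L.eval (sz x) + 1 := by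
      have := sz_le_of_mem ha
      have := hL x
      simp only [sz_prod]; omega
    have h2 := (hF (x, a)).trans (F.eval_mono_nat h1)
    simp only [Polynomial.eval_add, Polynomial.eval_comp, Polynomial.eval_X, Polynomial.eval_one]
    cases b x a with
    | true => simp only [cond_true, sz_cons]; simp only at h2; omega
    | false => simp only [cond_false]; omega
  convert this using 2 with x
  rw [List.reverse_eq_iff.2 ?_]
  have key : ∀ (l : List α) (acc : List β),
      l.foldl (fun acc a => bif b x a then f x a :: acc else acc) acc =
        ((l.filter (b x)).map (f x)).reverse ++ acc := by
    intro l
    induction l with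
    | nil => simp
    | cons a l ih =>
      intro acc
      rw [List.foldl_cons, ih]
      cases h : b x a <;> simp [h]
  simp [key]

@[fun_prop]
theorem map {l : X → List α} {f : X → α → β} (hl : PT l)
    (hf : PT (fun p : X × α => f p.1 p.2)) : PT (fun x => (l x).map (f x)) := by
  simpa using filterMap_cond (b := fun _ _ => true) hl (const _) hf

@[fun_prop]
theorem filter {l : X → List α} {b : X → α → Bool} (hl : PT l)
    (hb : PT (fun p : X × α => b p.1 p.2)) : PT (fun x => (l x).filter (b x)) := by
  simpa using filterMap_cond (f := fun _ a => a) hl hb snd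

@[fun_prop]
theorem any {l : X → List α} {b : X → α → Bool} (hl : PT l)
    (hb : PT (fun p : X × α => b p.1 p.2)) : PT (fun x => (l x).any (b x)) := by
  have : PT (fun x => !((l x).filter (b x)).isEmpty) := by fun_prop
  convert this using 2 with x
  rw [Bool.eq_iff_iff]
  simp

@[fun_prop]
theorem all {l : X → List α} {b : X → α → Bool} (hl : PT l)
    (hb : PT (fun p : X × α => b p.1 p.2)) : PT (fun x => (l x).all (b x)) := by
  have : PT (fun x => ((l x).filter (fun a => !b x a)).isEmpty) := by fun_prop
  convert this using 2 with x
  rw [Bool.eq_iff_iff]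
  simp

@[fun_prop]
theorem flatten {l : X → List (List α)} (hl : PT l) : PT (fun x => (l x).flatten) := by
  refine comp (g := fun l : List (List α) => l.flatten) ?_ hl
  have : PT (fun l : List (List α) => l.foldl (fun acc a => acc ++ a) []) := by
    refine foldl_of_add (f := fun _ acc a => acc ++ a) (by fun_prop) (by fun_prop) (by fun_prop)
      ⟨.X, fun l s a ha => ?_⟩
    have := sz_le_of_mem ha
    have := sz_append s a
    simp only [Polynomial.eval_X]
    omega
  convert this using 2 with l
  have key : ∀ (l : List (List α)) (acc : List α),
      l.foldl (fun acc a => acc ++ a) acc = acc ++ l.flatten := by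
    intro l
    induction l with
    | nil => simp
    | cons a l ih => intro acc; rw [List.foldl_cons, ih]; simp
  simp [key]

@[fun_prop]
theorem flatMap {l : X → List α} {f : X → α → List β} (hl : PT l)
    (hf : PT (fun p : X × α => f p.1 p.2)) : PT (fun x => (l x).flatMap (f x)) := by
  simp only [List.flatMap_def]
  fun_prop

@[fun_prop]
theorem product {l : X → List α} {m : X → List β} (hl : PT l) (hm : PT m) :
    PT (fun x => l x ×ˢ m x) := by
  have : PT (fun x => (l x).flatMap fun a => (m x).map fun b => (a, b)) := by fun_prop
  exact this

/-! ### Numbers in unary -/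

/-- Since `false` is the empty tree, a unary number and a list of that many `false` are the same
tree. This turns iteration into a fold. -/
theorem replicate_false : PT (fun m : ℕ => List.replicate m false) := by
  have h (m : ℕ) : enc (List.replicate m false) = enc m := by
    induction m with
    | zero => rfl
    | succ m ih => rw [List.replicate_succ, enc_list_cons, ih]; rfl
  refine of_prog .id 1 (fun m => ⟨1, le_rfl, ?_⟩) (fun m => ?_)
  · rw [h]; exact .id _
  · unfold sz; rw [h]; omega

/-- Iteration of a function whose values grow by a polynomial amount in every step, under an
invariant. -/
theorem iterate_of_inv {f : X → σ → σ} {s : X → σ} {m : X → ℕ} (I : X → σ → Prop)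
    (hf : PT (fun p : X × σ => f p.1 p.2)) (hs : PT s) (hm : PT m) (hI : ∀ x, I x (s x))
    (hb : ∃ Q : Polynomial ℕ, ∀ x s, I x s → I x (f x s) ∧ sz (f x s) ≤ sz s + Q.eval (sz x)) :
    PT (fun x => (f x)^[m x] (s x)) := by
  have : PT (fun x => (List.replicate (m x) false).foldl (fun s _ => f x s) (s x)) := by
    obtain ⟨Q, hQ⟩ := hb
    exact foldl_of_inv (f := fun x s _ => f x s) I
      (hf.comp (by fun_prop : PT (fun p : X × σ × Bool => (p.1, p.2.1)))) hs
      (replicate_false.comp hm) hI ⟨Q, fun x s _ _ => hQ x s⟩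
  convert this using 2 with x
  generalize m x = k
  generalize s x = s
  induction k generalizing s with
  | zero => rfl
  | succ k ih => rw [Function.iterate_succ_apply, ih, List.replicate_succ, List.foldl_cons]

theorem iterate_of_add {f : X → σ → σ} {s : X → σ} {m : X → ℕ}
    (hf : PT (fun p : X × σ => f p.1 p.2)) (hs : PT s) (hm : PT m)
    (hb : ∃ Q : Polynomial ℕ, ∀ x s, sz (f x s) ≤ sz s + Q.eval (sz x)) :
    PT (fun x => (f x)^[m x] (s x)) :=
  iterate_of_inv (fun _ _ => True) hf hs hm (fun _ => trivial)
    (hb.imp fun _ hQ x s _ => ⟨trivial, hQ x s⟩)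

@[fun_prop]
theorem succ {f : X → ℕ} (hf : PT f) : PT (fun x => f x + 1) :=
  comp (g := fun m : ℕ => m + 1) (of_prog (.pair .nil .id) 3
    (fun _ => ⟨_, le_rfl, .pair (.nil _) (.id _)⟩) (fun m => by simp only [sz_nat]; omega)) hf

@[fun_prop]
theorem pred {f : X → ℕ} (hf : PT f) : PT (fun x => f x - 1) := by
  refine comp (g := fun m : ℕ => m - 1) (of_prog .tl 3 (fun m => ?_)
    (fun m => by simp only [sz_nat]; omega)) hf
  cases m with
  | zero => exact ⟨1, by omega, .tl_nil⟩
  | succ m => exact ⟨1, by omega, .tl_cons _ _⟩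

@[fun_prop]
theorem add {f g : X → ℕ} (hf : PT f) (hg : PT g) : PT (fun x => f x + g x) := by
  have : PT (fun x => (fun s => s + 1)^[g x] (f x)) :=
    iterate_of_add (f := fun _ s => s + 1) (by fun_prop) hf hg
      ⟨2, fun x s => by simp only [sz_nat, Polynomial.eval_ofNat]; omega⟩
  convert this using 2 with x
  simp

@[fun_prop]
theorem sub {f g : X → ℕ} (hf : PT f) (hg : PT g) : PT (fun x => f x - g x) := by
  have : PT (fun x => (fun s => s - 1)^[g x] (f x)) :=
    iterate_of_add (f := fun _ s => s - 1) (by fun_prop) hf hg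
      ⟨0, fun x s => by simp only [sz_nat, Polynomial.eval_zero]; omega⟩
  convert this using 2 with x
  generalize g x = k
  generalize f x = s
  induction k generalizing s with
  | zero => rfl
  | succ k ih => rw [Function.iterate_succ_apply, ← ih]; omega

@[fun_prop]
theorem mul {f g : X → ℕ} (hf : PT f) (hg : PT g) : PT (fun x => f x * g x) := by
  have : PT (fun x => (fun s => s + f x)^[g x] 0) := by
    obtain ⟨F, hF⟩ := hf.size_le
    refine iterate_of_add (f := fun x s => s + f x) (by fun_prop) (const 0) hg
      ⟨F, fun x s => ?_⟩
    have := hF x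
    simp only [sz_nat] at this ⊢
    omega
  convert this using 2 with x
  simp [mul_comm]

@[fun_prop]
theorem decide_le {f g : X → ℕ} (hf : PT f) (hg : PT g) : PT (fun x => decide (f x ≤ g x)) := by
  have : PT (fun x => (List.replicate (f x - g x) false).isEmpty) :=
    (replicate_false.comp (hf.sub hg)).isEmpty
  convert this using 2 with x
  rw [Bool.eq_iff_iff]
  simp [Nat.sub_eq_zero_iff_le]

@[fun_prop]
theorem decide_lt {f g : X → ℕ} (hf : PT f) (hg : PT g) : PT (fun x => decide (f x < g x)) :=
  decide_le (hf.succ) hg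

@[fun_prop]
theorem decide_eq {f g : X → ℕ} (hf : PT f) (hg : PT g) : PT (fun x => decide (f x = g x)) := by
  have : PT (fun x => decide (f x ≤ g x) && decide (g x ≤ f x)) := by fun_prop
  convert this using 2 with x
  rw [Bool.eq_iff_iff]
  simp
  omega

@[fun_prop]
theorem decide_mem {f : X → ℕ} {l : X → List ℕ} (hf : PT f) (hl : PT l) :
    PT (fun x => decide (f x ∈ l x)) := by
  have : PT (fun x => (l x).any fun a => decide (f x = a)) := by fun_prop
  convert this using 2 with x
  rw [Bool.eq_iff_iff]
  simp

@[fun_prop]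
theorem length {l : X → List α} (hl : PT l) : PT (fun x => (l x).length) := by
  refine comp (g := fun l : List α => l.length) ?_ hl
  have : PT (fun l : List α => l.foldl (fun s _ => s + 1) 0) :=
    foldl_of_add (f := fun _ s _ => s + 1) (by fun_prop) (by fun_prop) (by fun_prop)
      ⟨2, fun l s a _ => by simp only [sz_nat, Polynomial.eval_ofNat]; omega⟩
  convert this using 2 with l
  have key : ∀ (l : List α) (s : ℕ), l.foldl (fun s _ => s + 1) s = s + l.length := by
    intro l
    induction l with
    | nil => simp
    | cons a l ih => intro s; rw [List.foldl_cons, ih, List.length_cons]; omega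
  simp [key]

@[fun_prop]
theorem drop {l : X → List α} {m : X → ℕ} (hl : PT l) (hm : PT m) :
    PT (fun x => (l x).drop (m x)) := by
  have : PT (fun x => List.tail^[m x] (l x)) :=
    iterate_of_add (f := fun _ s => s.tail) (by fun_prop) hl hm ⟨0, fun x s => by
      cases s with
      | nil => simp
      | cons a s => rw [sz_cons, List.tail_cons]; omega⟩
  convert this using 2 with x
  generalize m x = k
  generalize l x = s
  induction k generalizing s with
  | zero => rfl
  | succ k ih => rw [Function.iterate_succ_apply, ← ih, List.drop_tail]

@[fun_prop]
theorem getD {l : X → List α} {m : X → ℕ} (hl : PT l) (hm : PT m) (d : α) :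
    PT (fun x => (l x).getD (m x) d) := by
  have : PT (fun x => ((l x).drop (m x)).headD d) := by fun_prop
  convert this using 2 with x
  simp [List.getD_eq_getElem?_getD, List.headD_eq_head?_getD]

@[fun_prop]
theorem take {l : X → List α} {m : X → ℕ} (hl : PT l) (hm : PT m) :
    PT (fun x => (l x).take (m x)) := by
  have : PT (fun x => ((l x).reverse.drop ((l x).length - m x)).reverse) := by fun_prop
  convert this using 2 with x
  rw [List.reverse_drop, List.length_reverse]
  simp
  omega

-- The numbers put on the list grow with the counter, so the growth per step is not bounded
-- independently of the state. The quadratic bound on the whole fold is therefore proved directly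
-- and fed to `foldl`.
@[fun_prop]
theorem range {m : X → ℕ} (hm : PT m) : PT (fun x => List.range (m x)) := by
  refine comp (g := fun m : ℕ => List.range m) ?_ hm
  have : PT (fun m : ℕ => ((List.replicate m false).foldl
      (fun s _ => (s.1 + 1, s.1 :: s.2)) (0, ([] : List ℕ))).2.reverse) := by
    refine reverse (snd.comp ?_)
    have key : ∀ (l : List Bool) (s : ℕ × List ℕ),
        sz (l.foldl (fun s _ => (s.1 + 1, s.1 :: s.2)) s) ≤
          sz s + l.length * (2 * s.1 + 2 * l.length + 4) := by
      intro l
      induction l with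
      | nil => simp
      | cons a l ih =>
        intro s
        rw [List.foldl_cons]
        refine (ih _).trans ?_
        simp only [sz_prod, sz_nat, sz_cons, List.length_cons]
        nlinarith
    refine foldl (f := fun _ s _ => (s.1 + 1, s.1 :: s.2)) (by fun_prop) (by fun_prop)
      replicate_false ⟨3 + .X * (2 * .X + 4), fun m l hl => (key _ _).trans ?_⟩
    have h1 : l.length ≤ sz m := by
      have := hl.length_le
      rw [List.length_replicate] at this
      rw [sz_nat]; omega
    have h2 : sz (0, ([] : List ℕ)) = 3 := rfl
    simp only [Polynomial.eval_add, Polynomial.eval_mul, Polynomial.eval_X, Polynomial.eval_ofNat,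
      h2]
    nlinarith
  convert this using 2 with m
  have key : ∀ m : ℕ, (List.replicate m false).foldl
      (fun s _ => (s.1 + 1, s.1 :: s.2)) (0, ([] : List ℕ)) = (m, (List.range m).reverse) := by
    intro m
    induction m with
    | zero => rfl
    | succ m ih => rw [List.replicate_succ', List.foldl_append, ih]; simp [List.range_succ]
  simp [key]

end PT

/-! ### Numbers in binary -/

/-- The value of a bit string, least significant bit first. -/
def bitsVal : List Bool → ℕ
  | [] => 0
  | b :: l => b.toNat + 2 * bitsVal l

theorem bitsVal_bits (m : ℕ) : bitsVal (Nat.bits m) = m := by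
  induction m using Nat.binaryRec' with
  | zero => simp [bitsVal]
  | bit b n h ih => rw [Nat.bits_append_bit n b h, bitsVal, ih, Nat.bit_val]; omega

/-- Compares `a` and `b`, with `r` the result for numbers of equal value. -/
def ltBits (r : Bool) : List Bool → List Bool → Bool
  | [], b => b.any (fun x => x) || r
  | x :: a, b => ltBits (bif (x && b.headD false) || (!x && !b.headD false) then r
      else b.headD false) a b.tail

/-- The least significant digit comes first, so a later difference overrides an earlier one; `r`
carries the verdict on the digits already read. -/
theorem ltBits_iff (r : Bool) (a b : List Bool) :
    ltBits r a b = true ↔ bitsVal a < bitsVal b ∨ bitsVal a = bitsVal b ∧ r = true := by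
  induction a generalizing r b with
  | nil =>
    have key : ∀ b : List Bool, b.any (fun x => x) = true ↔ 0 < bitsVal b := by
      intro b
      induction b with
      | nil => simp [bitsVal]
      | cons y b ih => rw [List.any_cons, Bool.or_eq_true, ih]; cases y <;> simp [bitsVal]
    rw [ltBits, Bool.or_eq_true, key, bitsVal]
    constructor
    · rintro (h | h)
      · exact .inl h
      · rcases Nat.eq_zero_or_pos (bitsVal b) with h' | h'
        · exact .inr ⟨h'.symm, h⟩
        · exact .inl h'
    · rintro (h | ⟨_, h⟩)
      · exact .inl h
      · exact .inr h
  | cons x a ih =>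
    rw [ltBits, ih]
    cases b with
    | nil => cases x <;> cases r <;> simp [bitsVal]
    | cons y b => cases x <;> cases y <;> cases r <;> simp [bitsVal] <;> omega

/-- The successor of a binary number. -/
def incBits : List Bool → List Bool
  | [] => [true]
  | false :: l => true :: l
  | true :: l => false :: incBits l

theorem bits_succ (m : ℕ) : Nat.bits (m + 1) = incBits (Nat.bits m) := by
  induction m using Nat.binaryRec' with
  | zero => simp [incBits]
  | bit b n h ih =>
    rw [Nat.bits_append_bit n b h]
    cases b with
    | false =>
      rw [incBits, Nat.bit_false]
      exact Nat.bit1_bits n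
    | true =>
      rw [incBits, ← ih, Nat.bit_true, show 2 * n + 1 + 1 = 2 * (n + 1) by ring]
      exact Nat.bit0_bits (n + 1) (by omega)

/-- One step of the comparison of two bit strings. -/
def ltBitsStep (q : Bool × List Bool) (x : Bool) : Bool × List Bool :=
  (bif (x && q.2.headD false) || (!x && !q.2.headD false) then q.1 else q.2.headD false, q.2.tail)

/-- One step of the computation of the successor, on a carry and the digits obtained so far. -/
def incBitsStep (q : Bool × List Bool) (b : Bool) : Bool × List Bool :=
  (q.1 && b, ((q.1 && !b) || (!q.1 && b)) :: q.2)

/-- Inserts an element into a list that increases strictly for the order `lt`. -/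
def insertLt {α : Type} (lt : α → α → Bool) (l : List α) (a : α) : List α :=
  l.filter (fun b => lt b a) ++ a :: l.filter (fun b => lt a b)

namespace PT

variable {X Y Z α β σ : Type} [Enc X] [Enc Y] [Enc Z] [Enc α] [Enc β] [Enc σ]

@[fun_prop]
theorem ltBits {f g : X → List Bool} (r : Bool) (hf : PT f) (hg : PT g) :
    PT (fun x => ltBits r (f x) (g x)) := by
  refine comp (g := fun p : List Bool × List Bool => _root_.ltBits r p.1 p.2) ?_ (hf.pair hg)
  have h : PT (fun p : List Bool × List Bool => p.1.foldl ltBitsStep (r, p.2)) := by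
    refine foldl_of_add (f := fun _ => ltBitsStep) (by unfold ltBitsStep; fun_prop) (by fun_prop)
      (by fun_prop) ⟨3, fun p q x _ => ?_⟩
    simp only [ltBitsStep, sz_prod, Polynomial.eval_ofNat]
    have h1 := sz_bool (bif (x && q.2.headD false) || (!x && !q.2.headD false) then q.1
      else q.2.headD false)
    have h2 : sz q.2.tail ≤ sz q.2 := by
      cases q.2 with
      | nil => simp
      | cons a s => rw [sz_cons, List.tail_cons]; omega
    omega
  have : PT (fun p : List Bool × List Bool => (p.1.foldl ltBitsStep (r, p.2)).2.any (fun x => x) ||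
      (p.1.foldl ltBitsStep (r, p.2)).1) := by fun_prop
  convert this using 2 with p
  obtain ⟨a, b⟩ := p
  clear this h
  simp only
  induction a generalizing r b with
  | nil => simp [_root_.ltBits]
  | cons x a ih => rw [_root_.ltBits, ih, List.foldl_cons, ltBitsStep]

@[fun_prop]
theorem incBits {f : X → List Bool} (hf : PT f) : PT (fun x => incBits (f x)) := by
  refine comp (g := fun l : List Bool => _root_.incBits l) ?_ hf
  have h : PT (fun l : List Bool => l.foldl incBitsStep (true, [])) := by
    refine foldl_of_add (f := fun _ => incBitsStep) (by unfold incBitsStep; fun_prop) (by fun_prop)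
      (by fun_prop) ⟨10, fun p q x _ => ?_⟩
    simp only [incBitsStep, sz_prod, sz_cons, Polynomial.eval_ofNat]
    have h1 := sz_bool (q.1 && x)
    have h2 := sz_bool ((q.1 && !x) || (!q.1 && x))
    omega
  have : PT (fun l : List Bool => (l.foldl incBitsStep (true, [])).2.reverse ++
      bif (l.foldl incBitsStep (true, [])).1 then [true] else []) := by fun_prop
  convert this using 2 with l
  have h1 : ∀ l acc : List Bool, l.foldl incBitsStep (false, acc) = (false, l.reverse ++ acc) := by
    intro l
    induction l with
    | nil => simp
    | cons b l ih => intro acc; rw [List.foldl_cons]; simp [incBitsStep, ih]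
  have h2 : ∀ l acc : List Bool, acc.reverse ++ _root_.incBits l =
      (l.foldl incBitsStep (true, acc)).2.reverse ++
        bif (l.foldl incBitsStep (true, acc)).1 then [true] else [] := by
    intro l
    induction l with
    | nil => simp [_root_.incBits]
    | cons b l ih =>
      intro acc
      cases b with
      | false => simp [_root_.incBits, incBitsStep, h1]
      | true => simp [_root_.incBits, incBitsStep, ← ih]
  simpa using h2 l []

-- Conversion from unary to binary by repeated increments: their number is bounded by the input size
-- because the input is unary.
@[fun_prop]
theorem bits {f : X → ℕ} (hf : PT f) : PT (fun x => Nat.bits (f x)) := by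
  have : PT (fun x => (fun s => _root_.incBits s)^[f x] []) := by
    refine iterate_of_add (f := fun _ s => _root_.incBits s) (by fun_prop) (by fun_prop) hf
      ⟨10, fun x s => ?_⟩
    simp only [Polynomial.eval_ofNat]
    induction s with
    | nil => simp [_root_.incBits, sz, enc_list, enc_bool, Data.ofList, Data.size, Data.ofBool]
    | cons b s ih =>
      cases b with
      | false =>
        simp only [_root_.incBits, sz_cons]
        have := sz_bool true
        omega
      | true =>
        simp only [_root_.incBits, sz_cons]
        have : sz false ≤ sz true := by simp [sz, enc_bool, Data.ofBool, Data.size]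
        omega
  convert this using 2 with x
  generalize f x = m
  induction m with
  | zero => simp
  | succ m ih => rw [Function.iterate_succ_apply', bits_succ, ih]

@[fun_prop]
theorem natCode {f : X → ℕ} (hf : PT f) : PT (fun x => natCode (f x)) := by
  unfold _root_.natCode
  fun_prop

/-- Used for `insertLt`: the two filters select disjoint parts, so an insertion adds at most the
size of the new element. -/
theorem sz_filter_add_le (l : List α) (b c : α → Bool) (h : ∀ a, ¬(b a = true ∧ c a = true)) :
    sz (l.filter b) + sz (l.filter c) ≤ sz l + 1 := by
  induction l with
  | nil => simp [sz_nil]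
  | cons a l ih =>
    have := h a
    cases hb : b a <;> cases hc : c a <;> simp [hb, hc, sz_cons] at this ⊢ <;> omega

@[fun_prop]
theorem insertLt {l : X → List (List Bool)} {a : X → List Bool} (hl : PT l) (ha : PT a) :
    PT (fun x => insertLt (_root_.ltBits false) (l x) (a x)) := by
  unfold _root_.insertLt
  fun_prop

@[fun_prop]
theorem sortBits {l : X → List (List Bool)} (hl : PT l) :
    PT (fun x => (l x).foldl (_root_.insertLt (_root_.ltBits false)) []) := by
  refine comp (g := fun l : List (List Bool) => l.foldl (_root_.insertLt (_root_.ltBits false)) [])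
    ?_ hl
  refine foldl_of_add (f := fun _ => _root_.insertLt (_root_.ltBits false)) (by fun_prop)
    (by fun_prop) (by fun_prop) ⟨.X + 1, fun l s a ha => ?_⟩
  have h1 := sz_le_of_mem ha
  have h2 := sz_filter_add_le s (fun b => _root_.ltBits false b a)
    (fun b => _root_.ltBits false a b) (fun b hb => by
      simp only [ltBits_iff] at hb
      simp at hb
      omega)
  have h3 := sz_append (s.filter (fun b => _root_.ltBits false b a))
    (a :: s.filter (fun b => _root_.ltBits false a b))
  rw [sz_cons] at h3
  simp only [_root_.insertLt, Polynomial.eval_add, Polynomial.eval_X, Polynomial.eval_one]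
  omega

end PT

/-! ### Bipartite matchings by auction -/

/-- The entry of a Boolean matrix, `false` outside of the matrix. -/
def ent (E : List (List Bool)) (i j : ℕ) : Bool := (E.getD i []).getD j false

/-- In a state of the auction, a list of triples `(j, p, z)` of an object, its price and its owner,
the bidder `z` owns something. Objects of price `0` have no owner. -/
def isOwner (S : List (ℕ × ℕ × ℕ)) (z : ℕ) : Bool :=
  S.any fun e => decide (1 ≤ e.2.1) && decide (e.2.2 = z)

/-- The bidder `b.1` owns nothing, and the object of the entry `b.2` is a cheapest one among those
in which it is interested, with a price less than `L`. -/
def isBid (E : List (List Bool)) (L : ℕ) (S : List (ℕ × ℕ × ℕ)) (b : ℕ × ℕ × ℕ × ℕ) : Bool :=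
  !isOwner S b.1 && ent E b.1 b.2.1 && decide (b.2.2.1 < L) &&
    S.all fun e => !ent E b.1 e.1 || decide (b.2.2.1 ≤ e.2.1)

/-- The object `j` goes to `z`, and its price increases by one. -/
def placeBid (j z : ℕ) (S : List (ℕ × ℕ × ℕ)) : List (ℕ × ℕ × ℕ) :=
  S.map fun e => bif decide (e.1 = j) then (e.1, e.2.1 + 1, z) else e

/-- All possible bids. -/
def bids (E : List (List Bool)) (lefts : List ℕ) (L : ℕ) (S : List (ℕ × ℕ × ℕ)) :
    List (ℕ × ℕ × ℕ × ℕ) :=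
  (lefts ×ˢ S).filter (isBid E L S)

/-- The first possible bid is carried out. A state without bids is a fixed point, so iterating too
often does no harm. -/
def auctionStep (E : List (List Bool)) (lefts : List ℕ) (L : ℕ) (S : List (ℕ × ℕ × ℕ)) :
    List (ℕ × ℕ × ℕ) :=
  bif (bids E lefts L S).isEmpty then S else
    placeBid ((bids E lefts L S).headD (0, 0, 0, 0)).2.1
      ((bids E lefts L S).headD (0, 0, 0, 0)).1 S

/-- The final state of the auction. -/
def auction (E : List (List Bool)) (lefts rights : List ℕ) : List (ℕ × ℕ × ℕ) :=
  (auctionStep E lefts (rights.length + 2))^[rights.length * (rights.length + 2) + 1]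
    (rights.map fun j => (j, 0, 0))

/-- A positive number that is not a price. -/
def priceGap (S : List (ℕ × ℕ × ℕ)) : ℕ :=
  ((List.range (S.length + 2)).filter fun g =>
    decide (1 ≤ g) && S.all fun e => !decide (e.2.1 = g)).headD 0

/-- The objects whose price is above the gap. -/
def highObjects (S : List (ℕ × ℕ × ℕ)) : List ℕ :=
  (S.filter fun e => decide (priceGap S < e.2.1)).map fun e => e.1

/-- The bidder `z` owns an object whose price is below the gap. -/
def isLowOwner (S : List (ℕ × ℕ × ℕ)) (z : ℕ) : Bool :=
  S.any fun e => decide (1 ≤ e.2.1) && decide (e.2.1 < priceGap S) && decide (e.2.2 = z)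

/-! ### Running time of the auction -/

section PT

variable {X : Type} [Enc X]

@[fun_prop]
theorem PT.ent {E : X → List (List Bool)} {i j : X → ℕ} (hE : PT E) (hi : PT i) (hj : PT j) :
    PT (fun x => ent (E x) (i x) (j x)) := by
  unfold _root_.ent; fun_prop

@[fun_prop]
theorem PT.isOwner {S : X → List (ℕ × ℕ × ℕ)} {z : X → ℕ} (hS : PT S) (hz : PT z) :
    PT (fun x => isOwner (S x) (z x)) := by
  unfold _root_.isOwner; fun_prop

@[fun_prop]
theorem PT.isBid {E : X → List (List Bool)} {L : X → ℕ} {S : X → List (ℕ × ℕ × ℕ)}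
    {b : X → ℕ × ℕ × ℕ × ℕ} (hE : PT E) (hL : PT L) (hS : PT S) (hb : PT b) :
    PT (fun x => isBid (E x) (L x) (S x) (b x)) := by
  unfold _root_.isBid; fun_prop

@[fun_prop]
theorem PT.placeBid {j z : X → ℕ} {S : X → List (ℕ × ℕ × ℕ)} (hj : PT j) (hz : PT z) (hS : PT S) :
    PT (fun x => placeBid (j x) (z x) (S x)) := by
  unfold _root_.placeBid; fun_prop

@[fun_prop]
theorem PT.bids {E : X → List (List Bool)} {l : X → List ℕ} {L : X → ℕ}
    {S : X → List (ℕ × ℕ × ℕ)} (hE : PT E) (hl : PT l) (hL : PT L) (hS : PT S) :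
    PT (fun x => bids (E x) (l x) (L x) (S x)) := by
  unfold _root_.bids; fun_prop

@[fun_prop]
theorem PT.auctionStep {E : X → List (List Bool)} {l : X → List ℕ} {L : X → ℕ}
    {S : X → List (ℕ × ℕ × ℕ)} (hE : PT E) (hl : PT l) (hL : PT L) (hS : PT S) :
    PT (fun x => auctionStep (E x) (l x) (L x) (S x)) := by
  unfold _root_.auctionStep; fun_prop

theorem mem_bids {E : List (List Bool)} {lefts : List ℕ} {L : ℕ} {S : List (ℕ × ℕ × ℕ)}
    {b : ℕ × ℕ × ℕ × ℕ} : b ∈ bids E lefts L S ↔ b.1 ∈ lefts ∧ b.2 ∈ S ∧ isBid E L S b = true := by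
  obtain ⟨z, e⟩ := b
  rw [bids, List.mem_filter]
  exact (and_congr_left' List.pair_mem_product).trans and_assoc

theorem auctionStep_cases (E : List (List Bool)) (lefts : List ℕ) (L : ℕ)
    (S : List (ℕ × ℕ × ℕ)) :
    (bids E lefts L S = [] ∧ auctionStep E lefts L S = S) ∨
      ∃ b ∈ bids E lefts L S, auctionStep E lefts L S = placeBid b.2.1 b.1 S := by
  unfold auctionStep
  rcases h : bids E lefts L S with _ | ⟨b, l⟩
  · exact .inl ⟨rfl, rfl⟩
  · exact .inr ⟨b, by simp, rfl⟩

theorem sz_placeBid_le (j z : ℕ) (S : List (ℕ × ℕ × ℕ)) :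
    sz (placeBid j z S) ≤ sz S + S.length * (2 * z + 2) := by
  induction S with
  | nil => simp [placeBid]
  | cons e S ih =>
    have h : sz (bif decide (e.1 = j) then (e.1, e.2.1 + 1, z) else e) ≤ sz e + (2 * z + 2) := by
      cases decide (e.1 = j) <;> simp only [cond_true, cond_false, sz_prod, sz_nat] <;> omega
    unfold placeBid at ih ⊢
    rw [List.map_cons, sz_cons, sz_cons, List.length_cons, add_mul]
    omega

-- Bids change neither the number of entries nor the objects, and new owners come from the input
-- list. With the length as invariant, each step adds a polynomial amount.
@[fun_prop]
theorem PT.auction {E : X → List (List Bool)} {l r : X → List ℕ} (hE : PT E) (hl : PT l)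
    (hr : PT r) : PT (fun x => auction (E x) (l x) (r x)) := by
  unfold _root_.auction
  obtain ⟨P, hP⟩ := hl.size_le
  obtain ⟨R, hR⟩ := hr.size_le
  refine iterate_of_inv (f := fun x S => _root_.auctionStep (E x) (l x) ((r x).length + 2) S)
    (fun x S => S.length = (r x).length) (by fun_prop) (by fun_prop) (by fun_prop) (by simp)
    ⟨R * (P + 2), fun x S hS => ?_⟩
  rcases auctionStep_cases (E x) (l x) ((r x).length + 2) S with ⟨-, h⟩ | ⟨b, hb, h⟩
  · rw [h]; exact ⟨hS, by omega⟩
  · rw [h]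
    refine ⟨by simpa [_root_.placeBid] using hS, (sz_placeBid_le _ _ _).trans ?_⟩
    have h1 := (sz_le_of_mem (mem_bids.1 hb).1).trans (hP x)
    rw [sz_nat] at h1
    have h2 := (length_le_sz (r x)).trans (hR x)
    rw [← hS] at h2
    have := Nat.mul_le_mul h2 (show 2 * b.1 + 2 ≤ P.eval (sz x) + 2 by omega)
    simp only [Polynomial.eval_add, Polynomial.eval_mul, Polynomial.eval_ofNat]
    omega

@[fun_prop]
theorem PT.priceGap {S : X → List (ℕ × ℕ × ℕ)} (hS : PT S) : PT (fun x => priceGap (S x)) := by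
  unfold _root_.priceGap; fun_prop

@[fun_prop]
theorem PT.highObjects {S : X → List (ℕ × ℕ × ℕ)} (hS : PT S) :
    PT (fun x => highObjects (S x)) := by
  unfold _root_.highObjects; fun_prop

@[fun_prop]
theorem PT.isLowOwner {S : X → List (ℕ × ℕ × ℕ)} {z : X → ℕ} (hS : PT S) (hz : PT z) :
    PT (fun x => isLowOwner (S x) (z x)) := by
  unfold _root_.isLowOwner; fun_prop

end PT

/-- The conditions that hold in every state of the auction. -/
structure AuctionInv (E : List (List Bool)) (lefts rights : List ℕ) (L : ℕ)
    (S : List (ℕ × ℕ × ℕ)) : Prop where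
  keys : S.map (fun e => e.1) = rights
  mem : ∀ e ∈ S, 1 ≤ e.2.1 → e.2.2 ∈ lefts ∧ ent E e.2.2 e.1 = true
  cheap : ∀ e ∈ S, 1 ≤ e.2.1 → ∀ e' ∈ S, ent E e.2.2 e'.1 = true → e.2.1 ≤ e'.2.1 + 1
  inj : ∀ e ∈ S, 1 ≤ e.2.1 → ∀ e' ∈ S, 1 ≤ e'.2.1 → e.2.2 = e'.2.2 → e = e'
  bound : ∀ e ∈ S, e.2.1 ≤ L

/-! ### Termination and outcome of the auction -/

theorem eq_of_nodup_keys {S : List (ℕ × ℕ × ℕ)} (h : (S.map fun e => e.1).Nodup) {e e' : ℕ × ℕ × ℕ}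
    (he : e ∈ S) (he' : e' ∈ S) (h1 : e.1 = e'.1) : e = e' :=
  List.inj_on_of_nodup_map h he he' h1

theorem mem_placeBid {S : List (ℕ × ℕ × ℕ)} (h : (S.map fun e => e.1).Nodup) {j p o : ℕ}
    (hj : (j, p, o) ∈ S) (z : ℕ) (e : ℕ × ℕ × ℕ) :
    e ∈ placeBid j z S ↔ e = (j, p + 1, z) ∨ e ∈ S ∧ e.1 ≠ j := by
  rw [placeBid, List.mem_map]
  constructor
  · rintro ⟨e', he', rfl⟩
    by_cases h1 : e'.1 = j
    · have := eq_of_nodup_keys h he' hj h1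
      subst this
      simp
    · simp [h1, he']
  · rintro (rfl | ⟨he, h1⟩)
    · exact ⟨_, hj, by simp⟩
    · exact ⟨e, he, by simp [h1]⟩

/-- The sum of the prices is the potential that forces the auction to stop. -/
theorem sum_placeBid {S : List (ℕ × ℕ × ℕ)} (h : (S.map fun e => e.1).Nodup) {j : ℕ}
    (hj : j ∈ S.map fun e => e.1) (z : ℕ) :
    ((placeBid j z S).map fun e => e.2.1).sum = (S.map fun e => e.2.1).sum + 1 := by
  induction S with
  | nil => simp at hj
  | cons e S ih =>
    rw [List.map_cons, List.nodup_cons] at h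
    unfold placeBid at ih ⊢
    rw [List.map_cons, List.map_cons, List.sum_cons, List.map_cons, List.sum_cons]
    by_cases h1 : e.1 = j
    · have : S.map (fun e => bif decide (e.1 = j) then (e.1, e.2.1 + 1, z) else e) = S := by
        conv_rhs => rw [← List.map_id S]
        refine List.map_congr_left fun e' he' => ?_
        have : e'.1 ≠ j := by
          rintro h2
          exact h.1 (h1 ▸ h2 ▸ List.mem_map_of_mem he')
        simp [this]
      rw [this]
      simp [h1]
      omega
    · rw [ih h.2 (by
        rw [List.map_cons, List.mem_cons] at hj
        exact hj.resolve_left (Ne.symm h1))]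
      simp [h1]
      omega

/-- `cheap` survives because the bidder takes a cheapest interesting object, whose price rises by
one, while for the other owners prices of alternatives only increase. `inj` survives because the
bidder owned nothing; the previous owner is simply displaced. -/
theorem AuctionInv.placeBid {E : List (List Bool)} {lefts rights : List ℕ} {L : ℕ}
    {S : List (ℕ × ℕ × ℕ)} (h : AuctionInv E lefts rights L S) (hr : rights.Nodup)
    {b : ℕ × ℕ × ℕ × ℕ} (hb : b ∈ bids E lefts L S) :
    AuctionInv E lefts rights L (placeBid b.2.1 b.1 S) := by
  obtain ⟨z, j, p, o⟩ := b
  obtain ⟨hz, hj, hbid⟩ := mem_bids.1 hb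
  simp only [isBid, isOwner, Bool.and_eq_true, Bool.not_eq_true', decide_eq_true_eq,
    List.all_eq_true, List.any_eq_false, Bool.or_eq_true, not_and] at hz hj hbid ⊢
  obtain ⟨⟨⟨hown, hent⟩, hL⟩, hmin⟩ := hbid
  have hk : (S.map fun e => e.1).Nodup := by rw [h.keys]; exact hr
  have hm := mem_placeBid hk hj z
  have hmin' : ∀ e ∈ S, ent E z e.1 = true → p ≤ e.2.1 := fun e he h1 =>
    (hmin e he).resolve_left (by simp [h1])
  refine ⟨?_, ?_, ?_, ?_, ?_⟩
  · rw [← h.keys, _root_.placeBid, List.map_map]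
    refine List.map_congr_left fun e _ => ?_
    cases h1 : decide (e.1 = j) <;> simp [h1]
  · intro e he h1
    rcases (hm e).1 he with rfl | ⟨he, -⟩
    · exact ⟨hz, hent⟩
    · exact h.mem e he h1
  · intro e he h1 e' he' h2
    rcases (hm e).1 he with rfl | ⟨he, h3⟩ <;> rcases (hm e').1 he' with rfl | ⟨he', h4⟩
    · simp
    · have := hmin' e' he' h2
      simp only; omega
    · have := h.cheap e he h1 _ hj h2
      simp only at this ⊢; omega
    · exact h.cheap e he h1 e' he' h2
  · intro e he h1 e' he' h2 h3
    rcases (hm e).1 he with rfl | ⟨he, h4⟩ <;> rcases (hm e').1 he' with rfl | ⟨he', h5⟩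
    · rfl
    · exact absurd h3.symm (hown e' he' h2)
    · exact absurd h3 (hown e he h1)
    · exact h.inj e he h1 e' he' h2 h3
  · intro e he
    rcases (hm e).1 he with rfl | ⟨he, -⟩
    · exact hL
    · exact h.bound e he

theorem auction_inv (E : List (List Bool)) (lefts : List ℕ) {rights : List ℕ}
    (hr : rights.Nodup) :
    AuctionInv E lefts rights (rights.length + 2) (auction E lefts rights) ∧
      bids E lefts (rights.length + 2) (auction E lefts rights) = [] := by
  set L := rights.length + 2 with hL
  have key : ∀ m : ℕ, AuctionInv E lefts rights L
      ((auctionStep E lefts L)^[m] (rights.map fun j => (j, 0, 0))) ∧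
      (bids E lefts L ((auctionStep E lefts L)^[m] (rights.map fun j => (j, 0, 0))) = [] ∨
        m ≤ (((auctionStep E lefts L)^[m] (rights.map fun j => (j, 0, 0))).map
          fun e => e.2.1).sum) := by
    intro m
    induction m with
    | zero =>
      refine ⟨⟨by simp [Function.comp_def], ?_, ?_, ?_, ?_⟩, by simp⟩ <;> simp
    | succ m ih =>
      rw [Function.iterate_succ_apply']
      generalize (auctionStep E lefts L)^[m] (rights.map fun j => (j, 0, 0)) = S at ih
      rcases auctionStep_cases E lefts L S with ⟨h1, h2⟩ | ⟨b, h1, h2⟩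
      · rw [h2]; exact ⟨ih.1, .inl h1⟩
      · rw [h2]
        refine ⟨ih.1.placeBid hr h1, .inr ?_⟩
        rw [sum_placeBid (by rw [ih.1.keys]; exact hr) (List.mem_map_of_mem (mem_bids.1 h1).2.1)]
        rcases ih.2 with h3 | h3
        · rw [h3] at h1; simp at h1
        · omega
  -- Every price is at most `L`, so the prices sum to at most `rights.length * L`; one more
  -- iteration than that cannot have consisted of bids only.
  obtain ⟨h1, h2⟩ := key (rights.length * L + 1)
  refine ⟨h1, h2.resolve_right fun h3 => ?_⟩
  have h4 := List.sum_le_card_nsmul _ L (List.forall_mem_map.2 h1.bound)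
  rw [List.length_map, ← List.length_map (f := fun e : ℕ × ℕ × ℕ => e.1), h1.keys,
    smul_eq_mul] at h4
  omega

/-- A decomposition of a bipartite graph with sides `A` and `B`: the relation `O` is a matching, the
neighbors of `Z ⊆ A` lie in `Q ⊆ B`, all of `Q` is matched into `Z`, and all of `A \ Z` is matched
into `B \ Q`. -/
structure HallDecomposition {α β : Type} (edge : α → β → Prop) (A : Finset α) (B : Finset β)
    (O : β → α → Prop) (Z : Finset α) (Q : Finset β) : Prop where
  left : ∀ {j z}, O j z → z ∈ A
  right : ∀ {j z}, O j z → j ∈ B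
  adj : ∀ {j z}, O j z → edge z j
  inj : ∀ {j j' z}, O j z → O j' z → j = j'
  func : ∀ {j z z'}, O j z → O j z' → z = z'
  left_subset : Z ⊆ A
  right_subset : Q ⊆ B
  nbr : ∀ {z j}, z ∈ Z → j ∈ B → edge z j → j ∈ Q
  high : ∀ {j}, j ∈ Q → ∃ z ∈ Z, O j z
  cover : ∀ {z}, z ∈ A → z ∉ Z → ∃ j, O j z ∧ j ∉ Q

/-- In the state `S` of an auction, `j` is owned by `z`. -/
def Owns (S : List (ℕ × ℕ × ℕ)) (j z : ℕ) : Prop := ∃ p, 1 ≤ p ∧ (j, p, z) ∈ S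

theorem isOwner_iff {S : List (ℕ × ℕ × ℕ)} {z : ℕ} : isOwner S z = true ↔ ∃ j, Owns S j z := by
  simp only [isOwner, List.any_eq_true, Bool.and_eq_true, decide_eq_true_eq, Owns]
  constructor
  · rintro ⟨⟨j, p, z'⟩, h, h1, rfl⟩; exact ⟨j, p, h1, h⟩
  · rintro ⟨j, p, h1, h⟩; exact ⟨_, h, h1, rfl⟩

/-- Pigeonhole: there are `S.length + 1` candidates from 1 on, and only `S.length` prices. The gap
stays below the price cap `S.length + 2`, which separates objects at the cap from it. -/
theorem priceGap_spec (S : List (ℕ × ℕ × ℕ)) :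
    1 ≤ priceGap S ∧ priceGap S < S.length + 2 ∧ ∀ e ∈ S, e.2.1 ≠ priceGap S := by
  have hne : ((List.range (S.length + 2)).filter fun g =>
      decide (1 ≤ g) && S.all fun e => !decide (e.2.1 = g)) ≠ [] := by
    intro h
    have h1 : Finset.Icc 1 (S.length + 1) ⊆ (S.map fun e => e.2.1).toFinset := by
      intro g hg
      rw [Finset.mem_Icc] at hg
      by_contra hg'
      have : g ∈ (List.range (S.length + 2)).filter fun g =>
          decide (1 ≤ g) && S.all fun e => !decide (e.2.1 = g) := by
        rw [List.mem_filter, List.mem_range]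
        refine ⟨by omega, ?_⟩
        simp only [List.mem_toFinset, List.mem_map, not_exists, not_and] at hg'
        simpa [hg.1] using fun a b c h => hg' (a, b, c) h
      rw [h] at this
      simp at this
    have h2 := (Finset.card_le_card h1).trans (List.toFinset_card_le _)
    simp at h2
  have : priceGap S ∈ (List.range (S.length + 2)).filter fun g =>
      decide (1 ≤ g) && S.all fun e => !decide (e.2.1 = g) := by
    unfold priceGap
    rcases h : (List.range (S.length + 2)).filter fun g =>
      decide (1 ≤ g) && S.all fun e => !decide (e.2.1 = g) with _ | ⟨g, l⟩
    · exact absurd h hne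
    · simp
  rw [List.mem_filter, List.mem_range] at this
  simp only [Bool.and_eq_true, decide_eq_true_eq, List.all_eq_true, Bool.not_eq_true',
    decide_eq_false_iff_not] at this
  exact ⟨this.2.1, this.1, this.2.2⟩

theorem isLowOwner_iff {S : List (ℕ × ℕ × ℕ)} {z : ℕ} :
    isLowOwner S z = true ↔ ∃ e ∈ S, 1 ≤ e.2.1 ∧ e.2.1 < priceGap S ∧ e.2.2 = z := by
  simp [isLowOwner, and_assoc]

theorem mem_highObjects {S : List (ℕ × ℕ × ℕ)} {j : ℕ} :
    j ∈ highObjects S ↔ ∃ e ∈ S, priceGap S < e.2.1 ∧ e.1 = j := by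
  simp [highObjects]

theorem highObjects_sublist (E : List (List Bool)) (lefts : List ℕ) {rights : List ℕ}
    (hr : rights.Nodup) : (highObjects (auction E lefts rights)).Sublist rights := by
  conv_rhs => rw [← (auction_inv E lefts hr).1.keys]
  exact List.filter_sublist.map _

/-- Cut the objects at a value that no price takes: Q consists of the objects above the gap, Z of
the bidders that own nothing below it. Owners pay at most one more than any alternative costs, so
the neighbors of an owner above the gap cannot be below it; idle bidders see only objects at the
cap. Objects above the gap have positive price, hence an owner, which lies in Z; bidders outside Z
own objects below the gap. -/
theorem auction_spec (E : List (List Bool)) (lefts : List ℕ) {rights : List ℕ}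
    (hr : rights.Nodup) :
    HallDecomposition (fun z j => ent E z j = true) lefts.toFinset rights.toFinset
      (Owns (auction E lefts rights))
      (lefts.filter fun z => !isLowOwner (auction E lefts rights) z).toFinset
      (highObjects (auction E lefts rights)).toFinset := by
  obtain ⟨inv, hbids⟩ := auction_inv E lefts hr
  have hlen : (auction E lefts rights).length = rights.length := by
    conv_rhs => rw [← inv.keys, List.length_map]
  generalize auction E lefts rights = S at *
  obtain ⟨hg1, hg2, hg3⟩ := priceGap_spec S
  have hk : (S.map fun e => e.1).Nodup := by rw [inv.keys]; exact hr
  have hmem : ∀ e ∈ S, e.1 ∈ rights := fun e he => by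
    rw [← inv.keys]; exact List.mem_map_of_mem he
  refine ⟨?_, ?_, ?_, ?_, ?_, ?_, ?_, ?_, ?_, ?_⟩
  · rintro j z ⟨p, hp, h⟩
    exact List.mem_toFinset.2 (inv.mem _ h hp).1
  · rintro j z ⟨p, hp, h⟩
    exact List.mem_toFinset.2 (hmem _ h)
  · rintro j z ⟨p, hp, h⟩
    exact (inv.mem _ h hp).2
  · rintro j j' z ⟨p, hp, h⟩ ⟨p', hp', h'⟩
    exact congrArg Prod.fst (inv.inj _ h hp _ h' hp' rfl)
  · rintro j z z' ⟨p, hp, h⟩ ⟨p', hp', h'⟩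
    exact congrArg (fun e => e.2.2) (eq_of_nodup_keys hk h h' rfl)
  · intro z hz
    simp only [List.mem_toFinset, List.mem_filter] at hz ⊢
    exact hz.1
  · intro j hj
    rw [List.mem_toFinset, mem_highObjects] at hj
    obtain ⟨e, he, -, rfl⟩ := hj
    exact List.mem_toFinset.2 (hmem e he)
  · intro z j hz hj hzj
    simp only [List.mem_toFinset, List.mem_filter, Bool.not_eq_true', ← Bool.not_eq_true,
      isLowOwner_iff] at hz hj ⊢
    rw [mem_highObjects]
    rw [← inv.keys, List.mem_map] at hj
    obtain ⟨e, he, rfl⟩ := hj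
    refine ⟨e, he, ?_, rfl⟩
    by_cases hown : isOwner S z = true
    · obtain ⟨j', p, hp, hj'⟩ := isOwner_iff.1 hown
      -- The owned object costs more than the gap, so a neighbor costs at least the gap; as no price
      -- equals the gap, the neighbor is above it too.
      have h1 := inv.cheap _ hj' hp e he hzj
      have h2 := hg3 _ hj'
      have h3 := hg3 _ he
      have h4 : ¬ p < priceGap S := fun h4 => hz.2 ⟨_, hj', hp, h4, rfl⟩
      simp only at h1 h2
      omega
    -- A neighbor not above the gap would be below the cap, and the idle bidder could still bid on a
    -- cheapest neighbor, although no bids are left.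
    · by_contra hlt
      obtain ⟨e', he', hmin⟩ := (S.toFinset.filter fun e => ent E z e.1 = true).exists_min_image
        (fun e => e.2.1) ⟨e, by simp [he, hzj]⟩
      simp only [Finset.mem_filter, List.mem_toFinset] at he' hmin
      have : (z, e') ∈ bids E lefts (rights.length + 2) S := by
        rw [mem_bids]
        refine ⟨hz.1, he'.1, ?_⟩
        have := hmin e ⟨he, hzj⟩
        simp only [isBid, Bool.and_eq_true, Bool.not_eq_true', decide_eq_true_eq,
          List.all_eq_true, Bool.or_eq_true]
        refine ⟨⟨⟨by simpa using hown, he'.2⟩, by omega⟩, fun e'' he'' => ?_⟩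
        by_cases h5 : ent E z e''.1 = true
        · exact .inr (hmin e'' ⟨he'', h5⟩)
        · exact .inl (by simpa using h5)
      rw [hbids] at this
      simp at this
  · intro j hj
    rw [List.mem_toFinset, mem_highObjects] at hj
    obtain ⟨⟨j, p, z⟩, he, hp, rfl⟩ := hj
    simp only at hp
    refine ⟨z, ?_, p, by omega, he⟩
    simp only [List.mem_toFinset, List.mem_filter, Bool.not_eq_true', ← Bool.not_eq_true,
      isLowOwner_iff]
    refine ⟨(inv.mem _ he (by simp only; omega)).1, ?_⟩
    rintro ⟨e', he', h1, h2, h3⟩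
    have := inv.inj _ he (by simp only; omega) _ he' h1 h3.symm
    subst this
    simp only at h2
    omega
  · intro z hz hz'
    simp only [List.mem_toFinset, List.mem_filter, Bool.not_eq_true', ← Bool.not_eq_true,
      isLowOwner_iff, not_and, not_not] at hz hz'
    obtain ⟨⟨j, p, z⟩, he, h1, h2, rfl⟩ := hz' hz
    refine ⟨j, ⟨p, h1, he⟩, ?_⟩
    rw [List.mem_toFinset, mem_highObjects]
    rintro ⟨e', he', h3, h4⟩
    have := eq_of_nodup_keys hk he' he h4
    subst this
    simp only at h2 h3
    omega

/-! ### Extending list colorings -/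

section Hall

variable {V γ : Type}

theorem IsPartialListColoring.mono {G : SimpleGraph V} {L : V → Finset γ} {S S' : Finset V}
    {col : V → γ} (h : IsPartialListColoring G L S col) (hS : S' ⊆ S) :
    IsPartialListColoring G L S' col :=
  ⟨fun v hv => h.1 v (hS hv), fun u hu v hv => h.2 u (hS hu) v (hS hv)⟩

variable [DecidableEq V] [DecidableEq γ]

theorem exists_injOn_of_hall [Nonempty γ] (S : Finset V) (t : V → Finset γ)
    (h : ∀ X ⊆ S, X.card ≤ (X.biUnion t).card) :
    ∃ f : V → γ, Set.InjOn f S ∧ ∀ v ∈ S, f v ∈ t v := by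
  obtain ⟨f, hf, hft⟩ := (Finset.all_card_le_biUnion_card_iff_exists_injective
    (fun v : S => t v)).1 (fun X => by
      have := h (X.map (Function.Embedding.subtype _)) (fun v hv => by
        obtain ⟨w, -, rfl⟩ := Finset.mem_map.1 hv
        exact w.2)
      rw [Finset.card_map] at this
      refine this.trans (Finset.card_le_card fun i hi => ?_)
      simp only [Finset.mem_biUnion, Finset.mem_map] at hi ⊢
      obtain ⟨_, ⟨w, hw, rfl⟩, hi⟩ := hi
      exact ⟨w, hw, hi⟩)
  refine ⟨fun v => if hv : v ∈ S then f ⟨v, hv⟩ else Classical.arbitrary γ, ?_, ?_⟩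
  · intro u hu v hv huv
    rw [Finset.mem_coe] at hu hv
    simp only [hu, hv, dif_pos] at huv
    exact congrArg Subtype.val (hf huv)
  · intro v hv
    simpa only [hv, dif_pos] using hft ⟨v, hv⟩

theorem exists_injOn_of_card_le [Nonempty γ] (S : Finset V) (t : V → Finset γ)
    (h : ∀ v ∈ S, S.card ≤ (t v).card) : ∃ f : V → γ, Set.InjOn f S ∧ ∀ v ∈ S, f v ∈ t v := by
  refine exists_injOn_of_hall S t fun X hX => ?_
  rcases X.eq_empty_or_nonempty with rfl | ⟨v, hv⟩
  · simp
  · exact (Finset.card_le_card hX).trans ((h v (hX hv)).trans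
      (Finset.card_le_card (Finset.subset_biUnion_of_mem t hv)))

variable {G : SimpleGraph V} {L : V → Finset γ}

/-- A partial list coloring can be extended by new colors that are pairwise distinct. -/
theorem IsPartialListColoring.extend {X D : Finset V} {col f : V → γ}
    (h : IsPartialListColoring G L X col) (hf : Set.InjOn f D) (hL : ∀ v ∈ D, f v ∈ L v)
    (hnew : ∀ v ∈ D, f v ∉ X.image col) :
    IsPartialListColoring G L (X ∪ D) (fun v => if v ∈ X then col v else f v) := by
  refine ⟨fun v hv => ?_, fun u hu v hv huv => ?_⟩
  · by_cases hX : v ∈ X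
    · simpa [hX] using h.1 v hX
    · simpa [hX] using hL v ((Finset.mem_union.1 hv).resolve_left hX)
  · by_cases hX : u ∈ X <;> by_cases hX' : v ∈ X <;> simp only [hX, hX', if_true, if_false]
    · exact h.2 u hX v hX' huv
    · have h1 := hnew v ((Finset.mem_union.1 hv).resolve_left hX')
      exact fun h2 => h1 (h2 ▸ Finset.mem_image_of_mem col hX)
    · have h1 := hnew u ((Finset.mem_union.1 hu).resolve_left hX)
      exact fun h2 => h1 (h2 ▸ Finset.mem_image_of_mem col hX')
    · exact fun h2 => huv.ne (hf ((Finset.mem_union.1 hu).resolve_left hX)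
        ((Finset.mem_union.1 hv).resolve_left hX') h2)

/-- A partial list coloring can be extended to disjoint pairs of nonadjacent vertices, with a new
color for each pair. -/
theorem IsPartialListColoring.extend_pairs [Nonempty γ] {X P : Finset V} {col : V → γ} {y : V → V}
    (h : IsPartialListColoring G L X col)
    (hadj : ∀ u ∈ P, ¬G.Adj u (y u))
    (hcard : ∀ u ∈ P, (X.image col).card + P.card ≤ (L u ∩ L (y u)).card) :
    ∃ col' : V → γ, IsPartialListColoring G L (X ∪ (P ∪ P.image y)) col' ∧
      (∀ v ∈ X, col' v = col v) ∧ (((X ∪ (P ∪ P.image y)) \ X).image col').card ≤ P.card := by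
  obtain ⟨c, hc, hcL⟩ := exists_injOn_of_card_le P
    (fun u => (L u ∩ L (y u)) \ X.image col) (fun u hu => by
      have := hcard u hu
      have := Finset.le_card_sdiff (X.image col) (L u ∩ L (y u))
      omega)
  -- Every vertex of a pair gets a representative in `P`, whose color it receives. Equal colors
  -- force equal representatives, so they occur only within one nonadjacent pair.
  have hrep : ∀ v, ∃ a, v ∈ P ∪ P.image y → a ∈ P ∧ (v = a ∨ v = y a) := by
    intro v
    by_cases hv : v ∈ P
    · exact ⟨v, fun _ => ⟨hv, .inl rfl⟩⟩
    · by_cases hv' : v ∈ P.image y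
      · obtain ⟨a, ha, rfl⟩ := Finset.mem_image.1 hv'
        exact ⟨a, fun _ => ⟨ha, .inr rfl⟩⟩
      · exact ⟨v, fun h => absurd h fun h => (Finset.mem_union.1 h).elim hv hv'⟩
  choose r hr using hrep
  have hPL : ∀ v ∈ P ∪ P.image y, c (r v) ∈ L v ∧ c (r v) ∉ X.image col := by
    intro v hv
    obtain ⟨h1, h2⟩ := hr v hv
    have h3 := hcL _ h1
    rw [Finset.mem_sdiff, Finset.mem_inter] at h3
    rcases h2 with h2 | h2
    · exact ⟨(congrArg (fun w => c (r v) ∈ L w) h2).mpr h3.1.1, h3.2⟩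
    · exact ⟨(congrArg (fun w => c (r v) ∈ L w) h2).mpr h3.1.2, h3.2⟩
  refine ⟨fun v => if v ∈ X then col v else c (r v), ⟨fun v hv => ?_, fun u hu v hv huv => ?_⟩,
    fun v hv => by simp [hv], ?_⟩
  · by_cases hX : v ∈ X
    · simpa [hX] using h.1 v hX
    · simpa [hX] using (hPL v ((Finset.mem_union.1 hv).resolve_left hX)).1
  · by_cases hX : u ∈ X <;> by_cases hX' : v ∈ X <;> simp only [hX, hX', if_true, if_false]
    · exact h.2 u hX v hX' huv
    · have h1 := (hPL v ((Finset.mem_union.1 hv).resolve_left hX')).2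
      exact fun h2 => h1 (h2 ▸ Finset.mem_image_of_mem col hX)
    · have h1 := (hPL u ((Finset.mem_union.1 hu).resolve_left hX)).2
      exact fun h2 => h1 (h2 ▸ Finset.mem_image_of_mem col hX')
    · intro h2
      obtain ⟨h3, h4⟩ := hr u ((Finset.mem_union.1 hu).resolve_left hX)
      obtain ⟨h5, h6⟩ := hr v ((Finset.mem_union.1 hv).resolve_left hX')
      have h7 := hc h3 h5 h2
      rw [← h7] at h6
      rcases h4 with h4 | h4 <;> rcases h6 with h6 | h6
      · exact huv.ne (h4.trans h6.symm)
      · exact hadj _ h3 (by rwa [← h4, ← h6] at *)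
      · exact hadj _ h3 (by
          have := huv.symm
          rwa [h4, h6] at this)
      · exact huv.ne (h4.trans h6.symm)
  · refine (Finset.card_le_card (t := P.image c) fun i hi => ?_).trans Finset.card_image_le
    simp only [Finset.mem_image, Finset.mem_sdiff] at hi ⊢
    obtain ⟨v, ⟨hv, hX⟩, rfl⟩ := hi
    exact ⟨r v, (hr v ((Finset.mem_union.1 hv).resolve_left hX)).1, by simp [hX]⟩

end Hall

set_option linter.unusedSectionVars false

/-! ### Reduction to fewer colors than vertices -/

section Reduction

variable {V γ : Type} [DecidableEq V] [DecidableEq γ] {G : SimpleGraph V} {L : V → Finset γ}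
  {S : Finset V} {T : Finset γ} {O : γ → V → Prop} {Z : Finset V} {Q : Finset γ}

theorem HallDecomposition.lists_subset (D : HallDecomposition (fun v i => i ∈ L v) S T O Z Q)
    (hT : ∀ v ∈ S, L v ⊆ T) : ∀ v ∈ Z, L v ⊆ Q :=
  fun v hv _ hi => D.nbr hv (hT v (D.left_subset hv) hi) hi

/-- Vertices outside `Z` take their matched colors, which are distinct and outside `Q`; lists of `Z`
lie inside `Q`, so no conflict can arise. -/
theorem HallDecomposition.colorable_iff [Nonempty γ]
    (D : HallDecomposition (fun v i => i ∈ L v) S T O Z Q)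
    (hT : ∀ v ∈ S, L v ⊆ T) :
    (∃ col, IsPartialListColoring G L S col) ↔ ∃ col, IsPartialListColoring G L Z col := by
  refine ⟨fun ⟨col, h⟩ => ⟨col, h.mono D.left_subset⟩, fun ⟨col, h⟩ => ?_⟩
  have hf : ∀ v, ∃ i, v ∈ S → v ∉ Z → O i v ∧ i ∉ Q := by
    intro v
    by_cases hv : v ∈ S ∧ v ∉ Z
    · obtain ⟨i, hi⟩ := D.cover hv.1 hv.2
      exact ⟨i, fun _ _ => hi⟩
    · exact ⟨Classical.arbitrary γ, fun h1 h2 => absurd ⟨h1, h2⟩ hv⟩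
  choose f hf using hf
  refine ⟨_, (h.extend (D := S \ Z) (f := f) ?_ ?_ ?_).mono (by simp)⟩
  · intro u hu v hv huv
    simp only [Finset.coe_sdiff, Set.mem_sdiff, Finset.mem_coe] at hu hv
    have h1 := (hf u hu.1 hu.2).1
    rw [huv] at h1
    exact D.func h1 (hf v hv.1 hv.2).1
  · intro v hv
    rw [Finset.mem_sdiff] at hv
    exact D.adj (hf v hv.1 hv.2).1
  · intro v hv hi
    rw [Finset.mem_sdiff] at hv
    obtain ⟨u, hu, h1⟩ := Finset.mem_image.1 hi
    exact (hf v hv.1 hv.2).2 (h1 ▸ D.lists_subset hT u hu (h.1 u hu))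

/-- A matching that covers all vertices assigns pairwise distinct colors. -/
theorem HallDecomposition.colorable_of_forall [Nonempty γ]
    (D : HallDecomposition (fun v i => i ∈ L v) S T O Z Q)
    (h : ∀ v ∈ S, ∃ i, O i v) : ∃ col, IsPartialListColoring G L S col := by
  have hf : ∀ v, ∃ i, v ∈ S → O i v := fun v => by
    by_cases hv : v ∈ S
    · exact (h v hv).imp fun _ h _ => h
    · exact ⟨Classical.arbitrary γ, fun h => absurd h hv⟩
  choose f hf using hf
  refine ⟨f, fun v hv => D.adj (hf v hv), fun u hu v hv huv h1 => ?_⟩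
  exact huv.ne (D.func (hf u hu) (h1 ▸ hf v hv))

/-- An unmatched vertex must belong to `Z`, and the matching maps `Q` injectively into the rest of
`Z`. -/
theorem HallDecomposition.card_lt (D : HallDecomposition (fun v i => i ∈ L v) S T O Z Q)
    {v : V} (hv : v ∈ S) (h : ∀ i, ¬O i v) : Q.card < Z.card := by
  have hvZ : v ∈ Z := by
    by_contra hvZ
    obtain ⟨i, hi, -⟩ := D.cover hv hvZ
    exact h i hi
  refine lt_of_le_of_lt ?_ (Finset.card_erase_lt_of_mem hvZ)
  have hg : ∀ i, ∃ w, i ∈ Q → w ∈ Z ∧ O i w := fun i => by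
    by_cases hi : i ∈ Q
    · obtain ⟨w, hw⟩ := D.high hi
      exact ⟨w, fun _ => hw⟩
    · exact ⟨v, fun h => absurd h hi⟩
  choose g hg using hg
  refine Finset.card_le_card_of_injOn g (fun i hi => ?_) (fun i hi j hj hij => ?_)
  · have := hg i hi
    rw [Finset.mem_coe, Finset.mem_erase]
    exact ⟨fun h1 => h i (h1 ▸ this.2), this.1⟩
  · exact D.inj (hg i hi).2 (hij ▸ (hg j hj).2)

end Reduction

/-! ### Many disjoint pairs of nonadjacent vertices -/

section Pairs

variable {V γ : Type} [DecidableEq V] [DecidableEq γ] {G : SimpleGraph V} {L : V → Finset γ}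
  {S : Finset V} {T : Finset γ}

/-- Inclusion and exclusion inside `T`: two sets of size n - k in fewer than n colors. -/
theorem card_lists_inter {n k : ℕ} (hT : ∀ v ∈ S, L v ⊆ T) (hk : ∀ v ∈ S, (L v).card + k = n)
    (hTn : T.card < n) {u v : V} (hu : u ∈ S) (hv : v ∈ S) :
    n < (L u ∩ L v).card + 2 * k := by
  have h1 := Finset.card_union_add_card_inter (L u) (L v)
  have h2 := Finset.card_le_card (Finset.union_subset (hT u hu) (hT v hv))
  have h3 := hk u hu
  have h4 := hk v hv
  omega

/-- Coloring k pairs with k colors saves k colors, exactly what the lists are short of: n - 2k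
vertices remain, and each keeps at least n - 2k colors of its list. -/
theorem colorable_of_pairs [Nonempty γ] {k : ℕ} (hT : ∀ v ∈ S, L v ⊆ T)
    (hk : ∀ v ∈ S, (L v).card + k = S.card) (hTn : T.card < S.card) (hkn : 3 * k ≤ S.card)
    {P : Finset V} (hPS : P ⊆ S) {y : V → V} (hyS : ∀ u ∈ P, y u ∈ S) (hy : Set.InjOn y P)
    (hyP : ∀ u ∈ P, y u ∉ P) (hadj : ∀ u ∈ P, ¬G.Adj u (y u)) (hP : k ≤ P.card) :
    ∃ col, IsPartialListColoring G L S col := by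
  -- Exactly k pairs are kept; `rfl` replaces k by `P'.card`.
  obtain ⟨P', hP', rfl⟩ := Finset.exists_subset_card_eq hP
  obtain ⟨i⟩ := ‹Nonempty γ›
  have h0 : IsPartialListColoring G L ∅ (fun _ => i) := by constructor <;> simp
  have : Nonempty γ := ⟨i⟩
  obtain ⟨col, h1, -, h2⟩ := h0.extend_pairs (P := P') (y := y) (fun u hu => hadj u (hP' hu))
    (fun u hu => by
      have := card_lists_inter hT hk hTn (hPS (hP' hu)) (hyS u (hP' hu))
      simp only [Finset.image_empty, Finset.card_empty]
      omega)
  rw [Finset.empty_union] at h1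
  rw [Finset.empty_union, Finset.sdiff_empty] at h2
  have hdisj : Disjoint P' (P'.image y) := by
    rw [Finset.disjoint_left]
    intro u hu hu'
    obtain ⟨w, hw, rfl⟩ := Finset.mem_image.1 hu'
    exact hyP w (hP' hw) (hP' hu)
  have hsub : P' ∪ P'.image y ⊆ S := Finset.union_subset (hP'.trans hPS) (fun v hv => by
    obtain ⟨w, hw, rfl⟩ := Finset.mem_image.1 hv
    exact hyS w (hP' hw))
  have hcard : (P' ∪ P'.image y).card = 2 * P'.card := by
    rw [Finset.card_union_of_disjoint hdisj, Finset.card_image_of_injOn (hy.mono hP')]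
    ring
  obtain ⟨f, hf, hfL⟩ := exists_injOn_of_card_le (S \ (P' ∪ P'.image y))
    (fun v => L v \ (P' ∪ P'.image y).image col) (fun v hv => by
      have h3 := hk v (Finset.mem_sdiff.1 hv).1
      have h4 := Finset.le_card_sdiff ((P' ∪ P'.image y).image col) (L v)
      have h5 := Finset.card_sdiff_add_card_eq_card hsub
      omega)
  refine ⟨_, (h1.extend hf (fun v hv => (Finset.mem_sdiff.1 (hfL v hv)).1)
    (fun v hv => (Finset.mem_sdiff.1 (hfL v hv)).2)).mono
      (Finset.union_sdiff_of_subset hsub).ge⟩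

end Pairs

/-! ### Restriction to few interchangeable colors -/

section Interchange

variable {V γ : Type} [DecidableEq V] [DecidableEq γ] {G : SimpleGraph V} {L : V → Finset γ}

/-- Colors of `A` that are in all lists are interchangeable, and `|S|` of them suffice. -/
theorem exists_coloring_of_interchangeable [Nonempty γ] {S : Finset V} {A U K : Finset γ}
    (hU : U ⊆ A) (hUL : ∀ i ∈ U, ∀ v ∈ S, i ∈ L v) (hK : K ⊆ U)
    (hKcard : min S.card U.card ≤ K.card) {col : V → γ} (h : IsPartialListColoring G L S col) :
    ∃ col', IsPartialListColoring G L S col' ∧ (∀ v ∈ S, col' v ∈ U → col' v ∈ K) ∧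
      (S.image col' ∩ A).card ≤ (S.image col ∩ A).card := by
  -- The used colors of `U` are renamed injectively into `K`. There are at most `S.card` of them and
  -- at most `U.card`, whence the minimum in the hypothesis. Colors outside `U` stay, so they cannot
  -- clash with `K ⊆ U`.
  obtain ⟨f, hf, hfK⟩ := exists_injOn_of_card_le (S.image col ∩ U) (fun _ => K) (fun _ _ => by
    refine le_trans (le_min ?_ ?_) hKcard
    · exact (Finset.card_le_card Finset.inter_subset_left).trans Finset.card_image_le
    · exact Finset.card_le_card Finset.inter_subset_right)
  have hfK' : ∀ v ∈ S, col v ∈ U → f (col v) ∈ K := fun v hv hvU =>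
    hfK _ (Finset.mem_inter.2 ⟨Finset.mem_image_of_mem _ hv, hvU⟩)
  refine ⟨fun v => if col v ∈ U then f (col v) else col v, ⟨fun v hv => ?_,
    fun u hu v hv huv => ?_⟩, fun v hv => ?_, ?_⟩
  · by_cases hvU : col v ∈ U
    · simpa [hvU] using hUL _ (hK (hfK' v hv hvU)) v hv
    · simpa [hvU] using h.1 v hv
  · by_cases h1 : col u ∈ U <;> by_cases h2 : col v ∈ U <;> simp only [h1, h2, if_true, if_false]
    · exact fun h3 => h.2 u hu v hv huv (hf
        (Finset.mem_coe.2 (Finset.mem_inter.2 ⟨Finset.mem_image_of_mem _ hu, h1⟩))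
        (Finset.mem_coe.2 (Finset.mem_inter.2 ⟨Finset.mem_image_of_mem _ hv, h2⟩)) h3)
    · exact fun h3 => h2 (h3 ▸ hK (hfK' u hu h1))
    · exact fun h3 => h1 (h3 ▸ hK (hfK' v hv h2))
    · exact h.2 u hu v hv huv
  · by_cases hvU : col v ∈ U
    · simpa [hvU] using fun _ => hfK' v hv hvU
    · simp [hvU]
  · refine (Finset.card_le_card (t := (S.image col ∩ A).image
      fun i => if i ∈ U then f i else i) fun i hi => ?_).trans Finset.card_image_le
    obtain ⟨hi, hiA⟩ := Finset.mem_inter.1 hi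
    obtain ⟨v, hv, rfl⟩ := Finset.mem_image.1 hi
    refine Finset.mem_image.2 ⟨col v, Finset.mem_inter.2 ⟨Finset.mem_image_of_mem _ hv, ?_⟩, rfl⟩
    by_cases hvU : col v ∈ U
    · exact hU hvU
    · simpa [hvU] using hiA

end Interchange

/-! ### The vertices and colors that decide an instance -/

/-- A graph on `S` with lists of `|S| - k` of fewer than `|S|` colors, in which all vertices outside
of a small set `U` are adjacent. The set `R` consists of the colors that are missing from at least a
quarter of the lists. A bipartite graph has on one side the colors of `R` and the vertices of `U`
(the vertex `u` is represented by `c + u`), on the other side the vertices outside of `U`; colors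
are joined to the vertices whose lists contain them, vertices of `U` to their nonneighbors. -/
structure DenseInstance (G : SimpleGraph ℕ) (L : ℕ → Finset ℕ) (S T U R : Finset ℕ) (k c : ℕ)
    (edge O : ℕ → ℕ → Prop) (Z Q Y : Finset ℕ) : Prop where
  lists : ∀ v ∈ S, L v ⊆ T
  card_lists : ∀ v ∈ S, (L v).card + k = S.card
  card_colors : T.card < S.card
  large : 11 * k ≤ S.card
  subset : U ⊆ S
  card_le : U.card + 2 ≤ 2 * k
  clique : ∀ u ∈ S, u ∉ U → ∀ v ∈ S, v ∉ U → u ≠ v → G.Adj u v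
  mem_rare : ∀ i, i ∈ R ↔ i ∈ T ∧ S.card ≤ 4 * (S.filter fun v => i ∉ L v).card
  lt : ∀ i ∈ T, i < c
  edge_color : ∀ i ∈ T, ∀ v ∈ S, edge i v ↔ i ∈ L v
  edge_vertex : ∀ u ∈ U, ∀ v ∈ S, edge (c + u) v ↔ ¬G.Adj u v
  decomposition : HallDecomposition edge (R ∪ U.image fun u => c + u) (S \ U) O Z Q
  mem_paired : ∀ v, v ∈ Y ↔ ∃ u ∈ U, O v (c + u)

namespace DenseInstance

variable {G : SimpleGraph ℕ} {L : ℕ → Finset ℕ} {S T U R : Finset ℕ} {k c : ℕ}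
  {edge O : ℕ → ℕ → Prop} {Z Q Y : Finset ℕ}

theorem rare_subset (D : DenseInstance G L S T U R k c edge O Z Q Y) : R ⊆ T :=
  fun i hi => ((D.mem_rare i).1 hi).1

theorem k_pos (D : DenseInstance G L S T U R k c edge O Z Q Y) : 1 ≤ k := by
  have := D.card_le
  omega

theorem card_missing_lt (D : DenseInstance G L S T U R k c edge O Z Q Y) {v : ℕ} (hv : v ∈ S) :
    (T \ L v).card < k := by
  have h1 := Finset.card_sdiff_add_card_eq_card (D.lists v hv)
  have h2 := D.card_lists v hv
  have h3 := D.card_colors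
  omega

/-- Double counting of the pairs of a rare color and a vertex whose list lacks it: each rare color
occurs in at least n/4 of them, each vertex in at most k - 1. -/
theorem card_rare (D : DenseInstance G L S T U R k c edge O Z Q Y) : R.card + 4 ≤ 4 * k := by
  have h1 : R.card * S.card ≤ ∑ i ∈ R, 4 * (S.filter fun v => i ∉ L v).card := by
    rw [← smul_eq_mul, ← Finset.sum_const]
    exact Finset.sum_le_sum fun i hi => ((D.mem_rare i).1 hi).2
  have h2 : ∑ i ∈ R, (S.filter fun v => i ∉ L v).card = ∑ v ∈ S, (R.filter fun i => i ∉ L v).card :=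
    Finset.sum_card_bipartiteAbove_eq_sum_card_bipartiteBelow (fun i v => i ∉ L v)
  have h3 : ∑ v ∈ S, (R.filter fun i => i ∉ L v).card ≤ S.card * (k - 1) := by
    rw [← smul_eq_mul, ← Finset.sum_const]
    refine Finset.sum_le_sum fun v hv => ?_
    have h4 := D.card_missing_lt hv
    have h5 : (R.filter fun i => i ∉ L v) ⊆ T \ L v := fun i hi => by
      rw [Finset.mem_filter] at hi
      exact Finset.mem_sdiff.2 ⟨D.rare_subset hi.1, hi.2⟩
    have := Finset.card_le_card h5
    omega
  rw [← Finset.mul_sum, h2] at h1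
  have h5 : S.card * R.card ≤ S.card * (4 * (k - 1)) := by nlinarith
  have h6 := Nat.le_of_mul_le_mul_left h5 (by have := D.card_colors; omega)
  have := D.k_pos
  omega

theorem paired_subset (D : DenseInstance G L S T U R k c edge O Z Q Y) : Y ⊆ S \ U := by
  intro v hv
  obtain ⟨u, _, h⟩ := (D.mem_paired v).1 hv
  exact D.decomposition.right h

theorem deciding_subset (D : DenseInstance G L S T U R k c edge O Z Q Y) : U ∪ (Q ∪ Y) ⊆ S :=
  Finset.union_subset D.subset (Finset.union_subset
    (D.decomposition.right_subset.trans Finset.sdiff_subset)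
    (D.paired_subset.trans Finset.sdiff_subset))

/-- `Q \ Y` is matched into the rare colors of `Z`, so |Q \ Y| + |R \ Z| ≤ |R| ≤ 4k - 4; add |U| ≤
2k - 2 and |Y| ≤ k - 1. Including |R \ Z| in the estimate pays off in `colorable_of_deciding`. -/
theorem card_deciding (D : DenseInstance G L S T U R k c edge O Z Q Y) (hY : Y.card < k) :
    (U ∪ (Q ∪ Y)).card + (R \ Z).card + 7 ≤ 7 * k := by
  have h1 : (Q \ Y).card ≤ (R ∩ Z).card := by
    have hg : ∀ v, ∃ i, v ∈ Q → i ∈ Z ∧ O v i := fun v => by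
      by_cases hv : v ∈ Q
      · obtain ⟨i, hi⟩ := D.decomposition.high hv
        exact ⟨i, fun _ => hi⟩
      · exact ⟨0, fun h => absurd h hv⟩
    choose g hg using hg
    refine Finset.card_le_card_of_injOn g (fun v hv => ?_) (fun v hv w hw hvw => ?_)
    · rw [Finset.mem_coe, Finset.mem_sdiff] at hv
      obtain ⟨h2, h3⟩ := hg v hv.1
      rw [Finset.mem_coe, Finset.mem_inter]
      refine ⟨?_, h2⟩
      rcases Finset.mem_union.1 (D.decomposition.left h3) with h4 | h4
      · exact h4
      · obtain ⟨u, hu, h5⟩ := Finset.mem_image.1 h4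
        exact absurd ((D.mem_paired v).2 ⟨u, hu, by simpa only [h5] using h3⟩) hv.2
    · rw [Finset.mem_coe, Finset.mem_sdiff] at hv hw
      exact D.decomposition.inj (hg v hv.1).2 (hvw ▸ (hg w hw.1).2)
  have h2 := Finset.card_union_le U (Q ∪ Y)
  have h3 : (Q ∪ Y).card = (Q \ Y).card + Y.card := by
    rw [← Finset.sdiff_union_self_eq_union, Finset.card_union_of_disjoint Finset.sdiff_disjoint]
  have h4 := Finset.card_sdiff_add_card_inter R Z
  have h5 := D.card_rare
  have h6 := D.card_le
  omega

/-- The matching edges between `U` and `Y` are disjoint pairs of nonadjacent vertices. -/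
theorem colorable_of_card_paired (D : DenseInstance G L S T U R k c edge O Z Q Y)
    (hY : k ≤ Y.card) : ∃ col, IsPartialListColoring G L S col := by
  have hy : ∀ v, ∃ u, v ∈ Y → u ∈ U ∧ O v (c + u) := fun v => by
    by_cases hv : v ∈ Y
    · obtain ⟨u, hu⟩ := (D.mem_paired v).1 hv
      exact ⟨u, fun _ => hu⟩
    · exact ⟨0, fun h => absurd h hv⟩
  choose y hy using hy
  have hYS : ∀ v ∈ Y, v ∈ S ∧ v ∉ U := fun v hv => Finset.mem_sdiff.1 (D.paired_subset hv)
  refine colorable_of_pairs (y := y) D.lists D.card_lists D.card_colors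
    (by have := D.large; omega) (fun v hv => (hYS v hv).1) (fun v hv => D.subset (hy v hv).1)
    (fun v hv w hw hvw => ?_) (fun v hv h => (hYS _ h).2 (hy v hv).1) (fun v hv h => ?_) hY
  · exact D.decomposition.inj (hy v hv).2 (hvw ▸ (hy w hw).2)
  · obtain ⟨h1, h2⟩ := hy v hv
    exact (D.edge_vertex _ h1 v (hYS v hv).1).1 (D.decomposition.adj h2) h.symm

/-- Necessity of the budget, stated without subtraction from |T'|. In the given coloring, the
vertices of `W` have distinct colors of `T'` that `X` does not use, so |T'| bounds the colors of `X`
in `T'` plus |P| + n - |V'|. Recoloring the pairs costs at most |P| colors. -/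
theorem exists_deciding_of_colorable (D : DenseInstance G L S T U R k c edge O Z Q Y)
    (hY : Y.card < k) {T' : Finset ℕ} (hT' : ∀ i, i ∈ T' ↔ i ∈ T ∧ (i ∈ R → i ∉ Z)) {lam : ℕ → ℕ}
    (h : IsPartialListColoring G L S lam) :
    ∃ col, IsPartialListColoring G L (U ∪ (Q ∪ Y)) col ∧
      ((U ∪ (Q ∪ Y)).image col ∩ T').card + (S.card - (U ∪ (Q ∪ Y)).card) ≤ T'.card := by
  classical
  have hdec := D.deciding_subset
  have hcard := D.card_deciding hY
  have hlarge := D.large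
  set V' := U ∪ (Q ∪ Y) with hV'
  -- The vertices of `U` outside `Z`: they may share colors with vertices outside `V'`, but the
  -- matching provides nonadjacent partners `y u` in `Y` and outside `Q`.
  set P := U.filter fun u => c + u ∉ Z with hP
  have hy : ∀ u, ∃ v, u ∈ P → O v (c + u) ∧ v ∉ Q := fun u => by
    by_cases hu : u ∈ P
    · rw [hP, Finset.mem_filter] at hu
      obtain ⟨v, hv⟩ := D.decomposition.cover (z := c + u)
        (Finset.mem_union_right _ (Finset.mem_image_of_mem _ hu.1)) hu.2
      exact ⟨v, fun _ => hv⟩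
    · exact ⟨0, fun h => absurd h hu⟩
  choose y hy using hy
  have hPU : P ⊆ U := Finset.filter_subset _ _
  have hyY : P.image y ⊆ Y := fun v hv => by
    obtain ⟨u, hu, rfl⟩ := Finset.mem_image.1 hv
    exact (D.mem_paired _).2 ⟨u, hPU hu, (hy u hu).1⟩
  have hyinj : Set.InjOn y P := fun u hu v hv huv => by
    have h1 := (hy u hu).1
    rw [huv] at h1
    have := D.decomposition.func h1 (hy v hv).1
    omega
  have hPV : P ∪ P.image y ⊆ V' := Finset.union_subset
    (hPU.trans Finset.subset_union_left) (hyY.trans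
      (Finset.subset_union_right.trans Finset.subset_union_right))
  -- `X` keeps its colors. The partners of `P` move to `W`, so that their old colors are counted
  -- there together with those outside `V'`.
  set X := V' \ (P ∪ P.image y) with hX
  set W := P.image y ∪ (S \ V') with hW
  have hWC : ∀ w ∈ W, w ∈ S ∧ w ∉ U ∧ w ∉ Q := fun w hw => by
    rcases Finset.mem_union.1 hw with hw | hw
    · have h1 := Finset.mem_sdiff.1 (D.paired_subset (hyY hw))
      obtain ⟨u, hu, rfl⟩ := Finset.mem_image.1 hw
      exact ⟨h1.1, h1.2, (hy u hu).2⟩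
    · simp only [hV', Finset.mem_sdiff, Finset.mem_union, not_or] at hw
      exact ⟨hw.1, hw.2.1, hw.2.2.1⟩
  -- A color of `Z` occurs, within the clique, only in lists of vertices of `Q`; the vertices of `W`
  -- are not in `Q`.
  have hWT : W.image lam ⊆ T' := fun i hi => by
    obtain ⟨w, hw, rfl⟩ := Finset.mem_image.1 hi
    obtain ⟨h1, h2, h3⟩ := hWC w hw
    have h4 := D.lists w h1 (h.1 w h1)
    refine (hT' _).2 ⟨h4, fun _ h5 => h3 ?_⟩
    exact D.decomposition.nbr h5 (Finset.mem_sdiff.2 ⟨h1, h2⟩)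
      ((D.edge_color _ h4 w h1).2 (h.1 w h1))
  have hWinj : Set.InjOn lam W := fun u hu v hv huv => by
    by_contra hne
    obtain ⟨h1, h2, -⟩ := hWC u hu
    obtain ⟨h3, h4, -⟩ := hWC v hv
    exact h.2 u h1 v h3 (D.clique u h1 h2 v h3 h4 hne) huv
  -- Every vertex of `X` is adjacent to all of `W`: for a clique vertex this is clear, and a vertex
  -- of `U` in `X` lies in `Z`, so its nonneighbors in the clique are in `Q`.
  have hXW : Disjoint (X.image lam ∩ T') (W.image lam) := by
    rw [Finset.disjoint_left]
    intro i hi hi'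
    obtain ⟨w, hw, rfl⟩ := Finset.mem_image.1 hi'
    obtain ⟨x, hx, hxw⟩ := Finset.mem_image.1 (Finset.mem_inter.1 hi).1
    obtain ⟨h1, h2, h3⟩ := hWC w hw
    have hx' := Finset.mem_sdiff.1 hx
    have hxS := hdec hx'.1
    refine h.2 x hxS w h1 ?_ hxw
    by_cases hxU : x ∈ U
    · by_contra hadj
      have h4 : c + x ∈ Z := by
        by_contra h4
        exact hx'.2 (Finset.mem_union_left _ (Finset.mem_filter.2 ⟨hxU, h4⟩))
      exact h3 (D.decomposition.nbr h4 (Finset.mem_sdiff.2 ⟨h1, h2⟩)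
        ((D.edge_vertex x hxU w h1).2 hadj))
    · refine D.clique x hxS hxU w h1 h2 ?_
      rintro rfl
      rcases Finset.mem_union.1 hw with hw | hw
      · exact hx'.2 (Finset.mem_union_right _ hw)
      · exact (Finset.mem_sdiff.1 hw).2 hx'.1
  have hWcard : W.card = P.card + (S.card - V'.card) := by
    rw [hW, Finset.card_union_of_disjoint, Finset.card_image_of_injOn hyinj,
      Finset.card_sdiff_of_subset hdec]
    rw [Finset.disjoint_left]
    exact fun v hv hv' => (Finset.mem_sdiff.1 hv').2 (hPV (Finset.mem_union_right _ hv))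
  have hcount : (X.image lam ∩ T').card + (P.card + (S.card - V'.card)) ≤ T'.card := by
    rw [← hWcard, ← Finset.card_image_of_injOn hWinj, ← Finset.card_union_of_disjoint hXW]
    exact Finset.card_le_card (Finset.union_subset Finset.inter_subset_right hWT)
  have hXP : X ∪ (P ∪ P.image y) = V' := Finset.sdiff_union_of_subset hPV
  obtain ⟨col, h1, h2, h3⟩ := (h.mono (Finset.sdiff_subset.trans hdec) :
    IsPartialListColoring G L X lam).extend_pairs (P := P) (y := y) (fun u hu => by
      have h4 := Finset.mem_sdiff.1 (D.paired_subset (hyY (Finset.mem_image_of_mem y hu)))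
      exact (D.edge_vertex u (hPU hu) _ h4.1).1 (D.decomposition.adj (hy u hu).1))
    (fun u hu => by
      have h4 := Finset.mem_sdiff.1 (D.paired_subset (hyY (Finset.mem_image_of_mem y hu)))
      -- The partners share more than n - 2k ≥ 9k colors, while `X` and `P` account for at most 7k -
      -- 7 and 2k - 2. This uses n ≥ 11k.
      have h5 := card_lists_inter D.lists D.card_lists D.card_colors (D.subset (hPU hu)) h4.1
      have h6 : (X.image lam).card ≤ X.card := Finset.card_image_le
      have h7 : X.card ≤ V'.card := Finset.card_le_card Finset.sdiff_subset
      have h8 : P.card ≤ U.card := Finset.card_le_card hPU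
      have h9 := D.card_le
      omega)
  rw [hXP] at h1 h3
  refine ⟨col, h1, ?_⟩
  have h4 : V'.image col ∩ T' ⊆ (X.image lam ∩ T') ∪ (V' \ X).image col := by
    intro i hi
    obtain ⟨hi, hiT⟩ := Finset.mem_inter.1 hi
    obtain ⟨v, hv, rfl⟩ := Finset.mem_image.1 hi
    by_cases hvX : v ∈ X
    · refine Finset.mem_union_left _ (Finset.mem_inter.2 ⟨?_, hiT⟩)
      rw [h2 v hvX]
      exact Finset.mem_image_of_mem _ hvX
    · exact Finset.mem_union_right _ (Finset.mem_image_of_mem _ (Finset.mem_sdiff.2 ⟨hv, hvX⟩))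
  have h5 := (Finset.card_le_card h4).trans (Finset.card_union_le _ _)
  omega

/-- Sufficiency of the budget: the set `F` of unused colors of `T'` has at least as many elements as
there are uncolored vertices. Unused rare colors are assigned along the matching, the others by
Hall's theorem. -/
theorem colorable_of_deciding (D : DenseInstance G L S T U R k c edge O Z Q Y)
    (hY : Y.card < k) {T' : Finset ℕ} (hT' : ∀ i, i ∈ T' ↔ i ∈ T ∧ (i ∈ R → i ∉ Z)) {mu : ℕ → ℕ}
    (h : IsPartialListColoring G L (U ∪ (Q ∪ Y)) mu)
    (hs : ((U ∪ (Q ∪ Y)).image mu ∩ T').card + (S.card - (U ∪ (Q ∪ Y)).card) ≤ T'.card) :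
    ∃ col, IsPartialListColoring G L S col := by
  classical
  have hdec := D.deciding_subset
  have hcard := D.card_deciding hY
  have hlarge := D.large
  set V' := U ∪ (Q ∪ Y) with hV'
  have hDcard : (S \ V').card = S.card - V'.card := Finset.card_sdiff_of_subset hdec
  set F := T' \ V'.image mu with hF
  have hFcard : (S \ V').card ≤ F.card := by
    have := Finset.card_sdiff_add_card_inter T' (V'.image mu)
    rw [Finset.inter_comm, ← hF] at this
    omega
  -- The rare colors of `F`. They are hard to place, but each is matched with a clique vertex
  -- outside `Q`, which is uncolored.
  set B := (R \ Z) \ V'.image mu with hB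
  have hg : ∀ i, ∃ v, i ∈ B → v ∈ S \ V' ∧ i ∈ L v ∧ O v i := fun i => by
    by_cases hi : i ∈ B
    · have hi' := hi
      simp only [hB, Finset.mem_sdiff] at hi'
      obtain ⟨v, hv, hvQ⟩ := D.decomposition.cover (Finset.mem_union_left _ hi'.1.1) hi'.1.2
      have h1 := Finset.mem_sdiff.1 (D.decomposition.right hv)
      have hiT := D.rare_subset hi'.1.1
      refine ⟨v, fun _ => ⟨Finset.mem_sdiff.2 ⟨h1.1, ?_⟩,
        (D.edge_color i hiT v h1.1).1 (D.decomposition.adj hv), hv⟩⟩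
      simp only [hV', Finset.mem_union, not_or]
      refine ⟨h1.2, hvQ, fun hvY => ?_⟩
      -- A vertex matched with the color `i` is not in `Y`: its owner would also be `c + u`, while
      -- `i < c`.
      obtain ⟨u, -, hu⟩ := (D.mem_paired v).1 hvY
      have h2 := D.decomposition.func hv hu
      have h3 := D.lt i hiT
      omega
    · exact ⟨0, fun h => absurd h hi⟩
  choose g hg using hg
  have hginj : Set.InjOn g B := fun i hi j hj hij => by
    have h1 := (hg i hi).2.2
    rw [hij] at h1
    exact D.decomposition.func h1 (hg j hj).2.2
  have hgsub : B.image g ⊆ S \ V' := fun v hv => by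
    obtain ⟨i, hi, rfl⟩ := Finset.mem_image.1 hv
    exact (hg i hi).1
  have hBF : B ⊆ F := fun i hi => by
    simp only [hB, hF, Finset.mem_sdiff] at hi ⊢
    exact ⟨(hT' i).2 ⟨D.rare_subset hi.1.1, fun _ => hi.1.2⟩, hi.2⟩
  have h1card : ((S \ V') \ B.image g).card + B.card = (S \ V').card := by
    rw [← Finset.card_sdiff_add_card_eq_card hgsub, Finset.card_image_of_injOn hginj]
  have h2card : (F \ B).card + B.card = F.card := Finset.card_sdiff_add_card_eq_card hBF
  have hBcard : B.card ≤ (R \ Z).card := Finset.card_le_card Finset.sdiff_subset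
  obtain ⟨f, hf, hfL⟩ := exists_injOn_of_hall ((S \ V') \ B.image g)
    (fun v => L v ∩ (F \ B)) (fun X hX => by
      rcases X.eq_empty_or_nonempty with rfl | ⟨v, hv⟩
      · simp
      have hXS : X ⊆ S := hX.trans (Finset.sdiff_subset.trans Finset.sdiff_subset)
      by_cases hall : F \ B ⊆ X.biUnion fun v => L v ∩ (F \ B)
      · have h3 := Finset.card_le_card hall
        have h4 := Finset.card_le_card hX
        omega
      -- A color of `F \ B` missing from all lists of `X` is not rare, so |X| < n/4. A single vertex
      -- of `X` sees at least |F \ B| - (k - 1) ≥ n - 8k + 8 colors of `F \ B`, more than n/4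
      -- because n ≥ 11k.
      · obtain ⟨i, hi, hiX⟩ := Finset.not_subset.1 hall
        have hiL : ∀ w ∈ X, i ∉ L w := fun w hw hiw =>
          hiX (Finset.mem_biUnion.2 ⟨w, hw, Finset.mem_inter.2 ⟨hiw, hi⟩⟩)
        simp only [hF, hB, Finset.mem_sdiff, not_and, not_not] at hi
        obtain ⟨⟨hiT', himu⟩, hiB⟩ := hi
        have hiR : i ∉ R := fun hiR =>
          himu (hiB ⟨hiR, ((hT' i).1 hiT').2 hiR⟩)
        rw [D.mem_rare, not_and, not_le] at hiR
        have h3 := hiR ((hT' i).1 hiT').1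
        have h4 : X.card ≤ (S.filter fun v => i ∉ L v).card := Finset.card_le_card fun w hw =>
          Finset.mem_filter.2 ⟨hXS hw, hiL w hw⟩
        have h5 := Finset.card_le_card
          (Finset.subset_biUnion_of_mem (fun v => L v ∩ (F \ B)) hv)
        have h6 : (F \ B).card ≤ (L v ∩ (F \ B)).card + (T \ L v).card := by
          rw [← Finset.card_sdiff_add_card_inter (F \ B) (L v), Finset.inter_comm, add_comm]
          refine Nat.add_le_add_left (Finset.card_le_card fun j hj => ?_) _
          simp only [hF, Finset.mem_sdiff] at hj ⊢
          exact ⟨((hT' j).1 hj.1.1.1).1, hj.2⟩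
        have h7 := D.card_missing_lt (hXS hv)
        omega)
  have hr : ∀ v, ∃ i, v ∈ B.image g → i ∈ B ∧ g i = v := fun v => by
    by_cases hv : v ∈ B.image g
    · obtain ⟨i, hi⟩ := Finset.mem_image.1 hv
      exact ⟨i, fun _ => hi⟩
    · exact ⟨0, fun h => absurd h hv⟩
  choose r hr using hr
  have key : ∀ v ∈ S \ V', (if v ∈ B.image g then r v else f v) ∈ L v ∩ F := fun v hv => by
    by_cases hvg : v ∈ B.image g
    · obtain ⟨h1, h2⟩ := hr v hvg
      have h3 := (hg _ h1).2.1
      rw [h2] at h3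
      simpa only [hvg, if_true] using Finset.mem_inter.2 ⟨h3, hBF h1⟩
    · have := Finset.mem_inter.1 (hfL v (Finset.mem_sdiff.2 ⟨hv, hvg⟩))
      simpa only [hvg, if_false] using
        Finset.mem_inter.2 ⟨this.1, (Finset.mem_sdiff.1 this.2).1⟩
  refine ⟨_, (h.extend (D := S \ V') (f := fun v => if v ∈ B.image g then r v else f v)
    (fun u hu v hv huv => ?_) (fun v hv => (Finset.mem_inter.1 (key v hv)).1)
    (fun v hv => (Finset.mem_sdiff.1 (Finset.mem_inter.1 (key v hv)).2).2)).mono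
    (Finset.union_sdiff_of_subset hdec).ge⟩
  rw [Finset.mem_coe] at hu hv
  have hfB : ∀ v ∈ S \ V', v ∉ B.image g → f v ∉ B := fun v hv hvg =>
    (Finset.mem_sdiff.1 (Finset.mem_inter.1 (hfL v (Finset.mem_sdiff.2 ⟨hv, hvg⟩))).2).2
  by_cases h1 : u ∈ B.image g <;> by_cases h2 : v ∈ B.image g <;>
    simp only [h1, h2, if_true, if_false] at huv
  · rw [← (hr u h1).2, ← (hr v h2).2, huv]
  · exact absurd (huv ▸ (hr u h1).1) (hfB v hv h2)
  · exact absurd (huv ▸ (hr v h2).1) (hfB u hu h1)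
  · exact hf (Finset.mem_coe.2 (Finset.mem_sdiff.2 ⟨hu, h1⟩))
      (Finset.mem_coe.2 (Finset.mem_sdiff.2 ⟨hv, h2⟩)) huv

end DenseInstance

/-! ### The algorithm -/

/-- Adds two nonadjacent vertices that do not yet occur. -/
def greedyStep (A : List (List Bool)) (U : List ℕ) (e : ℕ × ℕ) : List ℕ :=
  bif !decide (e.1 = e.2) && !ent A e.1 e.2 && !decide (e.1 ∈ U) && !decide (e.2 ∈ U) then
    e.1 :: e.2 :: U else U

/-- The vertices of a maximal matching of the complement graph. -/
def greedyPairs (A : List (List Bool)) (verts : List ℕ) : List ℕ :=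
  (verts ×ˢ verts).foldl (greedyStep A) []

/-- The bipartite graph between colors and vertices (row `c + u` for the vertex `u`) on one side and
vertices on the other side. -/
def joinMatrix (c : ℕ) (A M : List (List Bool)) : List (List Bool) :=
  ((List.range c).map fun i => (List.range A.length).map fun v => ent M v i) ++
    (List.range A.length).map fun u => (List.range A.length).map fun v => !ent A u v

/-- The colors that are missing from at least a quarter of the lists. -/
def rareColors (M : List (List Bool)) (verts cols : List ℕ) : List ℕ :=
  cols.filter fun i => decide (verts.length ≤ 4 * (verts.filter fun v => !ent M v i).length)

/-- The matching of the rare colors and the vertices of `U` with the vertices outside of `U`. -/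
def rareAuction (c : ℕ) (A M : List (List Bool)) (verts cols U : List ℕ) : List (ℕ × ℕ × ℕ) :=
  auction (joinMatrix c A M) (rareColors M verts cols ++ U.map fun u => c + u)
    (verts.filter fun v => !decide (v ∈ U))

/-- The vertices that are matched with vertices. -/
def pairedVertices (c : ℕ) (S : List (ℕ × ℕ × ℕ)) : List ℕ :=
  (S.filter fun e => decide (1 ≤ e.2.1) && decide (c ≤ e.2.2)).map fun e => e.1

/-- The set U ∪ Q ∪ Y, restricted from `verts` so that it is free of repetitions. -/
def decidingVertices (c : ℕ) (S : List (ℕ × ℕ × ℕ)) (verts U : List ℕ) : List ℕ :=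
  verts.filter fun v => decide (v ∈ U) || decide (v ∈ highObjects S) ||
    decide (v ∈ pairedVertices c S)

/-- The colors outside R ∩ Z: a rare color lies outside Z if and only if it owns an object below the
gap. -/
def budgetColors (M : List (List Bool)) (S : List (ℕ × ℕ × ℕ)) (verts cols : List ℕ) : List ℕ :=
  cols.filter fun i => !decide (i ∈ rareColors M verts cols) || isLowOwner S i

/-- The last part of the algorithm: the input is a matching of the rare colors. The output consists
of the set of all relevant colors, a set of vertices, a set of colors, and the budget. -/
def decideMatched (k c : ℕ) (M : List (List Bool)) (verts cols U : List ℕ)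
    (S : List (ℕ × ℕ × ℕ)) : List ℕ × List ℕ × List ℕ × ℕ :=
  bif decide (k ≤ (pairedVertices c S).length) then ([], [], [], 0) else
  bif decide ((budgetColors M S verts cols).length <
      verts.length - (decidingVertices c S verts U).length) then
    -- A negative budget means a no-instance, represented by one vertex, all of whose colors are
    -- charged, and budget zero.
    (cols, [verts.headD 0], cols, 0) else
  (cols, decidingVertices c S verts U, budgetColors M S verts cols,
    (budgetColors M S verts cols).length -
      (verts.length - (decidingVertices c S verts U).length))

/-- The part of the algorithm for fewer colors than vertices. -/
def decideReduced (k c : ℕ) (A M : List (List Bool)) (verts cols : List ℕ) :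
    List ℕ × List ℕ × List ℕ × ℕ :=
  -- A small instance is output whole; with no charged colors the budget is no restriction.
  bif decide (verts.length < 11 * k) then (cols, verts, [], 0) else
  bif decide (2 * k ≤ (greedyPairs A verts).length) then ([], [], [], 0) else
  decideMatched k c M verts cols (greedyPairs A verts)
    (rareAuction c A M verts cols (greedyPairs A verts))

/-- The vertices that remain after the reduction to fewer colors than vertices. -/
def reducedVertices (n : ℕ) (S : List (ℕ × ℕ × ℕ)) : List ℕ :=
  (List.range n).filter fun v => !isLowOwner S v

/-- The algorithm, on the parameter `k`, the number `c` of colors, the adjacency matrix `A`, and the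
incidence matrix `M` of vertices and colors. -/
def decideInstance (k c : ℕ) (A M : List (List Bool)) : List ℕ × List ℕ × List ℕ × ℕ :=
  (fun S : List (ℕ × ℕ × ℕ) =>
    bif (List.range A.length).all (fun v => isOwner S v) then ([], [], [], 0) else
    -- The parameter drops by the number of deleted vertices, so the list size is again the number
    -- of vertices minus the parameter.
    decideReduced (k - (A.length - (reducedVertices A.length S).length)) c A M
      (reducedVertices A.length S) (highObjects S))
  (auction M (List.range A.length) (List.range c))

/-! ### Running time of the algorithm -/

section PT

variable {X : Type} [Enc X]

@[fun_prop]
theorem PT.greedyPairs {A : X → List (List Bool)} {l : X → List ℕ} (hA : PT A) (hl : PT l) :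
    PT (fun x => greedyPairs (A x) (l x)) := by
  unfold _root_.greedyPairs
  obtain ⟨P, hP⟩ := hl.size_le
  refine foldl_of_add (f := fun x => greedyStep (A x)) (by unfold greedyStep; fun_prop)
    (by fun_prop) (by fun_prop) ⟨2 * P + 2, fun x U e he => ?_⟩
  obtain ⟨h1, h2⟩ := List.pair_mem_product.1 (show (e.1, e.2) ∈ l x ×ˢ l x from he)
  have h3 := (sz_le_of_mem h1).trans (hP x)
  have h4 := (sz_le_of_mem h2).trans (hP x)
  simp only [Polynomial.eval_add, Polynomial.eval_mul, Polynomial.eval_ofNat]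
  unfold greedyStep
  cases (!decide (e.1 = e.2) && !_root_.ent (A x) e.1 e.2 && !decide (e.1 ∈ U) &&
    !decide (e.2 ∈ U)) <;> simp only [cond_true, cond_false, sz_cons] <;> omega

@[fun_prop]
theorem PT.joinMatrix {c : X → ℕ} {A M : X → List (List Bool)} (hc : PT c) (hA : PT A)
    (hM : PT M) : PT (fun x => joinMatrix (c x) (A x) (M x)) := by
  unfold _root_.joinMatrix; fun_prop

@[fun_prop]
theorem PT.rareColors {M : X → List (List Bool)} {l m : X → List ℕ} (hM : PT M) (hl : PT l)
    (hm : PT m) : PT (fun x => rareColors (M x) (l x) (m x)) := by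
  unfold _root_.rareColors; fun_prop

@[fun_prop]
theorem PT.rareAuction {c : X → ℕ} {A M : X → List (List Bool)} {l m U : X → List ℕ} (hc : PT c)
    (hA : PT A) (hM : PT M) (hl : PT l) (hm : PT m) (hU : PT U) :
    PT (fun x => rareAuction (c x) (A x) (M x) (l x) (m x) (U x)) := by
  unfold _root_.rareAuction; fun_prop

@[fun_prop]
theorem PT.pairedVertices {c : X → ℕ} {S : X → List (ℕ × ℕ × ℕ)} (hc : PT c) (hS : PT S) :
    PT (fun x => pairedVertices (c x) (S x)) := by
  unfold _root_.pairedVertices; fun_prop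

@[fun_prop]
theorem PT.decidingVertices {c : X → ℕ} {S : X → List (ℕ × ℕ × ℕ)} {l U : X → List ℕ} (hc : PT c)
    (hS : PT S) (hl : PT l) (hU : PT U) :
    PT (fun x => decidingVertices (c x) (S x) (l x) (U x)) := by
  unfold _root_.decidingVertices; fun_prop

@[fun_prop]
theorem PT.budgetColors {M : X → List (List Bool)} {S : X → List (ℕ × ℕ × ℕ)} {l m : X → List ℕ}
    (hM : PT M) (hS : PT S) (hl : PT l) (hm : PT m) :
    PT (fun x => budgetColors (M x) (S x) (l x) (m x)) := by
  unfold _root_.budgetColors; fun_prop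

@[fun_prop]
theorem PT.decideMatched {k c : X → ℕ} {M : X → List (List Bool)} {l m U : X → List ℕ}
    {S : X → List (ℕ × ℕ × ℕ)} (hk : PT k) (hc : PT c) (hM : PT M) (hl : PT l) (hm : PT m)
    (hU : PT U) (hS : PT S) :
    PT (fun x => decideMatched (k x) (c x) (M x) (l x) (m x) (U x) (S x)) := by
  unfold _root_.decideMatched; fun_prop

@[fun_prop]
theorem PT.decideReduced {k c : X → ℕ} {A M : X → List (List Bool)} {l m : X → List ℕ}
    (hk : PT k) (hc : PT c) (hA : PT A) (hM : PT M) (hl : PT l) (hm : PT m) :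
    PT (fun x => decideReduced (k x) (c x) (A x) (M x) (l x) (m x)) := by
  unfold _root_.decideReduced; fun_prop

@[fun_prop]
theorem PT.reducedVertices {n : X → ℕ} {S : X → List (ℕ × ℕ × ℕ)} (hn : PT n) (hS : PT S) :
    PT (fun x => reducedVertices (n x) (S x)) := by
  unfold _root_.reducedVertices; fun_prop

@[fun_prop]
theorem PT.decideInstance {k c : X → ℕ} {A M : X → List (List Bool)} (hk : PT k) (hc : PT c)
    (hA : PT A) (hM : PT M) : PT (fun x => decideInstance (k x) (c x) (A x) (M x)) := by
  unfold _root_.decideInstance; fun_prop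

end PT

/-! ### Correctness of the algorithm -/

/-- `A` and `M` are the adjacency matrix of `G` and the incidence matrix of vertices and list
colors, for the vertices less than `n` and the colors less than `c`. -/
structure Represents (G : SimpleGraph ℕ) (L : ℕ → Finset ℕ) (n c : ℕ) (A M : List (List Bool)) :
    Prop where
  length_eq : A.length = n
  adj : ∀ u < n, ∀ v < n, ent A u v = true ↔ G.Adj u v
  mem : ∀ v < n, ∀ i < c, ent M v i = true ↔ i ∈ L v

/-- The output `out` decides whether `G` has a list coloring on `S` with colors of `T`, and has the
required sizes. -/
structure Decides (G : SimpleGraph ℕ) (L : ℕ → Finset ℕ) (S T : Finset ℕ) (k : ℕ)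
    (out : List ℕ × List ℕ × List ℕ × ℕ) : Prop where
  nodup_cols : out.1.Nodup
  nodup_verts : out.2.1.Nodup
  cols_subset : ∀ i ∈ out.1, i ∈ T
  verts_subset : ∀ v ∈ out.2.1, v ∈ S
  special_subset : ∀ i ∈ out.2.2.1, i ∈ out.1
  budget_le : out.2.2.2 ≤ out.2.1.length
  length_verts : out.2.1.length ≤ 11 * k
  length_verts_of_le : 11 * k ≤ S.card → out.2.1.length ≤ 7 * k
  card_sdiff : (out.1.toFinset \ out.2.2.1.toFinset).card ≤ 11 * k
  lists_subset : ∀ v ∈ out.2.1, L v ⊆ out.1.toFinset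
  card_missing : ∀ v ∈ out.2.1, (out.1.toFinset \ L v).card ≤ k
  iff : (∃ col, IsPartialListColoring G L S col) ↔
    ∃ col, IsPartialListColoring G L out.2.1.toFinset col ∧
      (out.2.1.toFinset.image col ∩ out.2.2.1.toFinset).card ≤ out.2.2.2

variable {G : SimpleGraph ℕ} {L : ℕ → Finset ℕ} {n c k : ℕ} {A M : List (List Bool)}

theorem decides_nil {S T : Finset ℕ} (h : ∃ col, IsPartialListColoring G L S col) :
    Decides G L S T k ([], [], [], 0) := by
  constructor
  case iff => exact iff_of_true h ⟨fun _ => 0, by simp [IsPartialListColoring], by simp⟩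
  all_goals simp

/-- The fold maintains disjoint nonadjacent pairs, described by `P` and `y`. Two distinct
nonadjacent vertices unused at the end were unused when their pair was inspected, since vertices are
never removed, and would have been added then. -/
theorem greedyPairs_spec (A : List (List Bool)) (verts : List ℕ) :
    (∃ (P : Finset ℕ) (y : ℕ → ℕ), P ⊆ verts.toFinset ∧ (∀ u ∈ P, y u ∈ verts.toFinset) ∧
      Set.InjOn y P ∧ (∀ u ∈ P, y u ∉ P) ∧ (∀ u ∈ P, ent A u (y u) = false) ∧
      (greedyPairs A verts).toFinset = P ∪ P.image y ∧
      (greedyPairs A verts).length = 2 * P.card) ∧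
    ∀ u ∈ verts, u ∉ greedyPairs A verts → ∀ v ∈ verts, v ∉ greedyPairs A verts → u ≠ v →
      ent A u v = true := by
  have hstep : ∀ (U : List ℕ) (e : ℕ × ℕ), U ⊆ greedyStep A U e := by
    intro U e v hv
    unfold greedyStep
    cases (!decide (e.1 = e.2) && !ent A e.1 e.2 && !decide (e.1 ∈ U) && !decide (e.2 ∈ U)) <;>
      simp [hv]
  have hsub : ∀ (l : List (ℕ × ℕ)) (U : List ℕ), U ⊆ l.foldl (greedyStep A) U := by
    intro l
    induction l with
    | nil => intro U v hv; exact hv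
    | cons e l ih => intro U v hv; exact ih _ (hstep U e hv)
  constructor
  · have key : ∀ (l : List (ℕ × ℕ)) (U : List ℕ), (∀ e ∈ l, e.1 ∈ verts ∧ e.2 ∈ verts) →
        (∃ (P : Finset ℕ) (y : ℕ → ℕ), P ⊆ verts.toFinset ∧ (∀ u ∈ P, y u ∈ verts.toFinset) ∧
          Set.InjOn y P ∧ (∀ u ∈ P, y u ∉ P) ∧ (∀ u ∈ P, ent A u (y u) = false) ∧
          U.toFinset = P ∪ P.image y ∧ U.length = 2 * P.card) →
        (∃ (P : Finset ℕ) (y : ℕ → ℕ), P ⊆ verts.toFinset ∧ (∀ u ∈ P, y u ∈ verts.toFinset) ∧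
          Set.InjOn y P ∧ (∀ u ∈ P, y u ∉ P) ∧ (∀ u ∈ P, ent A u (y u) = false) ∧
          (l.foldl (greedyStep A) U).toFinset = P ∪ P.image y ∧
          (l.foldl (greedyStep A) U).length = 2 * P.card) := by
      intro l
      induction l with
      | nil => intro U _ h; exact h
      | cons e l ih =>
        intro U hl h
        rw [List.foldl_cons]
        refine ih _ (fun e' he' => hl e' (by simp [he'])) ?_
        by_cases hc : (!decide (e.1 = e.2) && !ent A e.1 e.2 && !decide (e.1 ∈ U) &&
            !decide (e.2 ∈ U)) = true
        · obtain ⟨P, y, h1, h2, h3, h4, h5, h6, h7⟩ := h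
          obtain ⟨h8, h9⟩ := hl e (by simp)
          unfold greedyStep
          rw [hc, cond_true]
          simp only [Bool.and_eq_true, Bool.not_eq_true', decide_eq_false_iff_not] at hc
          obtain ⟨⟨⟨hne, hadj⟩, hU1⟩, hU2⟩ := hc
          rw [← List.mem_toFinset, h6, Finset.mem_union, Finset.mem_image] at hU1 hU2
          push Not at hU1 hU2
          have hupd : ∀ u ∈ P, Function.update y e.1 e.2 u = y u := fun u hu =>
            Function.update_of_ne (fun h' => hU1.1 (by rwa [← h'])) _ _
          refine ⟨insert e.1 P, Function.update y e.1 e.2, ?_, ?_, ?_, ?_, ?_, ?_, ?_⟩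
          · exact Finset.insert_subset (List.mem_toFinset.2 h8) h1
          · rw [Finset.forall_mem_insert]
            refine ⟨by simpa using h9, fun u hu => ?_⟩
            rw [hupd u hu]
            exact h2 u hu
          · rw [Finset.coe_insert, Set.injOn_insert (by simpa using hU1.1)]
            refine ⟨fun u hu v hv huv => ?_, ?_⟩
            · rw [hupd u hu, hupd v hv] at huv
              exact h3 hu hv huv
            · rintro ⟨u, hu, h⟩
              rw [hupd u hu, Function.update_self] at h
              exact hU2.2 u hu h
          · rw [Finset.forall_mem_insert]
            refine ⟨?_, fun u hu => ?_⟩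
            · rw [Function.update_self, Finset.mem_insert, not_or]
              exact ⟨Ne.symm hne, hU2.1⟩
            · rw [hupd u hu, Finset.mem_insert, not_or]
              exact ⟨hU1.2 u hu, h4 u hu⟩
          · rw [Finset.forall_mem_insert]
            refine ⟨by rwa [Function.update_self], fun u hu => ?_⟩
            rw [hupd u hu]
            exact h5 u hu
          · rw [List.toFinset_cons, List.toFinset_cons, h6, Finset.image_insert,
              Function.update_self, Finset.image_congr (g := y) (fun u hu => hupd u hu)]
            ext v
            simp only [Finset.mem_insert, Finset.mem_union]
            tauto
          · rw [List.length_cons, List.length_cons, Finset.card_insert_of_notMem hU1.1]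
            omega
        · unfold greedyStep
          rw [Bool.eq_false_of_not_eq_true hc, cond_false]
          exact h
    refine key _ _ (fun e he => List.pair_mem_product.1 (show (e.1, e.2) ∈ verts ×ˢ verts from he))
      ⟨∅, fun v => v, ?_⟩
    simp
  · intro u hu hu' v hv hv' huv
    have hmem : (u, v) ∈ verts ×ˢ verts := List.pair_mem_product.2 ⟨hu, hv⟩
    unfold greedyPairs at hu' hv'
    by_contra hadj
    have key : ∀ (l : List (ℕ × ℕ)) (U : List ℕ), (u, v) ∈ l → u ∉ l.foldl (greedyStep A) U →
        v ∉ l.foldl (greedyStep A) U → False := by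
      intro l
      induction l with
      | nil => simp
      | cons e l ih =>
        intro U hl h1 h2
        rcases List.mem_cons.1 hl with rfl | hl
        · have h3 : u ∉ U := fun h => h1 (hsub _ _ h)
          have h4 : v ∉ U := fun h => h2 (hsub _ _ h)
          refine h1 (hsub l (greedyStep A U (u, v)) ?_)
          unfold greedyStep
          simp [huv, Bool.eq_false_of_not_eq_true hadj, h3, h4]
        · exact ih _ hl h1 h2
    exact key _ _ hmem hu' hv'

theorem ent_append_left {E F : List (List Bool)} {i : ℕ} (h : i < E.length) (j : ℕ) :
    ent (E ++ F) i j = ent E i j := by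
  unfold ent
  rw [List.getD_append _ _ _ _ h]

theorem ent_append_right {E F : List (List Bool)} (i j : ℕ) :
    ent (E ++ F) (E.length + i) j = ent F i j := by
  unfold ent
  rw [List.getD_append_right _ _ _ _ (by omega), Nat.add_sub_cancel_left]

theorem ent_map_range {m n : ℕ} (f : ℕ → ℕ → Bool) {i j : ℕ} (hi : i < m) (hj : j < n) :
    ent ((List.range m).map fun i => (List.range n).map fun j => f i j) i j = f i j := by
  simp [ent, List.getD_eq_getElem?_getD, hi, hj]

theorem ent_joinMatrix_color (h : Represents G L n c A M) {i v : ℕ} (hi : i < c) (hv : v < n) :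
    ent (joinMatrix c A M) i v = true ↔ i ∈ L v := by
  unfold joinMatrix
  rw [ent_append_left (by simpa using hi), h.length_eq, ent_map_range _ hi hv, h.mem v hv i hi]

theorem ent_joinMatrix_vertex (h : Represents G L n c A M) {u v : ℕ} (hu : u < n) (hv : v < n) :
    ent (joinMatrix c A M) (c + u) v = true ↔ ¬G.Adj u v := by
  unfold joinMatrix
  have := ent_append_right (E := (List.range c).map fun i => (List.range A.length).map
    fun v => ent M v i) (F := (List.range A.length).map fun u => (List.range A.length).map
    fun v => !ent A u v) u v
  rw [List.length_map, List.length_range] at this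
  rw [this, h.length_eq, ent_map_range _ hu hv, Bool.not_eq_true', ← Bool.not_eq_true,
    h.adj u hu v hv]

/-- The computed lists form a `DenseInstance`; then each of the three outputs is justified by the
corresponding lemma there. -/
theorem decideMatched_spec (h : Represents G L n c A M) {verts cols U : List ℕ}
    (hverts : verts.Nodup) (hcols : cols.Nodup) (hn : ∀ v ∈ verts, v < n) (hc : ∀ i ∈ cols, i < c)
    (hL : ∀ v ∈ verts, L v ⊆ cols.toFinset) (hk : ∀ v ∈ verts, (L v).card + k = verts.length)
    (hlt : cols.length < verts.length) (hlarge : 11 * k ≤ verts.length)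
    (hU : ∀ u ∈ U, u ∈ verts) (hUcard : U.toFinset.card + 2 ≤ 2 * k)
    (hclique : ∀ u ∈ verts, u ∉ U → ∀ v ∈ verts, v ∉ U → u ≠ v → G.Adj u v) :
    Decides G L verts.toFinset cols.toFinset k
      (decideMatched k c M verts cols U (rareAuction c A M verts cols U)) := by
  have hrights : (verts.filter fun v => !decide (v ∈ U)).Nodup := hverts.filter _
  have hspec := auction_spec (joinMatrix c A M)
    (rareColors M verts cols ++ U.map fun u => c + u) hrights
  obtain ⟨inv, -⟩ := auction_inv (joinMatrix c A M)
    (rareColors M verts cols ++ U.map fun u => c + u) hrights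
  have hrare : ∀ i, i ∈ rareColors M verts cols ↔ i ∈ cols ∧ verts.length ≤
      4 * (verts.toFinset.filter fun v => i ∉ L v).card := by
    intro i
    unfold rareColors
    rw [List.mem_filter, decide_eq_true_eq]
    refine and_congr_right fun hi => ?_
    rw [← List.toFinset_card_of_nodup (hverts.filter _), List.toFinset_filter]
    have : (verts.toFinset.filter fun v => (!ent M v i) = true) =
        verts.toFinset.filter fun v => i ∉ L v := Finset.filter_congr fun v hv => by
      rw [Bool.not_eq_true', ← Bool.not_eq_true, h.mem v (hn v (List.mem_toFinset.1 hv)) i (hc i hi)]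
    rw [this]
  change HallDecomposition _ _ _ (Owns (rareAuction c A M verts cols U))
    (List.filter (fun z => !isLowOwner (rareAuction c A M verts cols U) z) _).toFinset
    (highObjects (rareAuction c A M verts cols U)).toFinset at hspec
  change AuctionInv _ _ _ _ (rareAuction c A M verts cols U) at inv
  generalize rareAuction c A M verts cols U = S at *
  have hYnodup : (pairedVertices c S).Nodup := by
    have : (pairedVertices c S).Sublist (S.map fun e => e.1) := List.filter_sublist.map _
    exact this.nodup (inv.keys ▸ hrights)
  have D : DenseInstance G L verts.toFinset cols.toFinset U.toFinset
      (rareColors M verts cols).toFinset k c (fun z v => ent (joinMatrix c A M) z v = true) (Owns S)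
      ((rareColors M verts cols ++ U.map fun u => c + u).filter
        fun z => !isLowOwner S z).toFinset
      (highObjects S).toFinset (pairedVertices c S).toFinset := by
    have hcard : verts.toFinset.card = verts.length := List.toFinset_card_of_nodup hverts
    refine ⟨?_, ?_, ?_, ?_, ?_, hUcard, ?_, ?_, ?_, ?_, ?_, ?_, ?_⟩
    · simpa using hL
    · simpa [hcard] using hk
    · rwa [hcard, List.toFinset_card_of_nodup hcols]
    · rwa [hcard]
    · intro u hu
      rw [List.mem_toFinset] at hu ⊢
      exact hU u hu
    · simpa using hclique
    · intro i
      rw [List.mem_toFinset, hrare, hcard, List.mem_toFinset]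
    · simpa using hc
    · intro i hi v hv
      rw [List.mem_toFinset] at hi hv
      exact ent_joinMatrix_color h (hc i hi) (hn v hv)
    · intro u hu v hv
      rw [List.mem_toFinset] at hu hv
      exact ent_joinMatrix_vertex h (hn u (hU u hu)) (hn v hv)
    · convert hspec using 1
      · ext z; simp
      · ext z; simp
    · intro v
      rw [List.mem_toFinset]
      simp only [pairedVertices, List.mem_map, List.mem_filter, Bool.and_eq_true,
        decide_eq_true_eq]
      constructor
      · rintro ⟨⟨v, p, z⟩, ⟨he, h1, h2⟩, rfl⟩
        have h3 := (inv.mem _ he h1).1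
        simp only [List.mem_append, List.mem_map] at h3 h2
        -- Owners that are colors are less than `c`, so an owner at least `c` stands for a vertex of
        -- `U`.
        rcases h3 with h3 | ⟨u, hu, rfl⟩
        · have := hc z ((hrare z).1 h3).1
          omega
        · exact ⟨u, List.mem_toFinset.2 hu, p, h1, he⟩
      · rintro ⟨u, hu, p, h1, he⟩
        exact ⟨_, ⟨he, h1, by simp⟩, rfl⟩
  have hYcard : (pairedVertices c S).toFinset.card = (pairedVertices c S).length :=
    List.toFinset_card_of_nodup hYnodup
  unfold decideMatched
  by_cases h1 : k ≤ (pairedVertices c S).length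
  · simp only [h1, decide_true, cond_true]
    exact decides_nil (D.colorable_of_card_paired (by rwa [hYcard]))
  have hY : (pairedVertices c S).toFinset.card < k := by omega
  have hdec : (decidingVertices c S verts U).toFinset = U.toFinset ∪
      ((highObjects S).toFinset ∪ (pairedVertices c S).toFinset) := by
    have := D.deciding_subset
    ext v
    simp only [decidingVertices, List.mem_toFinset, List.mem_filter, Bool.or_eq_true,
      decide_eq_true_eq, Finset.mem_union]
    constructor
    · tauto
    · intro h2
      exact ⟨List.mem_toFinset.1 (this (by simpa using h2)), by tauto⟩
  have hnd : (decidingVertices c S verts U).Nodup := hverts.filter _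
  have hbud : ∀ i, i ∈ (budgetColors M S verts cols).toFinset ↔ i ∈ cols.toFinset ∧
      (i ∈ (rareColors M verts cols).toFinset → i ∉ ((rareColors M verts cols ++
        U.map fun u => c + u).filter fun z => !isLowOwner S z).toFinset) := by
    intro i
    simp only [budgetColors, List.mem_toFinset, List.mem_filter, Bool.or_eq_true,
      Bool.not_eq_true', decide_eq_false_iff_not, List.mem_append]
    cases isLowOwner S i <;> simp <;> tauto
  have hbnd : (budgetColors M S verts cols).Nodup := hcols.filter _
  have hfwd := fun lam hlam => D.exists_deciding_of_colorable hY hbud (lam := lam) hlam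
  have hbwd := fun mu hmu => D.colorable_of_deciding hY hbud (mu := mu) hmu
  have hcard := D.card_deciding hY
  rw [← hdec] at hfwd hbwd hcard
  rw [List.toFinset_card_of_nodup hverts, List.toFinset_card_of_nodup hnd,
    List.toFinset_card_of_nodup hbnd] at hfwd hbwd
  rw [List.toFinset_card_of_nodup hnd] at hcard
  have hmiss : ∀ v ∈ verts, (cols.toFinset \ L v).card ≤ k := fun v hv =>
    (D.card_missing_lt (List.mem_toFinset.2 hv)).le
  have hkpos := D.k_pos
  simp only [h1, decide_false, cond_false]
  by_cases h2 : (budgetColors M S verts cols).length <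
      verts.length - (decidingVertices c S verts U).length
  · simp only [h2, decide_true, cond_true]
    obtain ⟨v, l, rfl⟩ : ∃ v l, verts = v :: l := by
      cases verts with
      | nil => simp at hlt
      | cons v l => exact ⟨v, l, rfl⟩
    simp only [List.headD_cons]
    constructor
    · exact hcols
    · simp
    · simp
    · simp
    · simp
    · simp
    · simp only [List.length_singleton]; omega
    · simp only [List.length_singleton]; omega
    · simp
    · simpa using hL v (by simp)
    · simpa using hmiss v (by simp)
    · constructor
      · rintro ⟨lam, hlam⟩
        obtain ⟨col, -, h3⟩ := hfwd lam hlam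
        omega
      · rintro ⟨col, h3, h4⟩
        have h5 := hL v (by simp) (h3.1 v (by simp))
        simp only [List.toFinset_cons, List.toFinset_nil, Finset.image_insert,
          Finset.image_empty, nonpos_iff_eq_zero, Finset.card_eq_zero] at h4
        have : col v ∈ (∅ : Finset ℕ) := h4 ▸ Finset.mem_inter.2 ⟨by simp, h5⟩
        simp at this
  · simp only [h2, decide_false, cond_false]
    have hsub : ∀ v ∈ decidingVertices c S verts U, v ∈ verts := fun v hv =>
      (List.mem_filter.1 hv).1
    constructor
    · exact hcols
    · exact hnd
    · simp
    · simpa using hsub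
    · intro i hi
      exact (List.mem_filter.1 hi).1
    · have : (budgetColors M S verts cols).length ≤ cols.length := List.length_filter_le _ _
      simp only
      omega
    · simp only; omega
    · intro _; simp only; omega
    · have h3 : cols.toFinset \ (budgetColors M S verts cols).toFinset ⊆
          (rareColors M verts cols).toFinset := by
        intro i hi
        rw [Finset.mem_sdiff, hbud] at hi
        tauto
      have h4 := Finset.card_le_card h3
      have h5 := D.card_rare
      simp only
      omega
    · intro v hv
      exact hL v (hsub v hv)
    · intro v hv
      exact hmiss v (hsub v hv)
    · constructor
      · rintro ⟨lam, hlam⟩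
        obtain ⟨col, h3, h4⟩ := hfwd lam hlam
        exact ⟨col, h3, by simp only; omega⟩
      · rintro ⟨col, h3, h4⟩
        exact hbwd col h3 (by simp only at h4; omega)

theorem decideReduced_spec (h : Represents G L n c A M) {verts cols : List ℕ}
    (hverts : verts.Nodup) (hcols : cols.Nodup) (hn : ∀ v ∈ verts, v < n) (hc : ∀ i ∈ cols, i < c)
    (hL : ∀ v ∈ verts, L v ⊆ cols.toFinset) (hk : ∀ v ∈ verts, (L v).card + k = verts.length)
    (hlt : cols.length < verts.length) :
    Decides G L verts.toFinset cols.toFinset k (decideReduced k c A M verts cols) := by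
  have hvcard : verts.toFinset.card = verts.length := List.toFinset_card_of_nodup hverts
  have hccard : cols.toFinset.card = cols.length := List.toFinset_card_of_nodup hcols
  unfold decideReduced
  by_cases h1 : verts.length < 11 * k
  · simp only [h1, decide_true, cond_true]
    constructor
    · exact hcols
    · exact hverts
    · simp
    · simp
    · simp
    · simp
    · exact h1.le
    · intro h2; rw [hvcard] at h2; omega
    · simp only [List.toFinset_nil, Finset.sdiff_empty]; omega
    · exact hL
    · intro v hv
      have h2 := Finset.card_sdiff_add_card_eq_card (hL v hv)
      have h3 := hk v hv
      simp only
      omega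
    · simp
  simp only [h1, decide_false, cond_false]
  obtain ⟨⟨P, y, hP, hyv, hyinj, hyP, hadj, hU, hUlen⟩, hmax⟩ := greedyPairs_spec A verts
  have hadj' : ∀ u ∈ P, ¬G.Adj u (y u) := fun u hu h2 => by
    rw [← h.adj u (hn u (List.mem_toFinset.1 (hP hu))) _
      (hn _ (List.mem_toFinset.1 (hyv u hu))), hadj u hu] at h2
    simp at h2
  by_cases h2 : 2 * k ≤ (greedyPairs A verts).length
  · simp only [h2, decide_true, cond_true]
    exact decides_nil (colorable_of_pairs (by simpa using hL) (by simpa [hvcard] using hk)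
      (by rwa [hccard, hvcard]) (by omega) hP hyv hyinj hyP hadj' (by omega))
  · simp only [h2, decide_false, cond_false]
    refine decideMatched_spec h hverts hcols hn hc hL hk hlt (by omega) (fun u hu => ?_) ?_
      (fun u hu hu' v hv hv' huv => ?_)
    · rw [← List.mem_toFinset, hU, Finset.mem_union, Finset.mem_image] at hu
      rcases hu with hu | ⟨w, hw, rfl⟩
      · exact List.mem_toFinset.1 (hP hu)
      · exact List.mem_toFinset.1 (hyv w hw)
    · have := List.toFinset_card_le (greedyPairs A verts)
      omega
    · exact (h.adj u (hn u hu) v (hn v hv)).1 (hmax u hu hu' v hv hv' huv)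

theorem decideInstance_spec (h : Represents G L n c A M) (hL : ∀ v < n, L v ⊆ Finset.range c)
    (hk : ∀ v < n, (L v).card + k = n) :
    Decides G L (Finset.range n) (Finset.range c) k (decideInstance k c A M) := by
  have hspec := auction_spec M (List.range n) (List.nodup_range (n := c))
  have hsub := highObjects_sublist M (List.range n) (List.nodup_range (n := c))
  unfold decideInstance
  rw [h.length_eq]
  generalize auction M (List.range n) (List.range c) = S at *
  rw [List.toFinset_range, List.toFinset_range] at hspec
  have hspec' : HallDecomposition (fun v i => i ∈ L v) (Finset.range n) (Finset.range c) (Owns S)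
      (reducedVertices n S).toFinset (highObjects S).toFinset := by
    have hadj : ∀ {v i}, v ∈ Finset.range n → i ∈ Finset.range c →
        (ent M v i = true ↔ i ∈ L v) := fun hv hi =>
      h.mem _ (Finset.mem_range.1 hv) _ (Finset.mem_range.1 hi)
    exact { hspec with
      adj := fun h1 => (hadj (hspec.left h1) (hspec.right h1)).1 (hspec.adj h1)
      nbr := fun h1 h2 h3 => hspec.nbr h1 h2 ((hadj (hspec.left_subset h1) h2).2 h3) }
  have hLT : ∀ v ∈ Finset.range n, L v ⊆ Finset.range c := fun v hv =>
    hL v (Finset.mem_range.1 hv)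
  by_cases h1 : (List.range n).all (fun v => isOwner S v) = true
  · simp only [h1, cond_true]
    refine decides_nil (hspec'.colorable_of_forall fun v hv => ?_)
    rw [List.all_eq_true] at h1
    exact isOwner_iff.1 (h1 v (by simpa using hv))
  simp only [Bool.eq_false_of_not_eq_true h1, cond_false]
  obtain ⟨v, hv, hown⟩ : ∃ v < n, ¬∃ i, Owns S i v := by
    simpa [isOwner_iff] using h1
  have hvnd : (reducedVertices n S).Nodup := List.nodup_range.filter _
  have hcnd : (highObjects S).Nodup := hsub.nodup List.nodup_range
  have hvcard : (reducedVertices n S).toFinset.card = (reducedVertices n S).length :=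
    List.toFinset_card_of_nodup hvnd
  have hlt : (highObjects S).length < (reducedVertices n S).length := by
    rw [← hvcard, ← List.toFinset_card_of_nodup hcnd]
    exact hspec'.card_lt (Finset.mem_range.2 hv) (not_exists.1 hown)
  have hvn : ∀ v ∈ reducedVertices n S, v < n := fun v hv =>
    List.mem_range.1 (List.mem_filter.1 hv).1
  have hlists := hspec'.lists_subset hLT
  have hlen : (reducedVertices n S).length ≤ n := by
    simpa [reducedVertices] using
      List.length_filter_le (fun v => !isLowOwner S v) (List.range n)
  obtain ⟨w, hw⟩ : ∃ w, w ∈ reducedVertices n S :=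
    List.exists_mem_of_length_pos (by omega)
  -- A remaining list has n - k colors, all in `highObjects S`, which is smaller than the set of
  -- remaining vertices. So fewer than k vertices were deleted, and the subtraction in the new
  -- parameter is not truncated.
  have h2 := hk w (hvn w hw)
  have h3 := (Finset.card_le_card (hlists w (List.mem_toFinset.2 hw))).trans
    (List.toFinset_card_le _)
  have D := decideReduced_spec (k := k - (n - (reducedVertices n S).length)) h hvnd hcnd hvn
    (fun i hi => List.mem_range.1 (hsub.subset hi)) (fun v hv => hlists v (List.mem_toFinset.2 hv))
    (fun v hv => by have := hk v (hvn v hv); omega) hlt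
  constructor
  · exact D.nodup_cols
  · exact D.nodup_verts
  · exact fun i hi => hspec'.right_subset (D.cols_subset i hi)
  · exact fun v hv => hspec'.left_subset (D.verts_subset v hv)
  · exact D.special_subset
  · exact D.budget_le
  · have := D.length_verts
    omega
  · intro h4
    rw [Finset.card_range] at h4
    have := D.length_verts_of_le (by rw [hvcard]; omega)
    omega
  · have := D.card_sdiff
    omega
  · exact D.lists_subset
  · intro v hv
    have := D.card_missing v hv
    omega
  · exact (hspec'.colorable_iff hLT).trans D.iff

/-! ### Instances of Regular List Coloring as input -/

theorem ltBits_bits (a b : ℕ) : ltBits false (Nat.bits a) (Nat.bits b) = decide (a < b) := by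
  rw [Bool.eq_iff_iff, ltBits_iff, bitsVal_bits, bitsVal_bits]
  simp

theorem foldl_insertLt_bits (l acc : List ℕ) :
    (l.map Nat.bits).foldl (insertLt (ltBits false)) (acc.map Nat.bits) =
      (l.foldl (insertLt fun a b => decide (a < b)) acc).map Nat.bits := by
  induction l generalizing acc with
  | nil => rfl
  | cons a l ih =>
    rw [List.map_cons, List.foldl_cons, List.foldl_cons, ← ih]
    congr 1
    simp [insertLt, List.filter_map, Function.comp_def, ltBits_bits]

/-- Both filters of `insertLt` are strict, so an element equal to the new one is dropped: the fold
sorts and removes duplicates at once. -/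
theorem foldl_insertLt_spec (l acc : List ℕ) (h : acc.Pairwise (· < ·)) :
    (l.foldl (insertLt fun a b => decide (a < b)) acc).Pairwise (· < ·) ∧
      ∀ a, a ∈ l.foldl (insertLt fun a b => decide (a < b)) acc ↔ a ∈ acc ∨ a ∈ l := by
  induction l generalizing acc with
  | nil => simpa using h
  | cons b l ih =>
    obtain ⟨h1, h2⟩ := ih (insertLt (fun a b => decide (a < b)) acc b) (by
      unfold insertLt
      rw [List.pairwise_append, List.pairwise_cons]
      refine ⟨h.filter _, ⟨by simp, h.filter _⟩, ?_⟩
      intro x hx y hy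
      simp only [List.mem_filter, decide_eq_true_eq, List.mem_cons] at hx hy
      omega)
    rw [List.foldl_cons]
    refine ⟨h1, fun a => ?_⟩
    rw [h2]
    simp only [insertLt, List.mem_append, List.mem_filter, decide_eq_true_eq, List.mem_cons]
    rcases lt_trichotomy a b with h3 | h3 | h3
    · simp [h3, h3.ne, h3.not_gt]
    · simp [h3]
    · simp [h3, h3.ne', h3.not_gt]

theorem sort_eq_of_pairwise {A : Finset ℕ} {l : List ℕ} (h : l.Pairwise (· < ·))
    (hA : ∀ a, a ∈ l ↔ a ∈ A) : A.sort (· ≤ ·) = l := by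
  have : l.toFinset = A := by ext a; simp [hA]
  rw [← this]
  exact (List.toFinset_sort (· ≤ ·) (h.imp fun h => h.ne)).2 (h.imp fun h => h.le)

/-- The form in which programs get an instance: the parameter, the adjacency matrix, and the lists
of colors in binary. -/
abbrev RawInput := ℕ × List (List Bool) × List (List (List Bool))

/-- All colors of the lists, in increasing order. -/
def RawInput.palette (r : RawInput) : List (List Bool) :=
  r.2.2.flatten.foldl (insertLt (ltBits false)) []

/-- The incidence matrix of vertices and colors. -/
def RawInput.incidence (r : RawInput) : List (List Bool) :=
  r.2.2.map fun l => r.palette.map fun t => l.any fun s => !ltBits false s t && !ltBits false t s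

/-- Colors are replaced by their positions in the palette. The given colors are binary and may be
huge, whereas positions can be handled in unary. -/
def RawInput.decide (r : RawInput) : List ℕ × List ℕ × List ℕ × ℕ :=
  decideInstance r.1 r.palette.length r.2.1 r.incidence

section PT

@[fun_prop]
theorem PT.palette {X : Type} [Enc X] {r : X → RawInput} (hr : PT r) :
    PT (fun x => (r x).palette) := by
  unfold RawInput.palette; fun_prop

@[fun_prop]
theorem PT.incidence {X : Type} [Enc X] {r : X → RawInput} (hr : PT r) :
    PT (fun x => (r x).incidence) := by
  unfold RawInput.incidence; fun_prop

@[fun_prop]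
theorem PT.decide {X : Type} [Enc X] {r : X → RawInput} (hr : PT r) :
    PT (fun x => (r x).decide) := by
  unfold RawInput.decide; fun_prop

end PT

/-! ### Instances and their indexed form -/

namespace RegularInstance

variable (I : RegularInstance)

noncomputable def raw : RawInput :=
  (I.k, adjRows I.graph, List.ofFn fun v => ((I.lists v).sort (· ≤ ·)).map Nat.bits)

theorem _root_.enc_map_bits (l : List ℕ) :
    enc (l.map Nat.bits) = Data.ofList (l.map Data.ofNat) := by
  rw [enc_list, List.map_map]
  rfl

theorem enc_raw : enc I.raw = I.toData := by
  unfold raw toData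
  rw [enc_prod, enc_prod, enc_list (List.ofFn _), List.map_ofFn]
  simp only [Function.comp_def, enc_map_bits]
  rfl

/-- `raw` has the same tree as the instance, so a function on raw inputs is enough. Its time bound
holds for all raw inputs, including those that come from no instance. -/
theorem polyTimeComputable_of_pt {Y : Type} [Enc Y] {f : RawInput → Y} (hf : PT f)
    {out : RegularInstance → Data} (h : ∀ I, enc (f I.raw) = out I) :
    PolyTimeComputable RegularInstance.toData out := by
  obtain ⟨p, P, hp⟩ := hf
  refine ⟨p, P, fun I => ?_⟩
  rw [← enc_raw, ← h]
  exact (hp I.raw).1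

/-- The colors of all lists in increasing order. -/
noncomputable def palette : List ℕ := I.colors.sort (· ≤ ·)

theorem raw_palette : I.raw.palette = I.palette.map Nat.bits := by
  have h1 : I.raw.2.2.flatten =
      ((List.ofFn fun v => (I.lists v).sort (· ≤ ·)).flatten).map Nat.bits := by
    simp [raw, List.map_flatten, List.map_ofFn, Function.comp_def]
  unfold RawInput.palette palette
  obtain ⟨h2, h3⟩ := foldl_insertLt_spec (List.ofFn fun v => (I.lists v).sort (· ≤ ·)).flatten []
    List.Pairwise.nil
  rw [h1, sort_eq_of_pairwise h2 (fun a => ?_)]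
  · exact foldl_insertLt_bits _ []
  · rw [h3]
    simp [colors, List.mem_ofFn]

/-- The color with index `i`. -/
noncomputable def color (i : ℕ) : ℕ := I.palette.getD i 0

/-- The index of a color. -/
noncomputable def index (a : ℕ) : ℕ := I.palette.idxOf a

theorem mem_palette {a : ℕ} : a ∈ I.palette ↔ a ∈ I.colors := by simp [palette]

theorem palette_pairwise : I.palette.Pairwise (· < ·) := I.colors.sortedLT_sort.pairwise

theorem color_mem {i : ℕ} (hi : i < I.palette.length) : I.color i ∈ I.colors := by
  rw [← mem_palette, color, List.getD_eq_getElem _ _ hi]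
  exact List.getElem_mem hi

theorem color_lt_color {i j : ℕ} (hj : j < I.palette.length) (hij : i < j) :
    I.color i < I.color j := by
  rw [color, color, List.getD_eq_getElem _ _ hj, List.getD_eq_getElem _ _ (hij.trans hj)]
  exact List.pairwise_iff_getElem.1 I.palette_pairwise i j _ _ hij

theorem color_injOn : Set.InjOn I.color (Finset.range I.palette.length) := by
  intro i hi j hj hij
  simp only [Finset.coe_range, Set.mem_Iio] at hi hj
  rcases lt_trichotomy i j with h | h | h
  · exact absurd hij (I.color_lt_color hj h).ne
  · exact h
  · exact absurd hij (I.color_lt_color hi h).ne'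

theorem index_lt {a : ℕ} (ha : a ∈ I.colors) : I.index a < I.palette.length :=
  List.idxOf_lt_length_iff.2 (I.mem_palette.2 ha)

theorem color_index {a : ℕ} (ha : a ∈ I.colors) : I.color (I.index a) = a := by
  rw [color, List.getD_eq_getElem _ _ (I.index_lt ha)]
  exact List.getElem_idxOf (I.index_lt ha)

theorem lists_subset_colors (v : Fin I.n) : I.lists v ⊆ I.colors :=
  Finset.subset_biUnion_of_mem I.lists (Finset.mem_univ v)

/-- The graph, with vertices as natural numbers. -/
def natGraph : SimpleGraph ℕ := I.graph.map Fin.valEmbedding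

/-- The lists, with vertices as natural numbers and colors replaced by their indices. -/
noncomputable def natLists (v : ℕ) : Finset ℕ :=
  if h : v < I.n then (I.lists ⟨v, h⟩).image I.index else ∅

theorem natGraph_adj (u v : Fin I.n) : I.natGraph.Adj u v ↔ I.graph.Adj u v := by
  exact SimpleGraph.map_adj_apply (f := Fin.valEmbedding)

theorem natLists_val (v : Fin I.n) : I.natLists v = (I.lists v).image I.index := by
  simp [natLists]

theorem natLists_subset {v : ℕ} (hv : v < I.n) :
    I.natLists v ⊆ Finset.range I.palette.length := by
  intro i hi
  rw [I.natLists_val ⟨v, hv⟩, Finset.mem_image] at hi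
  obtain ⟨a, ha, rfl⟩ := hi
  exact Finset.mem_range.2 (I.index_lt (I.lists_subset_colors _ ha))

theorem index_injOn : Set.InjOn I.index I.colors := fun a ha b hb hab => by
  rw [← I.color_index ha, hab, I.color_index hb]

theorem index_color {i : ℕ} (hi : i < I.palette.length) : I.index (I.color i) = i := by
  have h1 := I.color_mem hi
  exact I.color_injOn (Finset.mem_coe.2 (Finset.mem_range.2 (I.index_lt h1)))
    (Finset.mem_coe.2 (Finset.mem_range.2 hi)) (I.color_index h1)

theorem mem_natLists (v : Fin I.n) {i : ℕ} (hi : i < I.palette.length) :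
    i ∈ I.natLists v ↔ I.color i ∈ I.lists v := by
  rw [natLists_val, Finset.mem_image]
  constructor
  · rintro ⟨a, ha, rfl⟩
    rwa [I.color_index (I.lists_subset_colors _ ha)]
  · exact fun h => ⟨_, h, I.index_color hi⟩

theorem card_natLists {v : ℕ} (hv : v < I.n) : (I.natLists v).card + I.k = I.n := by
  rw [I.natLists_val ⟨v, hv⟩, Finset.card_image_of_injOn
    (I.index_injOn.mono (I.lists_subset_colors _)), I.regular]

theorem represents : Represents I.natGraph I.natLists I.n I.palette.length I.raw.2.1
    I.raw.incidence := by
  refine ⟨by simp [raw, adjRows], fun u hu v hv => ?_, fun v hv i hi => ?_⟩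
  · rw [I.natGraph_adj ⟨u, hu⟩ ⟨v, hv⟩]
    simp [raw, adjRows, ent, List.getD_eq_getElem?_getD, hu, hv]
  · rw [I.mem_natLists ⟨v, hv⟩ hi]
    have h1 : I.color i = I.palette[i] := List.getD_eq_getElem _ _ hi
    unfold RawInput.incidence
    rw [raw_palette, h1]
    simp only [raw, ent, List.map_ofFn, List.getD_eq_getElem?_getD, List.getElem?_ofFn, hv,
      dif_pos, Function.comp_apply, Option.getD_some, List.getElem?_map,
      List.getElem?_eq_getElem hi, Option.map_some, List.any_map, List.any_eq_true,
      Finset.mem_sort, Bool.and_eq_true, Bool.not_eq_true', ltBits_bits, decide_eq_false_iff_not]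
    constructor
    · rintro ⟨a, ha, h2⟩
      have : a = I.palette[i] := by omega
      rwa [← this]
    · exact fun h => ⟨_, h, by omega⟩

/-- The sets and the budget that the algorithm computes, with indices for the colors. -/
noncomputable def decision : List ℕ × List ℕ × List ℕ × ℕ := I.raw.decide

theorem decision_spec : Decides I.natGraph I.natLists (Finset.range I.n)
    (Finset.range I.palette.length) I.k I.decision := by
  unfold decision RawInput.decide
  have h := I.represents
  have : I.raw.palette.length = I.palette.length := by rw [raw_palette, List.length_map]
  rw [this]
  exact decideInstance_spec h (fun v hv => I.natLists_subset hv) (fun v hv => I.card_natLists hv)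

theorem partialListColoring_color {S : Finset (Fin I.n)} {col : ℕ → ℕ}
    (h : IsPartialListColoring I.natGraph I.natLists (S.map Fin.valEmbedding) col) :
    IsPartialListColoring I.graph I.lists S (fun v => I.color (col v)) ∧
      ∀ v ∈ S, col v < I.palette.length := by
  have hS : ∀ v ∈ S, (v : ℕ) ∈ S.map Fin.valEmbedding := fun v hv =>
    Finset.mem_map_of_mem Fin.valEmbedding hv
  have hlt : ∀ v ∈ S, col v < I.palette.length := fun v hv =>
    Finset.mem_range.1 (I.natLists_subset v.2 (h.1 v (hS v hv)))
  refine ⟨⟨fun v hv => ?_, fun u hu v hv huv huv' => ?_⟩, hlt⟩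
  · exact (I.mem_natLists v (hlt v hv)).1 (h.1 v (hS v hv))
  · exact h.2 u (hS u hu) v (hS v hv) ((I.natGraph_adj u v).2 huv)
      (I.color_injOn (by simpa using hlt u hu) (by simpa using hlt v hv) huv')

theorem partialListColoring_index {S : Finset (Fin I.n)} {col : Fin I.n → ℕ}
    (h : IsPartialListColoring I.graph I.lists S col) :
    ∃ col' : ℕ → ℕ, IsPartialListColoring I.natGraph I.natLists (S.map Fin.valEmbedding) col' ∧
      ∀ v ∈ S, I.color (col' v) = col v := by
  have hmem : ∀ v ∈ S, col v ∈ I.colors := fun v hv => I.lists_subset_colors v (h.1 v hv)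
  refine ⟨fun v => if hv : v < I.n then I.index (col ⟨v, hv⟩) else 0, ⟨?_, ?_⟩, fun v hv => ?_⟩
  · simp only [Finset.mem_map, forall_exists_index, and_imp]
    rintro _ v hv rfl
    rw [Fin.valEmbedding_apply, natLists_val]
    simpa using ⟨_, h.1 v hv, rfl⟩
  · simp only [Finset.mem_map, forall_exists_index, and_imp]
    rintro _ u hu rfl _ v hv rfl huv huv'
    simp only [Fin.valEmbedding_apply, Fin.is_lt, dif_pos, Fin.eta] at huv'
    exact h.2 u hu v hv ((I.natGraph_adj u v).1 huv) (I.index_injOn (hmem u hu) (hmem v hv) huv')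
  · simp [I.color_index (hmem v hv)]

theorem isYes_iff : I.IsYes ↔
    ∃ col, IsPartialListColoring I.natGraph I.natLists (Finset.range I.n) col := by
  have hS : (Finset.univ : Finset (Fin I.n)).map Fin.valEmbedding = Finset.range I.n := by
    ext v
    simp only [Finset.mem_map, Finset.mem_univ, true_and, Fin.valEmbedding_apply,
      Finset.mem_range]
    exact ⟨fun ⟨u, hu⟩ => hu ▸ u.2, fun hv => ⟨⟨v, hv⟩, rfl⟩⟩
  rw [← hS]
  constructor
  · rintro ⟨col, h⟩
    obtain ⟨col', h', -⟩ := I.partialListColoring_index (S := Finset.univ) (col := col)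
      ⟨fun v _ => h.1 v, fun u _ v _ => h.2 u v⟩
    exact ⟨col', h'⟩
  · rintro ⟨col, h⟩
    obtain ⟨h', -⟩ := I.partialListColoring_color h
    exact ⟨_, fun v => h'.1 v (Finset.mem_univ v),
      fun u v => h'.2 u (Finset.mem_univ u) v (Finset.mem_univ v)⟩

/-! ### The small set of vertices that decides the instance -/

noncomputable def decidingSet : Finset (Fin I.n) := Finset.univ.filter fun v => (v : ℕ) ∈ I.decision.2.1

noncomputable def budgetSet : Finset ℕ := I.decision.2.2.1.toFinset.image I.color

noncomputable def budget : ℕ := I.decision.2.2.2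

theorem mem_decidingSet (v : Fin I.n) : v ∈ I.decidingSet ↔ (v : ℕ) ∈ I.decision.2.1 := by
  simp [decidingSet]

theorem decidingSet_map : I.decidingSet.map Fin.valEmbedding = I.decision.2.1.toFinset := by
  ext v
  simp only [decidingSet, Finset.mem_map, Finset.mem_filter, Finset.mem_univ, true_and,
    Fin.valEmbedding_apply, List.mem_toFinset]
  exact ⟨fun ⟨u, hu, h⟩ => h ▸ hu, fun hv =>
    ⟨⟨v, Finset.mem_range.1 (I.decision_spec.verts_subset v hv)⟩, hv, rfl⟩⟩

theorem special_lt {i : ℕ} (hi : i ∈ I.decision.2.2.1) : i < I.palette.length :=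
  Finset.mem_range.1 (I.decision_spec.cols_subset i (I.decision_spec.special_subset i hi))

theorem card_decidingSet : I.decidingSet.card = I.decision.2.1.length := by
  rw [← Finset.card_map Fin.valEmbedding, decidingSet_map,
    List.toFinset_card_of_nodup I.decision_spec.nodup_verts]

/-- Passing from indices to colors is injective on the palette, so the number of charged colors is
unchanged. -/
theorem card_image_inter {S : Finset (Fin I.n)} {col : ℕ → ℕ}
    (h : ∀ v ∈ S, col v < I.palette.length) :
    (S.image (fun v : Fin I.n => I.color (col v)) ∩ I.budgetSet).card =
      ((S.map Fin.valEmbedding).image col ∩ I.decision.2.2.1.toFinset).card := by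
  rw [← Finset.card_image_of_injOn (f := I.color)
    (s := (S.map Fin.valEmbedding).image col ∩ I.decision.2.2.1.toFinset)]
  · congr 1
    ext a
    simp only [budgetSet, Finset.mem_inter, Finset.mem_image, Finset.mem_map, List.mem_toFinset]
    constructor
    · rintro ⟨⟨v, hv, rfl⟩, i, hi, h1⟩
      have h2 := I.color_injOn (by simpa using I.special_lt hi) (by simpa using h v hv) h1
      exact ⟨col v, ⟨⟨v, ⟨v, hv, rfl⟩, rfl⟩, h2 ▸ hi⟩, rfl⟩
    · rintro ⟨i, ⟨⟨_, ⟨v, hv, rfl⟩, rfl⟩, hi⟩, rfl⟩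
      exact ⟨⟨v, hv, rfl⟩, _, hi, rfl⟩
  · refine I.color_injOn.mono fun i hi => ?_
    have := I.special_lt (List.mem_toFinset.1 (Finset.mem_inter.1 (Finset.mem_coe.1 hi)).2)
    simpa using this

theorem isYes_iff_decidingSet : I.IsYes ↔ ∃ col : Fin I.n → ℕ,
    IsPartialListColoring I.graph I.lists I.decidingSet col ∧
      (I.decidingSet.image col ∩ I.budgetSet).card ≤ I.budget := by
  rw [isYes_iff, I.decision_spec.iff, ← decidingSet_map]
  constructor
  · rintro ⟨col, h1, h2⟩
    obtain ⟨h3, h4⟩ := I.partialListColoring_color h1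
    exact ⟨_, h3, by rwa [I.card_image_inter h4]⟩
  · rintro ⟨col, h1, h2⟩
    obtain ⟨col', h3, h4⟩ := I.partialListColoring_index h1
    refine ⟨col', h3, ?_⟩
    rw [← I.card_image_inter (I.partialListColoring_color h3).2, Finset.image_congr
      (g := col) (fun v hv => h4 v hv)]
    exact h2

theorem polyTimeComputable_triple : PolyTimeComputable RegularInstance.toData
    (fun I => tripleData I.decidingSet I.budgetSet I.budget) := by
  refine polyTimeComputable_of_pt (f := fun r : RawInput =>
    ((List.range r.2.1.length).map (fun v => Decidable.decide (v ∈ r.decide.2.1)),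
      ((List.range r.palette.length).filter (fun i => Decidable.decide (i ∈ r.decide.2.2.1))).map
        (fun i => r.palette.getD i []), Nat.bits r.decide.2.2.2)) (by fun_prop) fun I => ?_
  unfold tripleData
  rw [enc_prod, enc_prod]
  congr 1
  · change Data.ofBits _ = _
    congr 1
    rw [I.represents.length_eq, List.ofFn_eq_map, ← List.map_coe_finRange_eq_range, List.map_map]
    refine List.map_congr_left fun v _ => ?_
    exact decide_eq_decide.2 (I.mem_decidingSet v).symm
  · congr 1
    rw [raw_palette, List.length_map]
    -- Filtering the range lists the special indices in increasing order, and `color` is increasing;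
    -- this gives the sorted list required by `Data.ofFinset`.
    have h1 : ((List.range I.palette.length).filter
        fun i => Decidable.decide (i ∈ I.decision.2.2.1)).map I.color =
          I.budgetSet.sort (· ≤ ·) := by
      refine (sort_eq_of_pairwise ?_ fun a => ?_).symm
      · rw [List.pairwise_map]
        have h2 : ((List.range I.palette.length).filter
          fun i => Decidable.decide (i ∈ I.decision.2.2.1)).Pairwise (· < ·) :=
            List.pairwise_lt_range.filter _
        refine h2.imp_of_mem fun {i j} _ hj hij => I.color_lt_color ?_ hij
        simpa using (List.mem_filter.1 hj).1
      · simp only [budgetSet, List.mem_map, List.mem_filter, List.mem_range, decide_eq_true_eq,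
          Finset.mem_image, List.mem_toFinset]
        exact ⟨fun ⟨i, hi, h⟩ => ⟨i, hi.2, h⟩, fun ⟨i, hi, h⟩ => ⟨i, ⟨I.special_lt hi, hi⟩, h⟩⟩
    unfold Data.ofFinset
    rw [← h1, enc_list, List.map_map, List.map_map]
    refine congrArg Data.ofList (List.map_congr_left fun i hi => ?_)
    simp only [List.mem_filter, List.mem_range] at hi
    simp only [Function.comp_apply, color, List.getD_eq_getElem?_getD, List.getElem?_map,
      List.getElem?_eq_getElem hi.1, Option.map_some, Option.getD_some]
    rfl

end RegularInstance

/-! ### The compressed instance -/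

/-- The color `i` is in all lists of the vertices `verts`, and counts for the budget. -/
def isInterchangeable (M : List (List Bool)) (out : List ℕ × List ℕ × List ℕ × ℕ) (i : ℕ) : Bool :=
  decide (i ∈ out.2.2.1) && out.2.1.all fun v => ent M v i

/-- The colors of the compressed instance. -/
def keptColors (M : List (List Bool)) (out : List ℕ × List ℕ × List ℕ × ℕ) : List ℕ :=
  (out.1.filter fun i => !isInterchangeable M out i) ++
    (out.1.filter fun i => isInterchangeable M out i).take out.2.1.length

/-- The instance of Budget-Constrained List Coloring on some vertices of `G` and some colors. -/
noncomputable def restrictInstance (G : SimpleGraph ℕ) (L : ℕ → Finset ℕ)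
    (verts cols special : List ℕ) (q : ℕ) : BudgetInstance where
  n := verts.length
  c := cols.length
  graph := G.comap fun i => verts.get i
  lists i := Finset.univ.filter fun j => cols.get j ∈ L (verts.get i)
  special := Finset.univ.filter fun j => cols.get j ∈ special
  budget := q

theorem mem_restrictInstance_lists (G : SimpleGraph ℕ) (L : ℕ → Finset ℕ)
    (verts cols special : List ℕ) (q : ℕ) (i : Fin verts.length) (j : Fin cols.length) :
    (show Fin (restrictInstance G L verts cols special q).c from j) ∈
      (restrictInstance G L verts cols special q).lists i ↔ cols.get j ∈ L (verts.get i) := by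
  change j ∈ Finset.univ.filter (fun j : Fin cols.length => cols.get j ∈ L (verts.get i)) ↔ _
  rw [Finset.mem_filter, and_iff_right (Finset.mem_univ _)]

theorem mem_restrictInstance_special (G : SimpleGraph ℕ) (L : ℕ → Finset ℕ)
    (verts cols special : List ℕ) (q : ℕ) (j : Fin cols.length) :
    (show Fin (restrictInstance G L verts cols special q).c from j) ∈
      (restrictInstance G L verts cols special q).special ↔ cols.get j ∈ special := by
  change j ∈ Finset.univ.filter (fun j : Fin cols.length => cols.get j ∈ special) ↔ _
  rw [Finset.mem_filter, and_iff_right (Finset.mem_univ _)]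

/-- The lists of the restricted instance are cut down to `cols`, so membership in `cols` appears as
a separate condition. Injectivity of `cols.get` makes positions and colors interchangeable. -/
theorem restrictInstance_isYes {G : SimpleGraph ℕ} {L : ℕ → Finset ℕ} {verts cols : List ℕ}
    (special : List ℕ) (q : ℕ) (hv : verts.Nodup) (hc : cols.Nodup) :
    (restrictInstance G L verts cols special q).IsYes ↔
      ∃ col, IsPartialListColoring G L verts.toFinset col ∧
        (∀ v ∈ verts, col v ∈ cols) ∧
        (verts.toFinset.image col ∩ special.toFinset).card ≤ q := by
  have himage : ∀ (f : Fin verts.length → Fin cols.length) (col : ℕ → ℕ),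
      (∀ i, col (verts.get i) = cols.get (f i)) →
      (verts.toFinset.image col ∩ special.toFinset).card =
        (Finset.univ.image f ∩ Finset.univ.filter fun j => cols.get j ∈ special).card := by
    intro f col hf
    rw [← Finset.card_image_of_injective (f := cols.get) _ (List.nodup_iff_injective_get.1 hc)]
    congr 1
    ext a
    simp only [Finset.mem_inter, Finset.mem_image, List.mem_toFinset, Finset.mem_univ, true_and,
      Finset.mem_filter]
    constructor
    · rintro ⟨⟨v, hv, rfl⟩, h⟩
      obtain ⟨i, rfl⟩ := List.get_of_mem hv
      exact ⟨f i, ⟨⟨i, rfl⟩, hf i ▸ h⟩, (hf i).symm⟩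
    · rintro ⟨_, ⟨⟨i, rfl⟩, h⟩, rfl⟩
      exact ⟨⟨verts.get i, List.get_mem _ _, hf i⟩, h⟩
  constructor
  · rintro ⟨f, ⟨h1, h2⟩, h3⟩
    change Fin verts.length → Fin cols.length at f
    have hidx : ∀ i : Fin verts.length, verts.idxOf (verts.get i) = i :=
      fun i => List.get_idxOf hv i
    refine ⟨fun v => if h : verts.idxOf v < verts.length then cols.get (f ⟨verts.idxOf v, h⟩)
      else 0, ?_⟩
    have hcol : ∀ i : Fin verts.length, (if h : verts.idxOf (verts.get i) < verts.length then
        cols.get (f ⟨verts.idxOf (verts.get i), h⟩) else 0) = cols.get (f i) := by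
      intro i
      have : verts.idxOf (verts.get i) < verts.length := by rw [hidx]; exact i.2
      rw [dif_pos this]
      congr 2
      exact Fin.ext (hidx i)
    refine ⟨⟨fun v hv' => ?_, fun u hu v hv' huv => ?_⟩, fun v hv' => ?_, ?_⟩
    · obtain ⟨i, rfl⟩ := List.get_of_mem (List.mem_toFinset.1 hv')
      simp only [hcol]
      exact (mem_restrictInstance_lists G L verts cols special q i (f i)).1 (h1 i)
    · obtain ⟨i, rfl⟩ := List.get_of_mem (List.mem_toFinset.1 hu)
      obtain ⟨j, rfl⟩ := List.get_of_mem (List.mem_toFinset.1 hv')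
      simp only [hcol]
      exact fun h => h2 i j huv (List.nodup_iff_injective_get.1 hc h)
    · obtain ⟨i, rfl⟩ := List.get_of_mem hv'
      simp only [hcol]
      exact List.get_mem _ _
    · rw [himage f _ hcol]
      exact h3
  · rintro ⟨col, ⟨h1, h2⟩, h3, h4⟩
    have hf : ∀ i : Fin verts.length, ∃ j : Fin cols.length, cols.get j = col (verts.get i) :=
      fun i => List.get_of_mem (h3 _ (List.get_mem _ _))
    choose f hf using hf
    have hmem : ∀ i, verts.get i ∈ verts.toFinset := fun i =>
      List.mem_toFinset.2 (List.get_mem _ _)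
    refine ⟨f, ⟨fun (i : Fin verts.length) => ?_,
      fun (i j : Fin verts.length) hij (h : f i = f j) => ?_⟩, ?_⟩
    · refine (mem_restrictInstance_lists G L verts cols special q i (f i)).2 ?_
      rw [hf]
      exact h1 _ (hmem i)
    · exact h2 _ (hmem i) _ (hmem j) hij (by rw [← hf, ← hf, h])
    · rw [himage f col fun i => (hf i).symm] at h4
      exact h4

/-- The colors, given by their positions, that are missing at the vertex `v`. -/
def missingColors (M : List (List Bool)) (cols : List ℕ) (v : ℕ) : List ℕ :=
  (List.range cols.length).filter fun j => !ent M v (cols.getD j 0)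

/-- The code of `restrictInstance`. -/
def restrictCode (A M : List (List Bool)) (verts cols special : List ℕ) (q : ℕ) : List Bool :=
  natCode verts.length ++ natCode cols.length ++ natCode q ++
    (verts.map fun u => verts.map fun v => ent A u v).flatten ++
    (cols.map fun i => decide (i ∈ special)) ++
    (verts.map fun v => natCode (missingColors M cols v).length ++
      (missingColors M cols v).flatMap fun j => natCode j).flatten

@[fun_prop]
theorem PT.isInterchangeable {X : Type} [Enc X] {M : X → List (List Bool)}
    {out : X → List ℕ × List ℕ × List ℕ × ℕ} {i : X → ℕ} (hM : PT M) (ho : PT out) (hi : PT i) :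
    PT (fun x => isInterchangeable (M x) (out x) (i x)) := by
  unfold _root_.isInterchangeable; fun_prop

@[fun_prop]
theorem PT.keptColors {X : Type} [Enc X] {M : X → List (List Bool)}
    {out : X → List ℕ × List ℕ × List ℕ × ℕ} (hM : PT M) (ho : PT out) :
    PT (fun x => keptColors (M x) (out x)) := by
  unfold _root_.keptColors; fun_prop

@[fun_prop]
theorem PT.missingColors {X : Type} [Enc X] {M : X → List (List Bool)} {l : X → List ℕ} {v : X → ℕ}
    (hM : PT M) (hl : PT l) (hv : PT v) : PT (fun x => missingColors (M x) (l x) (v x)) := by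
  unfold _root_.missingColors; fun_prop

@[fun_prop]
theorem PT.restrictCode {X : Type} [Enc X] {A M : X → List (List Bool)} {l m s : X → List ℕ}
    {q : X → ℕ} (hA : PT A) (hM : PT M) (hl : PT l) (hm : PT m) (hs : PT s) (hq : PT q) :
    PT (fun x => restrictCode (A x) (M x) (l x) (m x) (s x) (q x)) := by
  unfold _root_.restrictCode; fun_prop

theorem map_get_finRange (l : List ℕ) : (List.finRange l.length).map l.get = l := by
  rw [← List.ofFn_eq_map, List.ofFn_get]

theorem ofFn_get {β : Type} (l : List ℕ) (f : ℕ → β) :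
    (List.ofFn fun i : Fin l.length => f (l.get i)) = l.map f := by
  conv_rhs => rw [← map_get_finRange l]
  rw [List.ofFn_eq_map, List.map_map]
  rfl

/-- The encoding involves classical decisions and sorted finite sets; here it is identified with an
expression in the two matrices that a program can evaluate. -/
theorem encode_restrictInstance {G : SimpleGraph ℕ} {L : ℕ → Finset ℕ} {n c : ℕ}
    {A M : List (List Bool)} (h : Represents G L n c A M) {verts cols : List ℕ}
    (hv : ∀ v ∈ verts, v < n) (hc : ∀ i ∈ cols, i < c) (special : List ℕ) (q : ℕ) :
    (restrictInstance G L verts cols special q).encode =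
      restrictCode A M verts cols special q := by
  unfold BudgetInstance.encode restrictCode
  have h1 : adjRows (restrictInstance G L verts cols special q).graph =
      verts.map fun u => verts.map fun v => ent A u v := by
    unfold adjRows
    have h2 : ∀ i j : Fin verts.length,
        @decide (G.Adj (verts.get i) (verts.get j)) (Classical.propDecidable _) =
          ent A (verts.get i) (verts.get j) := fun i j => by
      rw [Bool.eq_iff_iff, @decide_eq_true_iff _ (Classical.propDecidable _), h.adj _ (hv _ (List.get_mem _ _)) _
        (hv _ (List.get_mem _ _))]
    refine Eq.trans ?_ (ofFn_get verts fun u => verts.map fun v => ent A u v)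
    refine congrArg List.ofFn (funext fun i => ?_)
    refine Eq.trans ?_ (ofFn_get verts fun v => ent A (verts.get i) v)
    exact congrArg List.ofFn (funext fun j => h2 i j)
  have h2 : (List.ofFn fun a : Fin (restrictInstance G L verts cols special q).c =>
      decide (a ∈ (restrictInstance G L verts cols special q).special)) =
      cols.map fun i => decide (i ∈ special) := by
    refine Eq.trans ?_ (ofFn_get cols fun i => decide (i ∈ special))
    refine congrArg List.ofFn (funext fun j => decide_eq_decide.2 ?_)
    exact mem_restrictInstance_special G L verts cols special q j
  have h3 : (List.ofFn fun v : Fin (restrictInstance G L verts cols special q).n =>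
      colorSetCode ((restrictInstance G L verts cols special q).lists v)ᶜ) =
      verts.map fun v => natCode (missingColors M cols v).length ++
        (missingColors M cols v).flatMap fun j => natCode j := by
    refine Eq.trans ?_ (ofFn_get verts fun v => natCode (missingColors M cols v).length ++
        (missingColors M cols v).flatMap fun j => natCode j)
    refine congrArg List.ofFn (funext fun i => ?_)
    have h4 : ((((restrictInstance G L verts cols special q).lists i)ᶜ).sort (· ≤ ·)) =
        (List.finRange cols.length).filter fun j => !ent M (verts.get i) (cols.get j) := by
      have h5 : ((List.finRange cols.length).filter
          fun j => !ent M (verts.get i) (cols.get j)).toFinset =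
          ((restrictInstance G L verts cols special q).lists i)ᶜ := by
        ext j
        have h7 := h.mem _ (hv _ (List.get_mem verts i)) _ (hc _ (List.get_mem cols j))
        rw [List.mem_toFinset, List.mem_filter, and_iff_right (List.mem_finRange _),
          Bool.not_eq_true', ← Bool.not_eq_true,
          h7.trans (mem_restrictInstance_lists G L verts cols special q i j).symm]
        exact Finset.mem_compl.symm
      rw [← h5]
      have h6 := (List.sortedLT_finRange cols.length).pairwise.filter
        fun j => !ent M (verts.get i) (cols.get j)
      exact (List.toFinset_sort (· ≤ ·) (h6.imp fun h => h.ne)).2 (h6.imp fun h => h.le)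
    have h5 : missingColors M cols (verts.get i) = (((List.finRange cols.length).filter
        fun j => !ent M (verts.get i) (cols.get j)).map fun j : Fin cols.length => (j : ℕ)) := by
      unfold missingColors
      rw [← List.map_coe_finRange_eq_range, List.filter_map]
      congr 2
      funext j
      simp [List.getD_eq_getElem?_getD]
    unfold colorSetCode
    rw [← Finset.length_sort (· ≤ ·), h4, h5, List.length_map, List.flatMap_map]
    rfl
  rw [h1, h2, h3]
  rfl

/-! ### Correctness and number of the kept colors -/

section Kept

variable {G : SimpleGraph ℕ} {L : ℕ → Finset ℕ} {n c k : ℕ} {A M : List (List Bool)}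
  {T : Finset ℕ} {out : List ℕ × List ℕ × List ℕ × ℕ}

theorem keptColors_subset : ∀ i ∈ keptColors M out, i ∈ out.1 := by
  intro i hi
  rcases List.mem_append.1 hi with hi | hi
  · exact (List.mem_filter.1 hi).1
  · exact (List.mem_filter.1 (List.mem_of_mem_take hi)).1

theorem keptColors_nodup (h : out.1.Nodup) : (keptColors M out).Nodup := by
  refine List.Nodup.append (h.filter _) ((h.filter _).sublist (List.take_sublist _ _)) ?_
  intro i hi hi'
  have h1 := (List.mem_filter.1 hi).2
  have h2 := (List.mem_filter.1 (List.mem_of_mem_take hi')).2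
  simp [h2] at h1

/-- All discarded colors are interchangeable with kept ones, and a coloring of the chosen vertices
uses at most as many of them as there are vertices. -/
theorem exists_kept_iff (h : Represents G L n c A M) (D : Decides G L (Finset.range n)
    (Finset.range c) k out) :
    (∃ col, IsPartialListColoring G L out.2.1.toFinset col ∧
      (out.2.1.toFinset.image col ∩ out.2.2.1.toFinset).card ≤ out.2.2.2) ↔
    ∃ col, IsPartialListColoring G L out.2.1.toFinset col ∧
      (∀ v ∈ out.2.1, col v ∈ keptColors M out) ∧
      (out.2.1.toFinset.image col ∩ out.2.2.1.toFinset).card ≤ out.2.2.2 := by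
  refine ⟨fun ⟨col, h1, h2⟩ => ?_, fun ⟨col, h1, _, h2⟩ => ⟨col, h1, h2⟩⟩
  have hnd : (out.1.filter fun i => isInterchangeable M out i).Nodup := D.nodup_cols.filter _
  obtain ⟨col', h3, h4, h5⟩ := exists_coloring_of_interchangeable
    (A := out.2.2.1.toFinset) (U := (out.1.filter fun i => isInterchangeable M out i).toFinset)
    (K := ((out.1.filter fun i => isInterchangeable M out i).take out.2.1.length).toFinset)
    (fun i hi => by
      simp only [List.mem_toFinset, List.mem_filter, isInterchangeable, Bool.and_eq_true,
        decide_eq_true_eq] at hi ⊢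
      exact hi.2.1)
    (fun i hi v hv => by
      simp only [List.mem_toFinset, List.mem_filter, isInterchangeable, Bool.and_eq_true,
        decide_eq_true_eq, List.all_eq_true] at hi hv
      exact (h.mem v (Finset.mem_range.1 (D.verts_subset v hv)) i
        (Finset.mem_range.1 (D.cols_subset i hi.1))).1 (hi.2.2 v hv))
    (fun i hi => by
      rw [List.mem_toFinset] at hi ⊢
      exact List.mem_of_mem_take hi)
    (by
      rw [List.toFinset_card_of_nodup hnd, List.toFinset_card_of_nodup D.nodup_verts,
        List.toFinset_card_of_nodup (hnd.sublist (List.take_sublist _ _)), List.length_take])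
    h1
  refine ⟨col', h3, fun v hv => ?_, h5.trans h2⟩
  have h6 := h4 v (List.mem_toFinset.2 hv)
  rw [List.mem_toFinset, List.mem_toFinset] at h6
  have h7 : col' v ∈ out.1 :=
    List.mem_toFinset.1 (D.lists_subset v hv (h3.1 v (List.mem_toFinset.2 hv)))
  unfold keptColors
  rw [List.mem_append]
  by_cases h8 : isInterchangeable M out (col' v) = true
  · exact .inr (h6 (List.mem_filter.2 ⟨h7, h8⟩))
  · exact .inl (List.mem_filter.2 ⟨h7, by simpa using h8⟩)

/-- A color that is not interchangeable is uncharged (at most 11k) or missing at one of at most 11k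
vertices (at most k each); at most 11k interchangeable colors are kept. So 11k + 11k^2 + 11k ≤
33k^2. -/
theorem length_keptColors (h : Represents G L n c A M) (D : Decides G L (Finset.range n)
    (Finset.range c) k out) : (keptColors M out).length ≤ 33 * k ^ 2 := by
  have h1 : (out.1.filter fun i => !isInterchangeable M out i).toFinset ⊆
      (out.1.toFinset \ out.2.2.1.toFinset) ∪
        out.2.1.toFinset.biUnion fun v => out.1.toFinset \ L v := by
    intro i hi
    simp only [List.mem_toFinset, List.mem_filter, Bool.not_eq_true', ← Bool.not_eq_true,
      isInterchangeable, Bool.and_eq_true, decide_eq_true_eq, List.all_eq_true, not_and] at hi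
    simp only [Finset.mem_union, Finset.mem_sdiff, List.mem_toFinset, Finset.mem_biUnion]
    by_cases h2 : i ∈ out.2.2.1
    · have h3 := hi.2 h2
      push Not at h3
      obtain ⟨v, hv, h3⟩ := h3
      rw [Ne, h.mem v (Finset.mem_range.1 (D.verts_subset v hv)) i
        (Finset.mem_range.1 (D.cols_subset i hi.1))] at h3
      exact .inr ⟨v, hv, hi.1, h3⟩
    · exact .inl ⟨hi.1, h2⟩
  have h2 := (Finset.card_le_card h1).trans (Finset.card_union_le _ _)
  rw [List.toFinset_card_of_nodup (D.nodup_cols.filter _)] at h2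
  have h3 : (out.2.1.toFinset.biUnion fun v => out.1.toFinset \ L v).card ≤
      out.2.1.toFinset.card * k :=
    Finset.card_biUnion_le_card_mul _ _ _ fun v hv =>
      D.card_missing v (List.mem_toFinset.1 hv)
  rw [List.toFinset_card_of_nodup D.nodup_verts] at h3
  have h4 := D.card_sdiff
  have h5 := D.length_verts
  unfold keptColors
  rw [List.length_append, List.length_take]
  have h6 : min out.2.1.length (out.1.filter fun i => isInterchangeable M out i).length ≤ 11 * k :=
    (min_le_left _ _).trans h5
  have h7 : k ≤ k ^ 2 := Nat.le_self_pow (by norm_num) k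
  nlinarith [Nat.mul_le_mul_right k h5]

theorem length_missingColors (h : Represents G L n c A M) (D : Decides G L (Finset.range n)
    (Finset.range c) k out) {v : ℕ} (hv : v ∈ out.2.1) :
    (missingColors M (keptColors M out) v).length ≤ k := by
  refine le_trans ?_ (D.card_missing v hv)
  have hnd : (missingColors M (keptColors M out) v).Nodup := List.nodup_range.filter _
  rw [← List.toFinset_card_of_nodup hnd]
  have hget : ∀ j ∈ (missingColors M (keptColors M out) v).toFinset,
      ∃ hj : j < (keptColors M out).length, (keptColors M out).getD j 0 = (keptColors M out)[j] ∧
        ent M v (keptColors M out)[j] = false := by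
    intro j hj
    simp only [missingColors, List.mem_toFinset, List.mem_filter, List.mem_range,
      Bool.not_eq_true'] at hj
    refine ⟨hj.1, List.getD_eq_getElem _ _ hj.1, ?_⟩
    rw [← List.getD_eq_getElem _ 0 hj.1]
    exact hj.2
  refine Finset.card_le_card_of_injOn (fun j => (keptColors M out).getD j 0) (fun j hj => ?_)
    (fun i hi j hj hij => ?_)
  · obtain ⟨hj, h1, h2⟩ := hget j hj
    simp only
    rw [h1, Finset.mem_coe, Finset.mem_sdiff, List.mem_toFinset]
    have h3 := keptColors_subset _ (List.getElem_mem hj)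
    refine ⟨h3, fun h4 => ?_⟩
    rw [← h.mem v (Finset.mem_range.1 (D.verts_subset v hv)) _
      (Finset.mem_range.1 (D.cols_subset _ h3)), h2] at h4
    simp at h4
  · obtain ⟨hi, h1, -⟩ := hget i hi
    obtain ⟨hj, h2, -⟩ := hget j hj
    simp only [h1, h2] at hij
    exact (List.Nodup.getElem_inj_iff (keptColors_nodup D.nodup_cols)).1 hij

end Kept

/-! ### The length of the code -/

theorem length_natCode_le {m s : ℕ} (h : m < 2 ^ s) : (natCode m).length ≤ 2 * s + 1 := by
  have h1 : (Nat.bits m).length ≤ s := by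
    rw [Nat.size_eq_bits_len]
    exact Nat.size_le.2 h
  have h2 : ∀ l : List Bool, (l.flatMap fun b => [true, b]).length = 2 * l.length := by
    intro l
    induction l with
    | nil => rfl
    | cons b l ih =>
      rw [List.flatMap_cons, List.length_append, ih, List.length_cons, List.length_cons]
      simp
      omega
  rw [natCode, List.length_append, h2, List.length_singleton]
  omega

theorem length_flatten_le {α : Type} {l : List (List α)} {b : ℕ} (h : ∀ x ∈ l, x.length ≤ b) :
    l.flatten.length ≤ l.length * b := by
  rw [List.length_flatten]
  have := List.sum_le_card_nsmul (l.map List.length) b (by simpa using h)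
  simpa using this

/-- Every number in the code is less than 2^s and takes at most 2s + 1 bits. The adjacency matrix
and the characteristic vector take at most 121k^2 + 33k^2 = 154k^2 bits. -/
theorem length_restrictCode_le {A M : List (List Bool)} {verts cols special : List ℕ} {q k s : ℕ}
    (hn : verts.length ≤ 11 * k) (hc : cols.length ≤ 33 * k ^ 2) (hq : q ≤ 11 * k)
    (hmiss : ∀ v ∈ verts, (missingColors M cols v).length ≤ k) (hs : 33 * k ^ 2 < 2 ^ s) :
    (restrictCode A M verts cols special q).length ≤
      3 * (2 * s + 1) + 154 * k ^ 2 + 11 * k * ((2 * s + 1) + k * (2 * s + 1)) := by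
  have hk : k ≤ k ^ 2 := Nat.le_self_pow (by norm_num) k
  have h1 := length_natCode_le (m := verts.length) (s := s) (by omega)
  have h2 := length_natCode_le (m := cols.length) (s := s) (by omega)
  have h3 := length_natCode_le (m := q) (s := s) (by omega)
  have h4 := length_flatten_le (l := verts.map fun u => verts.map fun v => ent A u v)
    (b := verts.length) (by simp)
  have h5 := length_flatten_le (l := verts.map fun v => natCode (missingColors M cols v).length ++
      (missingColors M cols v).flatMap fun j => natCode j)
    (b := (2 * s + 1) + k * (2 * s + 1)) (by
      simp only [List.mem_map, forall_exists_index, and_imp]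
      rintro _ v hv rfl
      have h6 := hmiss v hv
      have h7 := length_natCode_le (m := (missingColors M cols v).length) (s := s) (by omega)
      have h8 := length_flatten_le (l := (missingColors M cols v).map fun j => natCode j)
        (b := 2 * s + 1) (by
          simp only [List.mem_map, forall_exists_index, and_imp]
          rintro _ j hj rfl
          refine length_natCode_le ?_
          have h9 := (List.mem_filter.1 hj).1
          rw [List.mem_range] at h9
          omega)
      rw [List.length_map] at h8
      rw [List.length_append, List.flatMap_def]
      have := Nat.mul_le_mul_right (2 * s + 1) h6
      omega)
  rw [List.length_map] at h4 h5
  have h6 := Nat.mul_le_mul_right ((2 * s + 1) + k * (2 * s + 1)) hn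
  have h7 := Nat.mul_le_mul hn hn
  have h8 : 11 * k * (11 * k) = 121 * k ^ 2 := by ring
  unfold restrictCode
  simp only [List.length_append, List.length_map]
  omega

/-- With l = log k, the choice s = 2l + 8 gives 2^s = 64 (2^(l+1))^2 > 33k^2. For k ≥ 2 one has l ≥
1, which absorbs the lower-order terms; for k ≤ 1 the logarithm vanishes and the summand 1 on the
right takes over. -/
theorem code_bound (k : ℕ) : ∃ s, 33 * k ^ 2 < 2 ^ s ∧
    3 * (2 * s + 1) + 154 * k ^ 2 + 11 * k * ((2 * s + 1) + k * (2 * s + 1)) ≤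
      1200 * (k ^ 2 * Nat.log 2 k + 1) := by
  refine ⟨2 * Nat.log 2 k + 8, ?_, ?_⟩
  · have h1 : k < 2 ^ (Nat.log 2 k + 1) := Nat.lt_pow_succ_log_self (by norm_num) k
    have h2 : k ^ 2 < (2 ^ (Nat.log 2 k + 1)) ^ 2 := Nat.pow_lt_pow_left h1 (by norm_num)
    have h3 : 2 ^ (2 * Nat.log 2 k + 8) = 64 * (2 ^ (Nat.log 2 k + 1)) ^ 2 := by ring
    omega
  · generalize hl : Nat.log 2 k = l
    rcases Nat.lt_or_ge k 2 with h | h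
    · have : l = 0 := by rw [← hl]; exact Nat.log_of_lt h
      subst this
      interval_cases k <;> norm_num
    · have h1 : 1 ≤ l := by rw [← hl]; exact Nat.log_pos (by norm_num) h
      have h2 : 2 * k ≤ k ^ 2 := by nlinarith
      have h3 : 4 ≤ k ^ 2 := by nlinarith
      have e1 : 11 * k * ((2 * (2 * l + 8) + 1) + k * (2 * (2 * l + 8) + 1)) =
          11 * (k + k ^ 2) * (4 * l + 17) := by ring
      rw [e1]
      nlinarith [Nat.mul_le_mul h3 h1, Nat.mul_le_mul h2 h1, Nat.mul_le_mul_left (k ^ 2) h1]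

/-! ### The compression and the main theorem -/

namespace RegularInstance

variable (I : RegularInstance)

/-- The compressed instance. -/
noncomputable def compress : BudgetInstance :=
  restrictInstance I.natGraph I.natLists I.decision.2.1 (keptColors I.raw.incidence I.decision)
    I.decision.2.2.1 I.decision.2.2.2

theorem compress_isYes_iff : I.IsYes ↔ I.compress.IsYes := by
  unfold compress
  rw [restrictInstance_isYes _ _ I.decision_spec.nodup_verts
    (keptColors_nodup I.decision_spec.nodup_cols), ← exists_kept_iff I.represents I.decision_spec,
    isYes_iff, I.decision_spec.iff]

theorem encode_compress : I.compress.encode = restrictCode I.raw.2.1 I.raw.incidence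
    I.decision.2.1 (keptColors I.raw.incidence I.decision) I.decision.2.2.1 I.decision.2.2.2 :=
  encode_restrictInstance I.represents
    (fun v hv => Finset.mem_range.1 (I.decision_spec.verts_subset v hv))
    (fun i hi => Finset.mem_range.1 (I.decision_spec.cols_subset i (keptColors_subset i hi))) _ _

theorem polyTimeComputable_compress : PolyTimeComputable RegularInstance.toData
    (fun I => Data.ofBits I.compress.encode) :=
  polyTimeComputable_of_pt (f := fun r : RawInput => restrictCode r.2.1 r.incidence
    r.decide.2.1 (keptColors r.incidence r.decide) r.decide.2.2.1 r.decide.2.2.2) (by fun_prop)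
    fun I => by rw [encode_compress]; rfl

theorem compress_c_le : I.compress.c ≤ 33 * I.k ^ 2 :=
  length_keptColors I.represents I.decision_spec

theorem length_encode_compress_le :
    I.compress.encode.length ≤ 1200 * (I.k ^ 2 * Nat.log 2 I.k + 1) := by
  obtain ⟨s, hs, h⟩ := code_bound I.k
  rw [encode_compress]
  exact (length_restrictCode_le I.decision_spec.length_verts I.compress_c_le
    (I.decision_spec.budget_le.trans I.decision_spec.length_verts)
    (fun v hv => length_missingColors I.represents I.decision_spec hv) hs).trans h

end RegularInstance

theorem mainTheorem4 :
    -- the compression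
    (∃ (f : RegularInstance → BudgetInstance) (A : ℕ),
      PolyTimeComputable RegularInstance.toData (fun I => Data.ofBits (f I).encode) ∧
      ∀ I : RegularInstance,
        (I.IsYes ↔ (f I).IsYes) ∧
        (f I).n ≤ 11 * I.k ∧
        (f I).c ≤ A * I.k ^ 2 ∧
        (f I).encode.length ≤ A * (I.k ^ 2 * Nat.log 2 I.k + 1)) ∧
    -- the small set of vertices that decides the instance
    (∃ (V' : (I : RegularInstance) → Finset (Fin I.n)) (T' : RegularInstance → Finset ℕ)
      (q : RegularInstance → ℕ),
      PolyTimeComputable RegularInstance.toData (fun I => tripleData (V' I) (T' I) (q I)) ∧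
      ∀ I : RegularInstance, 11 * I.k ≤ I.n →
        (V' I).card ≤ 7 * I.k ∧
        T' I ⊆ I.colors ∧
        (I.IsYes ↔ ∃ col : Fin I.n → ℕ,
          IsPartialListColoring I.graph I.lists (V' I) col ∧
          ((V' I).image col ∩ T' I).card ≤ q I)) := by
  refine ⟨⟨RegularInstance.compress, 1200, RegularInstance.polyTimeComputable_compress,
    fun I => ⟨I.compress_isYes_iff, I.decision_spec.length_verts,
      I.compress_c_le.trans (Nat.mul_le_mul_right _ (by norm_num)),
      I.length_encode_compress_le⟩⟩,
    RegularInstance.decidingSet, RegularInstance.budgetSet, RegularInstance.budget,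
    RegularInstance.polyTimeComputable_triple, fun I hI => ⟨?_, ?_, I.isYes_iff_decidingSet⟩⟩
  · rw [I.card_decidingSet]
    exact I.decision_spec.length_verts_of_le (by rwa [Finset.card_range])
  · intro a ha
    obtain ⟨i, hi, rfl⟩ := Finset.mem_image.1 ha
    exact I.color_mem (I.special_lt (List.mem_toFinset.1 hi))
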